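/- Let $m>0$ and $n\in\{2,3\}$, and put $N=2$ if $n=2$, $N=4$ if $n=3$. Let $\sigma_1,\sigma_2,\sigma_3$ be the Pauli matrices, and let $\mathcal D$ be the free massive Dirac operator on $L^2(\mathbb R^n;\mathbb C^N)$: $\mathcal D=-i(\sigma_1\partial_1+\sigma_2\partial_2)+m\sigma_3$ if $n=2$, and $\mathcal D=-i\sum_{k=1}^3\alpha_k\partial_k+m\beta$ with $\alpha_k=\begin{pmatrix}0&\sigma_k\\ \sigma_k&0\end{pmatrix}$, $\beta=\begin{pmatrix}\mathrm{Id}_2&0\\0&-\mathrm{Id}_2\end{pmatrix}$ if $n=3$. Functions of the self-adjoint operator $\mathcal D$ are taken in the sense of its Borel functional calculus; in particular $u(t)=e^{it\mathcal D}u_0$ is the solution of $i\partial_tu+\mathcal Du=0$, $u(0)=u_0$. For $F=F(t,x)$ with values in $\mathbb C^N$ let $$\|F\|_{L^p_tL^q_{r^{n-1}dr}L^2_\theta}=\Big(\int_{\mathbb R}\Big(\int_0^\infty\Big(\int_{S^{n-1}}|F(t,r\omega)|^2\,d\sigma(\omega)\Big)^{q/2}r^{n-1}\,dr\Big)^{p/q}dt\Big)^{1/p}$$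 (with the essential supremum in $t$ if $p=\infty$), where $\sigma$ is the surface measure on $S^{n-1}$. For $s\in\mathbb R$ let $\|u\|_{\dot H^s}=\big\||\nabla|^su\big\|_{L^2(\mathbb R^n)}\in[0,\infty]$ be the homogeneous Sobolev norm. Let $(p,q)$ satisfy - if $n=2$: $2<p\le\infty$, $2\le q<\infty$ and $\frac1p+\frac1q<\frac12$, or $(p,q)=(\infty,2)$; - if $n=3$: $2\le p\le\infty$, $2\le q<\infty$ and $\frac1p+\frac2q<1$, or $(p,q)=(\infty,2)$. Then there is a constant $C>0$, depending only on $n,m,p,q$, such that for every $u_0\in L^2(\mathbb R^n;\mathbb C^N)$, with $u_0^{low}=\chi_{[m,m+1]}(|\mathcal D|)u_0$ and $u_0^{high}=u_0-u_0^{low}$, $$\|e^{it\mathcal D}u_0^{low}\|_{L^p_tL^q_{r^{n-1}dr}L^2_\theta}\le C\|u_0^{low}\|_{\dot H^{\frac n2-\frac2p-\frac nq}},\qquad \|e^{it\mathcal D}u_0^{high}\|_{L^p_tL^q_{r^{n-1}dr}L^2_\theta}\le C\|u_0^{high}\|_{\dot H^{\frac n2-\frac1p-\frac nq}}.$$ (An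 estimate is void when its right-hand side is infinite.) -/

import Mathlib

open MeasureTheory Set
open scoped ENNReal FourierTransform SchwartzMap LineDeriv

noncomputable section

namespace Dirac

/-- The physical space `ℝⁿ` with its Euclidean norm. -/
abbrev Space (n : ℕ) : Type := EuclideanSpace ℝ (Fin n)

/-- The spinor space `ℂᴺ` with its Hermitian norm. -/
abbrev Spinor (N : ℕ) : Type := EuclideanSpace ℂ (Fin N)

/-- The Hilbert space `L²(ℝⁿ; ℂᴺ)`. -/
abbrev L2 (n N : ℕ) : Type := Lp (Spinor N) 2 (volume : Measure (Space n))

/-- Coefficient matrices `α₁, …, αₙ, β` of a Dirac operator: Hermitian `N × N` matrices that satisfy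
the Clifford relations. Only the two concrete families `matrices2` and `matrices3` below are
used. -/
structure Matrices (n N : ℕ) where
  α : Fin n → Matrix (Fin N) (Fin N) ℂ
  β : Matrix (Fin N) (Fin N) ℂ
  α_herm : ∀ i, (α i).IsHermitian
  β_herm : β.IsHermitian
  α_mul : ∀ i j, α i * α j + α j * α i = if i = j then 2 else 0
  α_mul_β : ∀ i, α i * β + β * α i = 0
  β_mul : β * β = 1

/-- The Pauli matrices `σ₁, σ₂, σ₃` (indexed by `0, 1, 2`). -/
def pauli : Fin 3 → Matrix (Fin 2) (Fin 2) ℂ :=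
  ![!![0, 1; 1, 0], !![0, -Complex.I; Complex.I, 0], !![1, 0; 0, -1]]

theorem pauli_herm (i : Fin 3) : (pauli i).IsHermitian := by
  fin_cases i <;>
  · ext a b
    fin_cases a <;> fin_cases b <;> simp [pauli]

theorem pauli_mul (i j : Fin 3) :
    pauli i * pauli j + pauli j * pauli i = if i = j then 2 else 0 := by
  have h2 : (2 : Matrix (Fin 2) (Fin 2) ℂ) = !![2, 0; 0, 2] := by
    ext a b
    fin_cases a <;> fin_cases b <;> simp [Matrix.ofNat_apply]
  fin_cases i <;> fin_cases j <;>
  · simp only [h2]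
    ext a b
    fin_cases a <;> fin_cases b <;> simp [pauli] <;> norm_num

/-- Two space dimensions, `N = 2`: `αₖ = σₖ` for `k = 1, 2` and `β = σ₃`. -/
def matrices2 : Matrices 2 2 where
  α k := pauli k.castSucc
  β := pauli 2
  α_herm k := pauli_herm _
  β_herm := pauli_herm _
  α_mul i j := by
    simp only [pauli_mul, Fin.castSucc_inj]
  α_mul_β i := by
    rw [pauli_mul, if_neg]
    exact (Fin.castSucc_lt_last i).ne
  β_mul := by
    ext a b
    fin_cases a <;> fin_cases b <;> simp [pauli]

/-- The `4 × 4` matrix with `2 × 2` blocks `A B; C D`. -/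
def block (A B C D : Matrix (Fin 2) (Fin 2) ℂ) : Matrix (Fin 4) (Fin 4) ℂ :=
  Matrix.reindexAlgEquiv ℂ ℂ (finSumFinEquiv : Fin 2 ⊕ Fin 2 ≃ Fin 4) (Matrix.fromBlocks A B C D)

theorem block_mul (A B C D A' B' C' D' : Matrix (Fin 2) (Fin 2) ℂ) :
    block A B C D * block A' B' C' D' =
      block (A * A' + B * C') (A * B' + B * D') (C * A' + D * C') (C * B' + D * D') := by
  simp only [block, ← map_mul, Matrix.fromBlocks_multiply]

theorem block_add (A B C D A' B' C' D' : Matrix (Fin 2) (Fin 2) ℂ) :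
    block A B C D + block A' B' C' D' = block (A + A') (B + B') (C + C') (D + D') := by
  simp only [block, ← map_add, Matrix.fromBlocks_add]

theorem block_one : block 1 0 0 1 = 1 := by
  simp only [block, Matrix.fromBlocks_one, map_one]

theorem block_zero : block 0 0 0 0 = 0 := by
  simp only [block, Matrix.fromBlocks_zero, map_zero]

theorem block_two : block 2 0 0 2 = 2 := by
  have h := block_add 1 0 0 1 1 0 0 1
  rw [block_one, one_add_one_eq_two, one_add_one_eq_two, add_zero] at h
  exact h.symm

theorem block_herm {A B C D : Matrix (Fin 2) (Fin 2) ℂ} (hA : A.IsHermitian)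
    (hB : B.conjTranspose = C) (hD : D.IsHermitian) : (block A B C D).IsHermitian := by
  rw [block, Matrix.coe_reindexAlgEquiv]
  exact (Matrix.IsHermitian.fromBlocks hA hB hD).submatrix _

/-- Three space dimensions, `N = 4`: `αₖ = (0 σₖ; σₖ 0)` for `k = 1, 2, 3` and
`β = (Id 0; 0 -Id)`. -/
def matrices3 : Matrices 3 4 where
  α k := block 0 (pauli k) (pauli k) 0
  β := block 1 0 0 (-1)
  α_herm k := block_herm Matrix.isHermitian_zero (pauli_herm k) Matrix.isHermitian_zero
  β_herm := block_herm Matrix.isHermitian_one Matrix.conjTranspose_zero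
    Matrix.isHermitian_one.neg
  α_mul i j := by
    simp only [block_mul, block_add, zero_mul, mul_zero, add_zero, zero_add, pauli_mul]
    split_ifs
    · exact block_two
    · exact block_zero
  α_mul_β i := by
    simp [block_mul, block_add, block_zero]
  β_mul := by
    simp [block_mul, block_one]

variable {n N : ℕ}

namespace Matrices

/-- The free Dirac operator `𝒟 u = -i ∑ₖ αₖ ∂ₖ u + m β u`, on the core of Schwartz functions. -/
def diracOp (𝔇 : Matrices n N) (m : ℝ) (u : 𝓢(Space n, Spinor N)) : 𝓢(Space n, Spinor N) :=
  -Complex.I • ∑ k, (∂_{(EuclideanSpace.single k 1 : Space n)} u).postcompCLM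
      (Matrix.toEuclideanCLM (𝕜 := ℂ) (𝔇.α k))
    + (m : ℂ) • u.postcompCLM (Matrix.toEuclideanCLM (𝕜 := ℂ) 𝔇.β)

/-- The matrix symbol of the Dirac operator. As `𝓕 u ξ = ∫ exp (-2πi x·ξ) u(x) dx`, the operator
`-i ∂ₖ` is multiplication by `2π ξₖ` on the Fourier side, so `𝒟` is multiplication by
`∑ₖ 2π ξₖ αₖ + m β`; this is checked in `fourier_diracOp`. -/
def symbol (𝔇 : Matrices n N) (m : ℝ) (ξ : Space n) : Spinor N →L[ℂ] Spinor N :=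
  Matrix.toEuclideanCLM (𝕜 := ℂ)
    (∑ k, ((2 * Real.pi * ξ k : ℝ) : ℂ) • 𝔇.α k + (m : ℂ) • 𝔇.β)

theorem fourier_postcompCLM (L : Spinor N →L[ℂ] Spinor N) (u : 𝓢(Space n, Spinor N))
    (ξ : Space n) : 𝓕 (u.postcompCLM L) ξ = L (𝓕 u ξ) := by
  rw [SchwartzMap.fourier_coe, SchwartzMap.fourier_coe, Real.fourier_eq, Real.fourier_eq,
    ← L.integral_comp_comm ((Real.fourierIntegral_convergent_iff ξ).2 u.integrable)]
  refine integral_congr_ae (Filter.Eventually.of_forall fun x => ?_)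
  simp only [Circle.smul_def, map_smul, SchwartzMap.postcompCLM_apply]

theorem fourier_diracOp (𝔇 : Matrices n N) (m : ℝ) (u : 𝓢(Space n, Spinor N)) (ξ : Space n) :
    𝓕 (𝔇.diracOp m u) ξ = 𝔇.symbol m ξ (𝓕 u ξ) := by
  have key (k : Fin n) : 𝓕 (∂_{(EuclideanSpace.single k 1 : Space n)} u) ξ
      = (2 * Real.pi * Complex.I) • (ξ k : ℂ) • 𝓕 u ξ := by
    have h : (inner ℝ · (EuclideanSpace.single k 1 : Space n)).HasTemperateGrowth := by fun_prop
    rw [SchwartzMap.fourier_lineDerivOp_eq, _root_.smul_apply,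
      SchwartzMap.smulLeftCLM_apply_apply h]
    simp [EuclideanSpace.inner_single_right]
  have hadd (v w : 𝓢(Space n, Spinor N)) : 𝓕 (v + w) = 𝓕 v + 𝓕 w := FourierTransform.fourier_add v w
  have hsmul (c : ℂ) (v : 𝓢(Space n, Spinor N)) : 𝓕 (c • v) = c • 𝓕 v :=
    FourierTransform.fourier_smul c v
  have hsum (v : Fin n → 𝓢(Space n, Spinor N)) : 𝓕 (∑ k, v k) ξ = ∑ k, 𝓕 (v k) ξ := by
    have h := map_sum (FourierTransform.fourierCLM ℂ 𝓢(Space n, Spinor N)) v Finset.univ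
    simp only [FourierTransform.fourierCLM_apply] at h
    rw [h]
    simp
  simp only [diracOp, symbol, hadd, hsmul, add_apply, _root_.smul_apply, hsum,
    fourier_postcompCLM, key, map_add, map_sum, map_smul, sum_apply, Finset.smul_sum, smul_smul]
  congr 1
  refine Finset.sum_congr rfl fun k _ => ?_
  congr 1
  push_cast
  linear_combination (-2 * Real.pi * ξ k : ℂ) * Complex.I_mul_I

theorem symbol_isSelfAdjoint (𝔇 : Matrices n N) (m : ℝ) (ξ : Space n) :
    IsSelfAdjoint (𝔇.symbol m ξ) := by
  refine IsSelfAdjoint.map ?_ (Matrix.toEuclideanCLM (𝕜 := ℂ) (n := Fin N))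
  refine IsSelfAdjoint.add (isSelfAdjoint_sum _ fun k _ => ?_) ?_
  · exact IsSelfAdjoint.smul (Complex.conj_ofReal _) (𝔇.α_herm k)
  · exact IsSelfAdjoint.smul (Complex.conj_ofReal _) 𝔇.β_herm

/-- `√(|2πξ|² + m²)`, the absolute value of the two eigenvalues of the symbol. -/
def energy (m : ℝ) (ξ : Space n) : ℝ := √((2 * Real.pi * ‖ξ‖) ^ 2 + m ^ 2)

theorem energy_sq (m : ℝ) (ξ : Space n) :
    energy m ξ ^ 2 = (2 * Real.pi * ‖ξ‖) ^ 2 + m ^ 2 :=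
  Real.sq_sqrt (by positivity)

theorem symbol_mul_self (𝔇 : Matrices n N) (m : ℝ) (ξ : Space n) :
    𝔇.symbol m ξ * 𝔇.symbol m ξ = ((energy m ξ ^ 2 : ℝ) : ℂ) • 1 := by
  have hM : ∀ c : Fin n → ℂ, (∑ k, c k • 𝔇.α k) * (∑ k, c k • 𝔇.α k) = (∑ k, c k ^ 2) • 1 := by
    intro c
    have h2 : (∑ k, c k • 𝔇.α k) * (∑ k, c k • 𝔇.α k) + (∑ k, c k • 𝔇.α k) * (∑ k, c k • 𝔇.α k)
        = ∑ i, ∑ j, (c i * c j) • (𝔇.α i * 𝔇.α j + 𝔇.α j * 𝔇.α i) := by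
      simp only [smul_add, Finset.sum_add_distrib]
      congr 1
      · simp only [Finset.sum_mul_sum, smul_mul_smul_comm]
      · rw [Finset.sum_comm]
        simp only [Finset.sum_mul_sum, smul_mul_smul_comm, mul_comm]
    simp only [𝔇.α_mul, smul_ite, smul_zero, Finset.sum_ite_eq, Finset.mem_univ, if_true] at h2
    rw [← two_smul ℂ] at h2
    have h3 : ∑ x, (c x * c x) • (2 : Matrix (Fin N) (Fin N) ℂ)
        = (2 : ℂ) • (∑ k, c k ^ 2) • (1 : Matrix (Fin N) (Fin N) ℂ) := by
      rw [← Finset.sum_smul, smul_comm, two_smul ℂ (1 : Matrix (Fin N) (Fin N) ℂ),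
        one_add_one_eq_two]
      simp only [sq]
    exact smul_right_injective _ (two_ne_zero (α := ℂ)) (h2.trans h3)
  have hcross : ∀ c : Fin n → ℂ,
      (∑ k, c k • 𝔇.α k) * 𝔇.β + 𝔇.β * (∑ k, c k • 𝔇.α k) = 0 := by
    intro c
    simp only [Finset.sum_mul, Finset.mul_sum, ← Finset.sum_add_distrib, smul_mul_assoc,
      mul_smul_comm, ← smul_add, 𝔇.α_mul_β, smul_zero, Finset.sum_const_zero]
  rw [symbol, ← map_mul, ← map_one (Matrix.toEuclideanCLM (𝕜 := ℂ) (n := Fin N)), ← map_smul]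
  congr 1
  rw [add_mul, mul_add, mul_add, hM, smul_mul_smul_comm, 𝔇.β_mul, mul_smul_comm, smul_mul_assoc]
  have h := hcross (fun k => ((2 * Real.pi * ξ k : ℝ) : ℂ))
  have hn : ((energy m ξ ^ 2 : ℝ) : ℂ)
      = ∑ k, ((2 * Real.pi * ξ k : ℝ) : ℂ) ^ 2 + (m : ℂ) * m := by
    rw [energy_sq, mul_pow, EuclideanSpace.norm_sq_eq, Finset.mul_sum]
    push_cast
    congr 1
    · refine Finset.sum_congr rfl fun k _ => ?_
      rw [← Complex.ofReal_pow ‖ξ.ofLp k‖, Real.norm_eq_abs, sq_abs]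
      push_cast
      ring
    · ring
  rw [hn, add_smul]
  have h' := congrArg (fun A => (m : ℂ) • A) h
  simp only [smul_add, smul_zero] at h'
  rw [← add_assoc, add_assoc (_ • _) (_ • _) (_ • _), h', add_zero]

theorem spectrum_symbol (𝔇 : Matrices n N) (m : ℝ) (ξ : Space n) :
    spectrum ℂ (𝔇.symbol m ξ) ⊆ {(energy m ξ : ℂ), -(energy m ξ : ℂ)} := by
  intro z hz
  by_contra hne
  have hne' : z ^ 2 ≠ (energy m ξ : ℂ) ^ 2 := fun h => hne (sq_eq_sq_iff_eq_or_eq_neg.1 h)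
  refine hz ?_
  set A := 𝔇.symbol m ξ
  have hA : A * A = ((energy m ξ : ℂ) ^ 2) • 1 := by
    rw [symbol_mul_self, Complex.ofReal_pow]
  have hc : z ^ 2 - (energy m ξ : ℂ) ^ 2 ≠ 0 := sub_ne_zero.2 hne'
  have h1 : (algebraMap ℂ _ z - A) * (algebraMap ℂ _ z + A)
      = (z ^ 2 - (energy m ξ : ℂ) ^ 2) • 1 := by
    rw [Algebra.algebraMap_eq_smul_one, sub_mul, mul_add, mul_add, hA]
    simp only [smul_mul_assoc, mul_smul_comm, one_mul, mul_one]
    module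
  have h2 : (algebraMap ℂ _ z + A) * (algebraMap ℂ _ z - A)
      = (z ^ 2 - (energy m ξ : ℂ) ^ 2) • 1 := by
    rw [Algebra.algebraMap_eq_smul_one, add_mul, mul_sub, mul_sub, hA]
    simp only [smul_mul_assoc, mul_smul_comm, one_mul, mul_one]
    module
  refine ⟨⟨_, (z ^ 2 - (energy m ξ : ℂ) ^ 2)⁻¹ • (algebraMap ℂ _ z + A), ?_, ?_⟩, rfl⟩
  · rw [mul_smul_comm, h1, smul_smul, inv_mul_cancel₀ hc, one_smul]
  · rw [smul_mul_assoc, h2, smul_smul, inv_mul_cancel₀ hc, one_smul]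

/-- The matrix `f(∑ₖ 2π ξₖ αₖ + m β)`, given by the functional calculus of the Hermitian matrix
`∑ₖ 2π ξₖ αₖ + m β`. Its spectrum is finite, so every function on it is continuous. -/
def funSymbol (𝔇 : Matrices n N) (m : ℝ) (f : ℝ → ℂ) (ξ : Space n) : Spinor N →L[ℂ] Spinor N :=
  cfc (fun z : ℂ => f z.re) (𝔇.symbol m ξ)

theorem funSymbol_eq (𝔇 : Matrices n N) (m : ℝ) (f : ℝ → ℂ) (ξ : Space n) :
    𝔇.funSymbol m f ξ = ((f (energy m ξ) + f (-energy m ξ)) / 2) • 1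
      + ((f (energy m ξ) - f (-energy m ξ)) / (2 * energy m ξ)) • 𝔇.symbol m ξ := by
  have hn : IsStarNormal (𝔇.symbol m ξ) := (𝔇.symbol_isSelfAdjoint m ξ).isStarNormal
  set a := (f (energy m ξ) + f (-energy m ξ)) / 2 with ha
  set b := (f (energy m ξ) - f (-energy m ξ)) / (2 * energy m ξ) with hb
  have hE : (spectrum ℂ (𝔇.symbol m ξ)).EqOn (fun z : ℂ => f z.re) (fun z => a + b * z) := by
    intro z hz
    rcases eq_or_ne (energy m ξ) 0 with h0 | h0
    · have : z = 0 := by simpa [h0] using 𝔇.spectrum_symbol m ξ hz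
      simp [ha, hb, this, h0]
    · have h0' : (energy m ξ : ℂ) ≠ 0 := by exact_mod_cast h0
      rcases 𝔇.spectrum_symbol m ξ hz with rfl | rfl <;>
      · simp only [ha, hb, Complex.ofReal_re, Complex.neg_re]
        field_simp
        ring
  rw [funSymbol, cfc_congr hE, cfc_const_add a (fun z => b * z) (𝔇.symbol m ξ),
    cfc_const_mul_id b (𝔇.symbol m ξ),
    Algebra.algebraMap_eq_smul_one]

theorem measurable_energy (m : ℝ) : Measurable (energy (n := n) m) := by
  unfold energy
  fun_prop

theorem continuous_symbol (𝔇 : Matrices n N) (m : ℝ) : Continuous (𝔇.symbol m) := by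
  have h : 𝔇.symbol m = fun ξ => ∑ k, ((2 * Real.pi * ξ k : ℝ) : ℂ) •
      Matrix.toEuclideanCLM (𝕜 := ℂ) (𝔇.α k) + (m : ℂ) • Matrix.toEuclideanCLM (𝕜 := ℂ) 𝔇.β := by
    ext1 ξ
    simp only [symbol, map_add, map_sum, map_smul]
  rw [h]
  fun_prop

theorem memLp_funSymbol (𝔇 : Matrices n N) (m : ℝ) {f : ℝ → ℂ} (hf : Measurable f)
    (hb : ∃ C : ℝ, ∀ E, ‖f E‖ ≤ C) (v : L2 n N) :
    MemLp (fun ξ => 𝔇.funSymbol m f ξ (v ξ)) 2 volume := by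
  obtain ⟨C, hC⟩ := hb
  have hC0 : 0 ≤ C := (norm_nonneg _).trans (hC 0)
  have hv := Lp.memLp v
  refine MemLp.of_le_mul (c := C) hv ?_ (Filter.Eventually.of_forall fun ξ => ?_)
  · simp only [funSymbol_eq, add_apply, _root_.smul_apply, one_apply_eq_self]
    have hE := measurable_energy (n := n) m
    have h1 : Measurable fun ξ : Space n => (f (energy m ξ) + f (-energy m ξ)) / 2 := by
      fun_prop
    have h2 : Measurable fun ξ : Space n =>
        (f (energy m ξ) - f (-energy m ξ)) / (2 * energy m ξ) := by
      fun_prop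
    have h3 : AEStronglyMeasurable (fun ξ => 𝔇.symbol m ξ (v ξ)) volume :=
      (isBoundedBilinearMap_apply (𝕜 := ℂ) (E := Spinor N) (F := Spinor N)).continuous
        |>.comp_aestronglyMeasurable ((𝔇.continuous_symbol m).aestronglyMeasurable.prodMk hv.1)
    exact (h1.aestronglyMeasurable.smul hv.1).add (h2.aestronglyMeasurable.smul h3)
  · refine (ContinuousLinearMap.le_opNorm _ _).trans ?_
    gcongr
    exact norm_cfc_le hC0 fun z _ => hC _

/-- The bounded Borel functional calculus `f(𝒟)` of the free Dirac operator on `L²(ℝⁿ; ℂᴺ)`: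
`𝓕 (f(𝒟) u) (ξ) = f(∑ₖ 2π ξₖ αₖ + m β) 𝓕 u (ξ)`. -/
def funCalc (𝔇 : Matrices n N) (m : ℝ) (f : ℝ → ℂ) (hf : Measurable f)
    (hb : ∃ C : ℝ, ∀ E, ‖f E‖ ≤ C) (u : L2 n N) : L2 n N :=
  𝓕⁻ ((𝔇.memLp_funSymbol m hf hb (𝓕 u)).toLp)

/-- The propagator `e^{it𝒟}`. -/
def propagator (𝔇 : Matrices n N) (m t : ℝ) : L2 n N → L2 n N :=
  𝔇.funCalc m (fun E => Complex.exp (Complex.I * t * E)) (by fun_prop)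
    ⟨1, fun E => by
      rw [mul_assoc, ← Complex.ofReal_mul, mul_comm, Complex.norm_exp_ofReal_mul_I]⟩

/-- The low energy part `u^low = χ_{[m, m+1]}(|𝒟|) u`. -/
def low (𝔇 : Matrices n N) (m : ℝ) : L2 n N → L2 n N :=
  𝔇.funCalc m (fun E => (Icc m (m + 1)).indicator 1 |E|)
    ((measurable_one.indicator measurableSet_Icc).comp measurable_norm)
    ⟨1, fun E => by by_cases h : |E| ∈ Icc m (m + 1) <;> simp [h]⟩

/-- The high energy part `u^high = u - u^low`. -/
def high (𝔇 : Matrices n N) (m : ℝ) (u : L2 n N) : L2 n N := u - 𝔇.low m u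

end Matrices

/-- The norm of the homogeneous Sobolev space `Ḣˢ(ℝⁿ)`, that is
`(∫ |2πξ|^{2s} |𝓕 u (ξ)|² dξ)^{1/2}`, with values in `[0, ∞]`. -/
def sobolevNorm (s : ℝ) (u : L2 n N) : ℝ≥0∞ :=
  eLpNorm (fun ξ => (2 * Real.pi * ‖ξ‖) ^ s • (𝓕 u : L2 n N) ξ) 2 volume

/-- The norm of `L^q_{r^{n-1}dr} L²_ω` in polar coordinates `x = rω`: on the sphere, `toSphere` is the
surface measure, and `volumeIoiPow (n - 1)` is the measure `r^{n-1} dr` on `(0, ∞)`. -/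
def polarNorm (q : ℝ≥0∞) (v : Space n → Spinor N) : ℝ≥0∞ :=
  eLpNorm (fun r : Ioi (0 : ℝ) =>
    eLpNorm (fun ω : Metric.sphere (0 : Space n) 1 => v (r.1 • ω.1)) 2
      (volume : Measure (Space n)).toSphere) q (Measure.volumeIoiPow (n - 1))

/-- The norm of `L^p_t L^q_{r^{n-1}dr} L²_ω`, the time variable running over `ℝ`. -/
def mixedNorm (p q : ℝ≥0∞) (F : ℝ → Space n → Spinor N) : ℝ≥0∞ :=
  eLpNorm (fun t => polarNorm q (F t)) p volume

end Dirac

end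

/-!
On the Fourier side the propagator is multiplication by `exp (itE) Π₊ + exp (-itE) Π₋`, with
`E = √(|2πξ|² + m²)` and `Π₊`, `Π₋` the spectral projections of the symbol. So the solution is a
superposition of waves with dispersion relation `±E`, and after a dyadic decomposition in frequency
(`enorm_propagator_le_tsum`) it is enough to treat a wave `v` with frequencies in a shell
`ℓ ≤ |ξ| < 2ℓ`, on which the group speed is at least `w`. Since the angular norm is only `L²`, no
dispersive estimate and no expansion in spherical harmonics is needed. Four `L²` bounds carry the
argument: `v` is square integrable in time at each point of space, the integral of `|v|²` over time
and a ball of radius `R` is at most a multiple of `R / w` (local smoothing), and `v` is bounded in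
space at a fixed time, in `L²` and pointwise. All four are instances of the Schur test
`oscillatory_lintegral_le`, with point masses or with Gaussian weights, whose Fourier transforms are
explicit and positive.

The one-dimensional Sobolev inequality along rays turns these bounds into bounds for the integral of
`|v|²` over the sphere of radius `r`, for `r` in a dyadic interval `[R, 2R)`: it is controlled by a
function of time that is bounded and integrable (`exists_energy`). Interpolation in `r` and `t` gives
the estimate of one piece, `exists_dyadic_bound`: the power of `ℓ` and the factor `w ^ (-1/p)` are
those of the theorem, and there is a gain of `min (Rℓ) (Rℓ)⁻¹ ^ δ`. The exponent `δ` can be taken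
positive because `q < ∞`, for `Rℓ ≤ 1`, and `1/p < (n - 1) (1/2 - 1/q)`, for `Rℓ ≥ 1`; the latter is
exactly the hypothesis on `(p, q)` for `n = 2, 3`. As `p, q ≥ 2`, the norm of the sum over `R` is at
most the `ℓ²` sum of the norms (`mixedNorm_le`), and with the gain the sum over `ℓ` is a convolution,
which Young's inequality on `ℤ` estimates by the `ℓ²` sum of the data, that is, by the Sobolev norm.

At low energy `w` is comparable to `ℓ`, at high energy to `1`; this is the only difference between
the two estimates. For `(p, q) = (∞, 2)` both are Plancherel's theorem.
-/

noncomputable section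

namespace Dirac

/-! ### The Schur test for oscillatory integrals, Gaussian weights, polar coordinates -/

section

/-- Schur's test in `TT*` form: the square of the norm is expanded, and the integral over `y` is taken
first. Of the resulting kernel only the absolute value matters. -/
theorem oscillatory_lintegral_le {X Y H : Type*} [MeasurableSpace X] [MeasurableSpace Y]
    [NormedAddCommGroup H] [InnerProductSpace ℂ H] [CompleteSpace H]
    {μ : Measure X} [SFinite μ] {ν : Measure Y} [IsFiniteMeasure ν]
    {θ : Y → X → ℝ} (hθ : Measurable (Function.uncurry θ)) {g : X → H} (hg : Integrable g μ)
    {K : X → X → ℝ≥0∞} (hKm : Measurable (Function.uncurry K)) (hKs : ∀ ξ η, K ξ η = K η ξ)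
    (hK : ∀ ξ η, ‖∫ y, Complex.exp ((θ y ξ - θ y η : ℝ) * Complex.I) ∂ν‖ₑ ≤ K ξ η)
    {B : ℝ≥0∞} (hB : ∀ᵐ ξ ∂μ, ∫⁻ η, K ξ η ∂μ ≤ B) :
    ∫⁻ y, ‖∫ ξ, Complex.exp ((θ y ξ : ℝ) * Complex.I) • g ξ ∂μ‖ₑ ^ 2 ∂ν
      ≤ B * ∫⁻ ξ, ‖g ξ‖ₑ ^ 2 ∂μ := by
  set V : Y → H := fun y => ∫ ξ, Complex.exp ((θ y ξ : ℝ) * Complex.I) • g ξ ∂μ with hV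
  have hθ1 (y : Y) : Measurable (θ y) := hθ.comp measurable_prodMk_left
  have hexp : Measurable fun x : ℝ => Complex.exp ((x : ℂ) * Complex.I) := by fun_prop
  have hint (y : Y) : Integrable (fun ξ => Complex.exp ((θ y ξ : ℝ) * Complex.I) • g ξ) μ := by
    refine hg.mono ((hexp.comp (hθ1 y)).aestronglyMeasurable.smul hg.1) (ae_of_all _ fun ξ => ?_)
    rw [norm_smul, Complex.norm_exp_ofReal_mul_I, one_mul]
  -- the square of the norm as a double integral
  have hsq (y : Y) : inner ℂ (V y) (V y) = ∫ z : X × X,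
      Complex.exp ((θ y z.1 - θ y z.2 : ℝ) * Complex.I) * inner ℂ (g z.2) (g z.1) ∂(μ.prod μ) := by
    have h1 : inner ℂ (V y) (V y) = ∫ ξ, ∫ η, Complex.exp ((θ y ξ - θ y η : ℝ) * Complex.I) *
        inner ℂ (g η) (g ξ) ∂μ ∂μ := by
      rw [hV, ← integral_inner (hint y)]
      refine integral_congr_ae (ae_of_all _ fun ξ => ?_)
      simp only
      rw [← inner_conj_symm, ← integral_inner (hint y), ← integral_conj]
      refine integral_congr_ae (ae_of_all _ fun η => ?_)
      simp only [inner_smul_left, inner_smul_right, map_mul, inner_conj_symm, ← Complex.exp_conj,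
        Complex.conj_ofReal, Complex.conj_I, map_neg, neg_neg]
      rw [← mul_assoc, ← Complex.exp_add]
      congr 2
      push_cast
      ring
    rw [h1, integral_prod]
    refine Integrable.mono (hg.norm.mul_prod hg.norm) ?_ (ae_of_all _ fun z => ?_)
    · refine AEStronglyMeasurable.mul ?_ ?_
      · refine (hexp.comp ?_).aestronglyMeasurable
        exact ((hθ1 y).comp measurable_fst).sub ((hθ1 y).comp measurable_snd)
      · exact hg.1.comp_snd.inner hg.1.comp_fst
    · rw [norm_mul, Complex.norm_exp_ofReal_mul_I, one_mul, norm_mul, norm_norm, norm_norm,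
        mul_comm]
      exact norm_inner_le_norm _ _
  have hbig : Integrable (Function.uncurry fun (y : Y) (z : X × X) =>
      Complex.exp ((θ y z.1 - θ y z.2 : ℝ) * Complex.I) * inner ℂ (g z.2) (g z.1))
      (ν.prod (μ.prod μ)) := by
    refine Integrable.mono ((integrable_const (1 : ℝ)).mul_prod (hg.norm.mul_prod hg.norm)) ?_
      (ae_of_all _ fun z => ?_)
    · refine AEStronglyMeasurable.mul ?_ ?_
      · have h1 : Measurable fun z : Y × X × X => θ z.1 z.2.1 :=
          hθ.comp (measurable_fst.prodMk measurable_snd.fst)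
        have h2 : Measurable fun z : Y × X × X => θ z.1 z.2.2 :=
          hθ.comp (measurable_fst.prodMk measurable_snd.snd)
        exact (hexp.comp (h1.sub h2)).aestronglyMeasurable
      · exact (hg.1.comp_snd.inner hg.1.comp_fst).comp_snd
    · simp only [Function.uncurry]
      rw [norm_mul, Complex.norm_exp_ofReal_mul_I, one_mul, one_mul, norm_mul, norm_norm,
        norm_norm, mul_comm]
      exact norm_inner_le_norm _ _
  have hswap : ∫ y, inner ℂ (V y) (V y) ∂ν = ∫ z : X × X,
      (∫ y, Complex.exp ((θ y z.1 - θ y z.2 : ℝ) * Complex.I) ∂ν) * inner ℂ (g z.2) (g z.1)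
        ∂(μ.prod μ) := by
    simp_rw [hsq]
    rw [integral_integral_swap hbig]
    refine integral_congr_ae (ae_of_all _ fun z => ?_)
    exact integral_mul_const _ _
  have hVint : Integrable (fun y => inner ℂ (V y) (V y)) ν := by
    simp_rw [hsq]
    exact hbig.integral_prod_left
  have hlhs : ∫⁻ y, ‖V y‖ₑ ^ 2 ∂ν = ‖∫ y, inner ℂ (V y) (V y) ∂ν‖ₑ := by
    have h2 (y : Y) : inner ℂ (V y) (V y) = ((‖V y‖ ^ 2 : ℝ) : ℂ) := by
      rw [inner_self_eq_norm_sq_to_K]; norm_cast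
    have h3 : Integrable (fun y => ‖V y‖ ^ 2) ν := by
      refine hVint.re.congr (ae_of_all _ fun y => ?_)
      simp only [h2]
      exact Complex.ofReal_re _
    simp_rw [h2]
    rw [integral_complex_ofReal, ← ofReal_norm, Complex.norm_real,
      Real.norm_of_nonneg (integral_nonneg fun y => by positivity),
      ofReal_integral_eq_lintegral_ofReal h3 (ae_of_all _ fun y => by positivity)]
    refine lintegral_congr fun y => ?_
    rw [ENNReal.ofReal_pow (norm_nonneg _), ofReal_norm]
  have hgm : AEMeasurable (fun ξ => ‖g ξ‖ₑ) μ := hg.1.enorm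
  calc ∫⁻ y, ‖V y‖ₑ ^ 2 ∂ν
      ≤ ∫⁻ z : X × X, K z.1 z.2 * ((‖g z.1‖ₑ ^ 2 + ‖g z.2‖ₑ ^ 2) / 2) ∂(μ.prod μ) := by
        rw [hlhs, hswap]
        refine (enorm_integral_le_lintegral_enorm _).trans (lintegral_mono fun z => ?_)
        rw [enorm_mul]
        refine mul_le_mul' (hK _ _) ?_
        rw [ENNReal.le_div_iff_mul_le (by simp) (by simp)]
        simp only [← ofReal_norm]
        rw [← ENNReal.ofReal_pow (norm_nonneg _), ← ENNReal.ofReal_pow (norm_nonneg _),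
          ← ENNReal.ofReal_add (by positivity) (by positivity), ← ENNReal.ofReal_ofNat,
          ← ENNReal.ofReal_mul (norm_nonneg _)]
        refine ENNReal.ofReal_le_ofReal ?_
        have h := norm_inner_le_norm (𝕜 := ℂ) (g z.2) (g z.1)
        nlinarith [two_mul_le_add_sq ‖g z.1‖ ‖g z.2‖]
    _ = (∫⁻ z : X × X, K z.1 z.2 * ‖g z.1‖ₑ ^ 2 ∂(μ.prod μ)
          + ∫⁻ z : X × X, K z.1 z.2 * ‖g z.2‖ₑ ^ 2 ∂(μ.prod μ)) / 2 := by
        rw [← lintegral_add_left' , ENNReal.div_eq_inv_mul, ← lintegral_const_mul' _ _ (by simp)]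
        · refine lintegral_congr fun z => ?_
          rw [ENNReal.div_eq_inv_mul]
          ring
        · exact hKm.aemeasurable.mul (hgm.comp_fst.pow_const 2)
    _ = ∫⁻ z : X × X, K z.1 z.2 * ‖g z.1‖ₑ ^ 2 ∂(μ.prod μ) := by
        have h : ∫⁻ z : X × X, K z.1 z.2 * ‖g z.2‖ₑ ^ 2 ∂(μ.prod μ)
            = ∫⁻ z : X × X, K z.1 z.2 * ‖g z.1‖ₑ ^ 2 ∂(μ.prod μ) := by
          rw [← lintegral_prod_swap]
          refine lintegral_congr fun z => ?_
          simp [hKs z.1 z.2]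
        rw [h, ← two_mul, mul_comm, ENNReal.mul_div_cancel_right (by simp) (by simp)]
    _ = ∫⁻ ξ, (∫⁻ η, K ξ η ∂μ) * ‖g ξ‖ₑ ^ 2 ∂μ := by
        rw [lintegral_prod (fun z : X × X => K z.1 z.2 * ‖g z.1‖ₑ ^ 2)
          (hKm.aemeasurable.mul (hgm.comp_fst.pow_const 2))]
        refine lintegral_congr fun ξ => ?_
        exact lintegral_mul_const (‖g ξ‖ₑ ^ 2) (f := K ξ) (hKm.comp measurable_prodMk_left)
    _ ≤ ∫⁻ ξ, B * ‖g ξ‖ₑ ^ 2 ∂μ := by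
        refine lintegral_mono_ae (hB.mono fun ξ h => ?_)
        gcongr
    _ = B * ∫⁻ ξ, ‖g ξ‖ₑ ^ 2 ∂μ := lintegral_const_mul'' _ (hgm.pow_const 2)

/-- The Gaussian measure with density `exp (-b |v|²)`. -/
def gauss (V : Type*) [NormedAddCommGroup V] [MeasureSpace V] (b : ℝ) : Measure V :=
  volume.withDensity fun v => ENNReal.ofReal (Real.exp (-b * ‖v‖ ^ 2))

section Gauss

variable {V : Type*} [NormedAddCommGroup V] [InnerProductSpace ℝ V] [FiniteDimensional ℝ V]
  [MeasurableSpace V] [BorelSpace V]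

theorem integrable_exp_neg_mul_norm_sq {b : ℝ} (hb : 0 < b) :
    Integrable fun v : V => Real.exp (-b * ‖v‖ ^ 2) := by
  have h := (GaussianFourier.integrable_cexp_neg_mul_sq_norm_add (V := V) (b := b)
    (by simpa using hb) 0 0).norm
  refine h.congr (ae_of_all _ fun v => ?_)
  simp only [Complex.norm_exp]
  norm_cast
  simp

theorem lintegral_exp_neg_mul_norm_sq {b : ℝ} (hb : 0 < b) :
    ∫⁻ v : V, ENNReal.ofReal (Real.exp (-b * ‖v‖ ^ 2))
      = ENNReal.ofReal ((Real.pi / b) ^ (Module.finrank ℝ V / 2 : ℝ)) := by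
  rw [← ofReal_integral_eq_lintegral_ofReal (integrable_exp_neg_mul_norm_sq hb)
    (ae_of_all _ fun v => (Real.exp_pos _).le), GaussianFourier.integral_rexp_neg_mul_sq_norm hb]

theorem isFiniteMeasure_gauss {b : ℝ} (hb : 0 < b) : IsFiniteMeasure (gauss V b) :=
  isFiniteMeasure_withDensity_ofReal (integrable_exp_neg_mul_norm_sq hb).2

/-- The Fourier transform of a Gaussian. -/
theorem integral_gauss_char {b : ℝ} (hb : 0 < b) (w : V) :
    ∫ v, Complex.exp ((inner ℝ w v : ℝ) * Complex.I) ∂(gauss V b)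
      = (((Real.pi / b) ^ (Module.finrank ℝ V / 2 : ℝ) * Real.exp (-‖w‖ ^ 2 / (4 * b)) : ℝ) : ℂ) := by
  rw [gauss, integral_withDensity_eq_integral_toReal_smul (by fun_prop) (by simp)]
  have h := GaussianFourier.integral_cexp_neg_mul_sq_norm_add (V := V) (b := b)
    (by simpa using hb) Complex.I w
  have h2 (v : V) : (ENNReal.ofReal (Real.exp (-b * ‖v‖ ^ 2))).toReal •
      Complex.exp ((inner ℝ w v : ℝ) * Complex.I)
      = Complex.exp (-b * ‖v‖ ^ 2 + Complex.I * inner ℝ w v) := by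
    rw [ENNReal.toReal_ofReal (Real.exp_pos _).le, Complex.exp_add, Complex.real_smul]
    push_cast
    rw [mul_comm (Complex.I)]
  simp_rw [h2]
  rw [h, Complex.ofReal_mul, Complex.ofReal_cpow (by positivity), Complex.ofReal_exp]
  push_cast
  rw [Complex.I_sq]
  congr 2
  ring

end Gauss

section Polar

variable {n : ℕ}

theorem lintegral_volumeIoiPow (k : ℕ) (f : ℝ → ℝ≥0∞) :
    ∫⁻ r, f r.1 ∂(Measure.volumeIoiPow k) = ∫⁻ r in Ioi (0 : ℝ), ENNReal.ofReal (r ^ k) * f r := by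
  rw [Measure.volumeIoiPow, lintegral_withDensity_eq_lintegral_mul_non_measurable _ (by fun_prop)
    (ae_of_all _ fun r => ENNReal.ofReal_lt_top),
    ← lintegral_subtype_comap measurableSet_Ioi]
  rfl

/-- Polar coordinates. The change of variables is a homeomorphism of the punctured space, so `f` need
not be measurable. -/
theorem lintegral_polar_prod [NeZero n] (f : Space n → ℝ≥0∞) :
    ∫⁻ x, f x = ∫⁻ p, f (p.2.1 • p.1.1) ∂((volume : Measure (Space n)).toSphere.prod
      (Measure.volumeIoiPow (n - 1))) := by
  have hmp := (volume : Measure (Space n)).measurePreserving_homeomorphUnitSphereProd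
  rw [finrank_euclideanSpace_fin] at hmp
  rw [← hmp.lintegral_comp_emb (Homeomorph.measurableEmbedding _)]
  have : Nontrivial (Space n) := Module.nontrivial_of_finrank_pos (R := ℝ)
    (by rw [finrank_euclideanSpace_fin]; exact Nat.pos_of_ne_zero (NeZero.ne n))
  have h0 : ∫⁻ x, f x = ∫⁻ x in {(0 : Space n)}ᶜ, f x := by rw [restrict_compl_singleton]
  rw [h0, ← lintegral_subtype_comap (measurableSet_singleton _).compl]
  refine lintegral_congr fun x => ?_
  have hx : ‖x.1‖ ≠ 0 := norm_ne_zero_iff.2 x.2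
  simp [smul_smul, hx]

theorem lintegral_polar [NeZero n] {f : Space n → ℝ≥0∞} (hf : Measurable f) :
    ∫⁻ x, f x = ∫⁻ ω : Metric.sphere (0 : Space n) 1,
      ∫⁻ r in Ioi (0 : ℝ), ENNReal.ofReal (r ^ (n - 1)) * f (r • ω.1)
        ∂(volume : Measure ℝ) ∂(volume : Measure (Space n)).toSphere := by
  rw [lintegral_polar_prod, lintegral_prod _ (by fun_prop)]
  refine lintegral_congr fun ω => ?_
  exact lintegral_volumeIoiPow (n - 1) fun r => f (r • ω.1)

/-- A Gaussian of width `1 / μ` on the sphere has mass of order `μ ^ (-(n - 1))`. -/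
theorem exists_lintegral_sphere_exp_le (n : ℕ) [NeZero n] : ∃ C : ℝ, 0 < C ∧
    ∀ (θ : Metric.sphere (0 : Space n) 1) (μ : ℝ), 0 < μ →
      ∫⁻ φ : Metric.sphere (0 : Space n) 1,
        ENNReal.ofReal (Real.exp (-(μ * ‖φ.1 - θ.1‖) ^ 2))
          ∂(volume : Measure (Space n)).toSphere ≤ ENNReal.ofReal (C * μ / μ ^ n) := by
  refine ⟨Real.exp 1 * (2 * Real.pi) ^ (n / 2 : ℝ), by positivity, fun θ μ hμ => ?_⟩
  set I := ∫⁻ φ : Metric.sphere (0 : Space n) 1,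
        ENNReal.ofReal (Real.exp (-(μ * ‖φ.1 - θ.1‖) ^ 2))
          ∂(volume : Measure (Space n)).toSphere with hI
  -- compare with the full Gaussian integral over the shell `1 < r < 1 + 1 / μ`
  have h1 : ∫⁻ x : Space n, ENNReal.ofReal (Real.exp (-(μ ^ 2 / 2) * ‖x - θ.1‖ ^ 2))
      = ENNReal.ofReal ((2 * Real.pi) ^ (n / 2 : ℝ) / μ ^ n) := by
    rw [lintegral_sub_right_eq_self
      (fun x : Space n => ENNReal.ofReal (Real.exp (-(μ ^ 2 / 2) * ‖x‖ ^ 2))) θ.1,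
      lintegral_exp_neg_mul_norm_sq (by positivity), finrank_euclideanSpace_fin]
    congr 1
    rw [show Real.pi / (μ ^ 2 / 2) = 2 * Real.pi / μ ^ 2 by field_simp,
      Real.div_rpow (by positivity) (by positivity)]
    congr 1
    rw [← Real.rpow_natCast, ← Real.rpow_natCast, ← Real.rpow_mul hμ.le]
    congr 1
    push_cast
    ring
  have h2 : ENNReal.ofReal (Real.exp (-1) / μ) * I
      ≤ ENNReal.ofReal ((2 * Real.pi) ^ (n / 2 : ℝ) / μ ^ n) := by
    rw [← h1, lintegral_polar (by fun_prop), hI, ← lintegral_const_mul _ (by fun_prop)]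
    refine lintegral_mono fun φ => ?_
    set E := Real.exp (-(μ * ‖φ.1 - θ.1‖) ^ 2)
    calc ENNReal.ofReal (Real.exp (-1) / μ) * ENNReal.ofReal E
        = ∫⁻ r in Ioc 1 (1 + 1 / μ), ENNReal.ofReal (Real.exp (-1) * E) := by
          rw [setLIntegral_const, Real.volume_Ioc, ← ENNReal.ofReal_mul (by positivity),
            ← ENNReal.ofReal_mul (by positivity)]
          congr 1
          ring
      _ ≤ ∫⁻ r in Ioc 1 (1 + 1 / μ), ENNReal.ofReal (r ^ (n - 1)) *
            ENNReal.ofReal (Real.exp (-(μ ^ 2 / 2) * ‖r • φ.1 - θ.1‖ ^ 2)) := by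
          refine setLIntegral_mono' measurableSet_Ioc fun r hr => ?_
          rw [← ENNReal.ofReal_mul (pow_nonneg (by linarith [hr.1]) _)]
          refine ENNReal.ofReal_le_ofReal ?_
          have h3 : ‖r • φ.1 - θ.1‖ ≤ 1 / μ + ‖φ.1 - θ.1‖ := by
            have h4 : r • φ.1 - θ.1 = (r - 1) • φ.1 + (φ.1 - θ.1) := by module
            have h5 : ‖φ.1‖ = 1 := by simp
            rw [h4]
            refine (norm_add_le _ _).trans ?_
            rw [norm_smul, h5, Real.norm_of_nonneg (by linarith [hr.1])]
            linarith [hr.2]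
          have h6 : μ * ‖r • φ.1 - θ.1‖ ≤ 1 + μ * ‖φ.1 - θ.1‖ := by
            calc _ ≤ μ * (1 / μ + ‖φ.1 - θ.1‖) := by gcongr
              _ = _ := by field_simp
          have h7 : (μ * ‖r • φ.1 - θ.1‖) ^ 2 ≤ 2 + 2 * (μ * ‖φ.1 - θ.1‖) ^ 2 := by
            have : 0 ≤ μ * ‖r • φ.1 - θ.1‖ := by positivity
            nlinarith [sq_nonneg (1 - μ * ‖φ.1 - θ.1‖)]
          calc Real.exp (-1) * E = Real.exp (-1 + -(μ * ‖φ.1 - θ.1‖) ^ 2) := by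
                rw [Real.exp_add]
            _ ≤ Real.exp (-(μ ^ 2 / 2) * ‖r • φ.1 - θ.1‖ ^ 2) := by
                gcongr
                linarith
            _ ≤ _ := le_mul_of_one_le_left (Real.exp_pos _).le (one_le_pow₀ hr.1.le)
      _ ≤ _ := lintegral_mono_set fun r hr => lt_trans one_pos hr.1
  have h3 : I = ENNReal.ofReal (Real.exp 1 * μ) * (ENNReal.ofReal (Real.exp (-1) / μ) * I) := by
    rw [← mul_assoc, ← ENNReal.ofReal_mul (by positivity)]
    have : Real.exp 1 * μ * (Real.exp (-1) / μ) = 1 := by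
      rw [Real.exp_neg]
      field_simp
    rw [this, ENNReal.ofReal_one, one_mul]
  rw [h3]
  refine (mul_le_mul_right h2 _).trans ?_
  rw [← ENNReal.ofReal_mul (by positivity)]
  refine ENNReal.ofReal_le_ofReal (le_of_eq ?_)
  ring

end Polar

end

/-! ### Waves with frequencies in a shell -/

section

variable {n : ℕ} {H : Type*} [NormedAddCommGroup H] [InnerProductSpace ℂ H]

/-- The frequency shell `{ξ | ℓ ≤ |ξ| < 2ℓ}`. -/
def shell (n : ℕ) (ℓ : ℝ) : Set (Space n) := {ξ | ‖ξ‖ ∈ Ico ℓ (2 * ℓ)}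

theorem measurableSet_shell (ℓ : ℝ) : MeasurableSet (shell n ℓ) :=
  measurable_norm measurableSet_Ico

theorem volume_shell_le {ℓ : ℝ} (hℓ : 0 < ℓ) :
    volume (shell n ℓ) ≤ ENNReal.ofReal ((2 * ℓ) ^ n) * volume (Metric.ball (0 : Space n) 1) := by
  refine (measure_mono fun ξ hξ => ?_ : _ ≤ volume (Metric.ball (0 : Space n) (2 * ℓ))).trans ?_
  · simpa using hξ.2
  · rw [Measure.addHaar_ball_of_pos _ _ (by positivity), finrank_euclideanSpace_fin]

theorem volume_shell_lt_top {ℓ : ℝ} (hℓ : 0 < ℓ) : volume (shell n ℓ) < ∞ :=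
  (volume_shell_le hℓ).trans_lt (ENNReal.mul_lt_top ENNReal.ofReal_lt_top measure_ball_lt_top)

/-- The superposition `∫_Ω exp (i (t φ(ξ) + 2π ξ·x)) g(ξ) dξ` of plane waves with dispersion
relation `φ` and frequencies in `Ω`. -/
def wave (φ : Space n → ℝ) (Ω : Set (Space n)) (g : Space n → H) (t : ℝ) (x : Space n) : H :=
  ∫ ξ in Ω, Complex.exp ((t * φ ξ + 2 * Real.pi * inner ℝ ξ x : ℝ) * Complex.I) • g ξ

theorem continuous_wave {φ : Space n → ℝ} (hφ : Measurable φ) {Ω : Set (Space n)}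
    {g : Space n → H} (hg : IntegrableOn g Ω) :
    Continuous (Function.uncurry (wave φ Ω g)) := by
  refine continuous_of_dominated (F := fun (z : ℝ × Space n) ξ =>
    Complex.exp ((z.1 * φ ξ + 2 * Real.pi * inner ℝ ξ z.2 : ℝ) * Complex.I) • g ξ)
    (bound := fun ξ => ‖g ξ‖) (fun z => ?_) (fun z => ae_of_all _ fun ξ => ?_) hg.norm
    (ae_of_all _ fun ξ => ?_)
  · refine AEStronglyMeasurable.smul (Measurable.aestronglyMeasurable ?_) hg.1
    fun_prop
  · rw [norm_smul, Complex.norm_exp_ofReal_mul_I, one_mul]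
  · fun_prop

theorem measurable_enorm_wave_sq {φ : Space n → ℝ} (hφ : Measurable φ) {Ω : Set (Space n)}
    {g : Space n → H} (hg : IntegrableOn g Ω) :
    Measurable (Function.uncurry fun t x => ‖wave φ Ω g t x‖ₑ ^ 2) :=
  (continuous_wave hφ hg).enorm.measurable.pow_const 2

/-- By Fatou's lemma, a bound that is uniform over Gaussian weights holds without the weight. -/
theorem lintegral_le_of_gauss_le {V : Type*} [NormedAddCommGroup V] [MeasureSpace V]
    [OpensMeasurableSpace V] {F : V → ℝ≥0∞} (hF : Measurable F) {B : ℝ≥0∞}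
    (h : ∀ ε > 0, ∫⁻ v, F v ∂(gauss V ε) ≤ B) : ∫⁻ v, F v ≤ B := by
  have h1 (k : ℕ) : ∫⁻ v, ENNReal.ofReal (Real.exp (-(1 / ((k : ℝ) + 1)) * ‖v‖ ^ 2)) * F v ≤ B := by
    refine le_trans (le_of_eq ?_) (h (1 / ((k : ℝ) + 1)) (by positivity))
    rw [gauss, lintegral_withDensity_eq_lintegral_mul _ (by fun_prop) hF]
    rfl
  have h2 (v : V) : Filter.Tendsto (fun k : ℕ =>
      ENNReal.ofReal (Real.exp (-(1 / ((k : ℝ) + 1)) * ‖v‖ ^ 2)) * F v) Filter.atTop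
      (nhds (F v)) := by
    have h3 : Filter.Tendsto (fun k : ℕ =>
        ENNReal.ofReal (Real.exp (-(1 / ((k : ℝ) + 1)) * ‖v‖ ^ 2))) Filter.atTop (nhds 1) := by
      rw [← ENNReal.ofReal_one]
      refine ENNReal.tendsto_ofReal ?_
      rw [← Real.exp_zero]
      refine (Real.continuous_exp.tendsto _).comp ?_
      have := (tendsto_one_div_add_atTop_nhds_zero_nat (𝕜 := ℝ)).neg.mul_const (‖v‖ ^ 2)
      simpa using this
    have := ENNReal.Tendsto.mul_const (b := F v) h3 (Or.inl one_ne_zero)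
    simpa using this
  calc ∫⁻ v, F v = ∫⁻ v, Filter.liminf (fun k : ℕ =>
        ENNReal.ofReal (Real.exp (-(1 / ((k : ℝ) + 1)) * ‖v‖ ^ 2)) * F v) Filter.atTop :=
        lintegral_congr fun v => (h2 v).liminf_eq.symm
    _ ≤ _ := lintegral_liminf_le fun k => by fun_prop
    _ ≤ B := Filter.liminf_le_of_le (by isBoundedDefault) fun b hb => by
        obtain ⟨k, hk⟩ := hb.exists
        exact hk.trans (h1 k)

/-- The Gaussian weight `exp (-|x|² / R²)` is at least `exp (-4)` on the ball of radius `2R`. -/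
theorem setLIntegral_closedBall_le_gauss {f : Space n → ℝ≥0∞} (hf : Measurable f) {R : ℝ}
    (hR : 0 < R) : ∫⁻ x in Metric.closedBall 0 (2 * R), f x
      ≤ ENNReal.ofReal (Real.exp 4) * ∫⁻ x, f x ∂(gauss (Space n) (1 / R ^ 2)) := by
  rw [gauss, lintegral_withDensity_eq_lintegral_mul _ (by fun_prop) hf,
    ← lintegral_const_mul _ (by fun_prop)]
  refine (setLIntegral_mono' Metric.isClosed_closedBall.measurableSet fun x hx => ?_).trans
    (setLIntegral_le_lintegral _ _)
  rw [Pi.mul_apply, ← mul_assoc, ← ENNReal.ofReal_mul (Real.exp_pos _).le, ← Real.exp_add]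
  refine le_mul_of_one_le_left' ?_
  rw [ENNReal.one_le_ofReal, Real.one_le_exp_iff]
  have hx' : ‖x‖ ≤ 2 * R := by simpa using hx
  have : ‖x‖ ^ 2 / R ^ 2 ≤ 4 := by
    rw [div_le_iff₀ (by positivity)]
    calc ‖x‖ ^ 2 ≤ (2 * R) ^ 2 := by gcongr
      _ = _ := by ring
  linarith [show -(1 / R ^ 2) * ‖x‖ ^ 2 = -(‖x‖ ^ 2 / R ^ 2) by ring]

theorem setLIntegral_shell_le [NeZero n] {ℓ : ℝ} {f : Space n → ℝ≥0∞}
    (hf : Measurable f) {k : ℝ → ℝ≥0∞} (hk : Measurable k)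
    {h : Metric.sphere (0 : Space n) 1 → ℝ≥0∞} (hh : Measurable h)
    (hle : ∀ r ∈ Ico ℓ (2 * ℓ), ∀ ω : Metric.sphere (0 : Space n) 1, f (r • ω.1) ≤ k r * h ω) :
    ∫⁻ ξ in shell n ℓ, f ξ ≤ ENNReal.ofReal ((2 * ℓ) ^ (n - 1)) * (∫⁻ r, k r) *
      ∫⁻ ω, h ω ∂(volume : Measure (Space n)).toSphere := by
  rw [← lintegral_indicator (measurableSet_shell ℓ),
    lintegral_polar (hf.indicator (measurableSet_shell ℓ)), ← lintegral_const_mul _ hh]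
  refine lintegral_mono fun ω => ?_
  rw [← lintegral_const_mul _ hk, ← lintegral_mul_const _ (by fun_prop)]
  refine (setLIntegral_mono' measurableSet_Ioi fun r (hr : 0 < r) => ?_).trans
    (setLIntegral_le_lintegral _ _)
  have hω : ‖ω.1‖ = 1 := by simp
  by_cases hrs : r • ω.1 ∈ shell n ℓ
  · have hr' : r ∈ Ico ℓ (2 * ℓ) := by
      simpa [shell, norm_smul, hω, abs_of_pos hr] using hrs
    rw [indicator_of_mem hrs, mul_assoc]
    gcongr
    · exact hr'.2.le
    · exact hle r hr' ω
  · rw [indicator_of_notMem hrs, mul_zero]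
    exact zero_le

/-- The value does not depend on the width `ε` of the Gaussian in time. This is what makes bounds on
the whole time axis possible. -/
theorem lintegral_time_kernel {ε w : ℝ} (hε : 0 < ε) (hw : 0 < w) (a : ℝ) :
    ∫⁻ r : ℝ, ENNReal.ofReal ((Real.pi / ε) ^ (1 / 2 : ℝ) *
      Real.exp (-(w * |a - r|) ^ 2 / (4 * ε))) = ENNReal.ofReal (2 * Real.pi / w) := by
  have h1 := lintegral_exp_neg_mul_norm_sq (V := ℝ) (b := w ^ 2 / (4 * ε)) (by positivity)
  rw [← lintegral_sub_left_eq_self _ a] at h1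
  simp_rw [ENNReal.ofReal_mul (show 0 ≤ (Real.pi / ε) ^ (1 / 2 : ℝ) by positivity)]
  rw [lintegral_const_mul _ (by fun_prop)]
  have h2 : ∫⁻ r : ℝ, ENNReal.ofReal (Real.exp (-(w * |a - r|) ^ 2 / (4 * ε)))
      = ENNReal.ofReal ((Real.pi / (w ^ 2 / (4 * ε))) ^ (1 / 2 : ℝ)) := by
    simp only [Module.finrank_self, Nat.cast_one] at h1
    rw [← h1]
    refine lintegral_congr fun r => ?_
    congr 2
    rw [Real.norm_eq_abs]
    ring
  rw [h2, ← ENNReal.ofReal_mul (by positivity), ← Real.mul_rpow (by positivity) (by positivity)]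
  congr 1
  have h3 : Real.pi / ε * (Real.pi / (w ^ 2 / (4 * ε))) = (2 * Real.pi / w) ^ 2 := by
    field_simp
    ring
  rw [h3, ← Real.sqrt_eq_rpow, Real.sqrt_sq (by positivity)]

/-- The Fourier transform of a Gaussian in time, at the frequency `φ ξ - φ η`. -/
def timeKernel (φ : Space n → ℝ) (ε : ℝ) (ξ η : Space n) : ℝ :=
  (Real.pi / ε) ^ (1 / 2 : ℝ) * Real.exp (-(φ ξ - φ η) ^ 2 / (4 * ε))

/-- The Fourier transform of a Gaussian of width `R` in space, at the frequency `ξ - η`. -/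
def spaceKernel (R : ℝ) (ξ η : Space n) : ℝ :=
  (Real.pi * R ^ 2) ^ (n / 2 : ℝ) * Real.exp (-(Real.pi * R * ‖ξ - η‖) ^ 2)

theorem timeKernel_nonneg (φ : Space n → ℝ) {ε : ℝ} (hε : 0 < ε) (ξ η : Space n) :
    0 ≤ timeKernel φ ε ξ η := by
  unfold timeKernel; positivity

theorem spaceKernel_nonneg (R : ℝ) (ξ η : Space n) : 0 ≤ spaceKernel R ξ η := by
  unfold spaceKernel; positivity

theorem integral_gauss_time (φ : Space n → ℝ) {ε : ℝ} (hε : 0 < ε) (ξ η : Space n) :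
    ∫ t, Complex.exp ((t * (φ ξ - φ η) : ℝ) * Complex.I) ∂(gauss ℝ ε)
      = (timeKernel φ ε ξ η : ℂ) := by
  have h := integral_gauss_char (V := ℝ) hε (φ ξ - φ η)
  simp only [Module.finrank_self, Nat.cast_one, Real.norm_eq_abs, sq_abs] at h
  rw [timeKernel, ← h]
  rfl

theorem integral_gauss_space {R : ℝ} (hR : 0 < R) (ξ η : Space n) :
    ∫ x, Complex.exp ((2 * Real.pi * inner ℝ (ξ - η) x : ℝ) * Complex.I)
      ∂(gauss (Space n) (1 / R ^ 2)) = (spaceKernel R ξ η : ℂ) := by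
  have h := integral_gauss_char (V := Space n) (b := 1 / R ^ 2) (by positivity)
    ((2 * Real.pi) • (ξ - η))
  simp only [inner_smul_left, finrank_euclideanSpace_fin, conj_trivial] at h
  rw [h, spaceKernel, norm_smul, Real.norm_of_nonneg (by positivity)]
  congr 3
  · field_simp
  · field_simp
    ring

/-- Integration of the time kernel over a shell in polar coordinates: as `φ` has speed at least `w`,
the radial integral gains `1 / w`. -/
theorem setLIntegral_timeKernel_le [NeZero n] {φ : Space n → ℝ} (hφ : Measurable φ) {ℓ w ε : ℝ}
    (hℓ : 0 < ℓ) (hw : 0 < w) (hε : 0 < ε) {ξ : Space n}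
    (hφw : ∀ η ∈ shell n ℓ, w * |‖ξ‖ - ‖η‖| ≤ |φ ξ - φ η|)
    {h : Metric.sphere (0 : Space n) 1 → ℝ≥0∞} (hh : Measurable h) {f : Space n → ℝ≥0∞}
    (hf : Measurable f)
    (hle : ∀ r ∈ Ico ℓ (2 * ℓ), ∀ ω : Metric.sphere (0 : Space n) 1, f (r • ω.1) ≤ h ω) :
    ∫⁻ η in shell n ℓ, ENNReal.ofReal (timeKernel φ ε ξ η) * f η
      ≤ ENNReal.ofReal ((2 * ℓ) ^ (n - 1)) * ENNReal.ofReal (2 * Real.pi / w) *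
        ∫⁻ ω, h ω ∂(volume : Measure (Space n)).toSphere := by
  rw [← lintegral_time_kernel hε hw ‖ξ‖]
  refine setLIntegral_shell_le ?_ (by fun_prop) hh fun r hr ω => ?_
  · unfold timeKernel; fun_prop
  refine mul_le_mul' ?_ (hle r hr ω)
  have hr0 : 0 < r := hℓ.trans_le hr.1
  have hω : ‖r • ω.1‖ = r := by
    simp [norm_smul, hr0.le]
  have h1 := hφw (r • ω.1) (show ‖r • ω.1‖ ∈ _ by rwa [hω])
  rw [hω] at h1
  unfold timeKernel
  rw [← sq_abs (φ ξ - φ _)]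
  gcongr

/-- Outside the ball of radius `ℓ`, the radial projection to the unit sphere is Lipschitz with
constant `1 / ℓ`. -/
theorem norm_unit_sub_le {ℓ r : ℝ} (hℓ : 0 < ℓ) (hr : ℓ ≤ r) {a : ℝ} (ha : ℓ ≤ a)
    (α ω : Metric.sphere (0 : Space n) 1) : ℓ * ‖ω.1 - α.1‖ ≤ ‖a • α.1 - r • ω.1‖ := by
  refine (pow_le_pow_iff_left₀ (by positivity) (norm_nonneg _) two_ne_zero).1 ?_
  have hα : ‖α.1‖ = 1 := by simp
  have hω : ‖ω.1‖ = 1 := by simp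
  have h1 : inner ℝ ω.1 α.1 ≤ 1 := by simpa [hα, hω] using real_inner_le_norm ω.1 α.1
  rw [mul_pow, norm_sub_sq_real, norm_sub_sq_real, norm_smul, norm_smul, inner_smul_left,
    inner_smul_right, real_inner_comm, hα, hω]
  simp only [conj_trivial, Real.norm_eq_abs, mul_one, sq_abs]
  rw [real_inner_comm] at h1
  have h2 : ℓ ^ 2 ≤ a * r := by nlinarith
  nlinarith [sq_nonneg (a - r), mul_le_mul_of_nonneg_right h2 (sub_nonneg.2 h1)]

/-- A constant phase does not change the absolute value of an oscillatory integral. -/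
theorem enorm_integral_exp_mul_eq {Y : Type*} [MeasurableSpace Y] (ν : Measure Y) (f : Y → ℝ)
    (c : ℝ) : ‖∫ y, Complex.exp ((f y + c : ℝ) * Complex.I) ∂ν‖ₑ
      = ‖∫ y, Complex.exp ((f y : ℝ) * Complex.I) ∂ν‖ₑ := by
  have h (y : Y) : Complex.exp ((f y + c : ℝ) * Complex.I)
      = Complex.exp ((f y : ℝ) * Complex.I) * Complex.exp ((c : ℝ) * Complex.I) := by
    rw [← Complex.exp_add]
    push_cast
    ring_nf
  simp_rw [h]
  rw [integral_mul_const, enorm_mul, ← ofReal_norm (Complex.exp _), Complex.norm_exp_ofReal_mul_I,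
    ENNReal.ofReal_one, mul_one]

theorem enorm_ofReal_of_nonneg {a : ℝ} (ha : 0 ≤ a) : ‖(a : ℂ)‖ₑ = ENNReal.ofReal a := by
  rw [← ofReal_norm, Complex.norm_real, Real.norm_of_nonneg ha]

/-- The dispersion relation `φ` has speed at least `w` on the shell of radius `ℓ`. -/
structure IsDispersive (φ : Space n → ℝ) (ℓ w : ℝ) : Prop where
  measurable : Measurable φ
  pos : 0 < ℓ
  speed_pos : 0 < w
  le : ∀ ξ ∈ shell n ℓ, ∀ η ∈ shell n ℓ, w * |‖ξ‖ - ‖η‖| ≤ |φ ξ - φ η|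

theorem integrableOn_shell {H : Type*} [NormedAddCommGroup H] {ℓ : ℝ} (hℓ : 0 < ℓ) {g : Space n → H}
    (hg : MemLp g 2 (volume.restrict (shell n ℓ))) : IntegrableOn g (shell n ℓ) := by
  have : IsFiniteMeasure (volume.restrict (shell n ℓ)) := ⟨by simpa using volume_shell_lt_top hℓ⟩
  exact hg.integrable (by norm_num)

variable [CompleteSpace H]

/-- At a fixed point of space, a wave is square integrable in time. -/
theorem exists_lintegral_time_wave_le (n : ℕ) [NeZero n] : ∃ C : ℝ, 0 < C ∧
    ∀ {φ : Space n → ℝ} {ℓ w : ℝ}, IsDispersive φ ℓ w → ∀ {g : Space n → H},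
      MemLp g 2 (volume.restrict (shell n ℓ)) → ∀ x,
      ∫⁻ t, ‖wave φ (shell n ℓ) g t x‖ₑ ^ 2
        ≤ ENNReal.ofReal (C * (ℓ ^ (n - 1) / w)) * ∫⁻ ξ in shell n ℓ, ‖g ξ‖ₑ ^ 2 := by
  set S := (volume : Measure (Space n)).toSphere.real univ
  refine ⟨2 ^ (n - 1) * (2 * Real.pi) * (S + 1), by positivity, fun {φ ℓ w} hφ {g} hg x => ?_⟩
  have hℓ := hφ.pos
  have hw := hφ.speed_pos
  have hgi := integrableOn_shell hφ.pos hg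
  refine lintegral_le_of_gauss_le ?_ fun ε hε => ?_
  · exact Measurable.of_uncurry_right (y := x) (measurable_enorm_wave_sq hφ.measurable hgi)
  have := isFiniteMeasure_gauss (V := ℝ) hε
  have hφm := hφ.measurable
  refine oscillatory_lintegral_le (K := fun ξ η => ENNReal.ofReal (timeKernel φ ε ξ η))
    ?_ hgi ?_ ?_ ?_ ?_
  · simp only [Function.uncurry_def]
    fun_prop
  · simp only [Function.uncurry_def, timeKernel]
    fun_prop
  · intro ξ η
    simp only [timeKernel]
    rw [← sq_abs, abs_sub_comm, sq_abs]
  · intro ξ η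
    have h (t : ℝ) : t * φ ξ + 2 * Real.pi * inner ℝ ξ x - (t * φ η + 2 * Real.pi * inner ℝ η x)
        = t * (φ ξ - φ η) + (2 * Real.pi * inner ℝ ξ x - 2 * Real.pi * inner ℝ η x) := by ring
    simp_rw [h]
    rw [enorm_integral_exp_mul_eq, integral_gauss_time φ hε,
      enorm_ofReal_of_nonneg (timeKernel_nonneg φ hε _ _)]
  · filter_upwards [ae_restrict_mem (measurableSet_shell ℓ)] with ξ hξ
    have h := setLIntegral_timeKernel_le hφ.measurable hφ.pos hφ.speed_pos hε
      (hφ.le ξ hξ) (measurable_const (a := (1 : ℝ≥0∞))) (measurable_const (a := (1 : ℝ≥0∞)))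
      (fun r hr ω => le_rfl)
    simp only [mul_one, lintegral_const, one_mul] at h
    refine h.trans ?_
    rw [← ofReal_measureReal, ← ENNReal.ofReal_mul (by positivity),
      ← ENNReal.ofReal_mul (by positivity)]
    refine ENNReal.ofReal_le_ofReal ?_
    change _ * S ≤ _
    calc (2 * ℓ) ^ (n - 1) * (2 * Real.pi / w) * S
        = 2 ^ (n - 1) * (2 * Real.pi) * S * (ℓ ^ (n - 1) / w) := by rw [mul_pow]; ring
      _ ≤ _ := by
        gcongr
        linarith

/-- Local smoothing: a ball of radius `R` is crossed in time `R / w`. The Gaussian weights in time and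
space separate the radial and the angular variable of the kernel. -/
theorem exists_lintegral_time_space_wave_le (n : ℕ) [NeZero n] : ∃ C : ℝ, 0 < C ∧
    ∀ {φ : Space n → ℝ} {ℓ w : ℝ}, IsDispersive φ ℓ w → ∀ {g : Space n → H},
      MemLp g 2 (volume.restrict (shell n ℓ)) → ∀ {R : ℝ}, 0 < R →
      ∫⁻ t, ∫⁻ x in Metric.closedBall 0 (2 * R), ‖wave φ (shell n ℓ) g t x‖ₑ ^ 2
        ≤ ENNReal.ofReal (C * (R / w)) * ∫⁻ ξ in shell n ℓ, ‖g ξ‖ₑ ^ 2 := by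
  obtain ⟨S, hS, hSle⟩ := exists_lintegral_sphere_exp_le n
  refine ⟨Real.exp 4 * (2 ^ (n - 1) * (2 * Real.pi) * Real.pi ^ (n / 2 : ℝ) * S * Real.pi
    / Real.pi ^ n), by positivity, fun {φ ℓ w} hφ {g} hg R hR => ?_⟩
  have hℓ := hφ.pos
  have hw := hφ.speed_pos
  have hgi := integrableOn_shell hφ.pos hg
  have hm := measurable_enorm_wave_sq hφ.measurable hgi
  refine lintegral_le_of_gauss_le hm.lintegral_prod_right fun ε hε => ?_
  have := isFiniteMeasure_gauss (V := ℝ) hε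
  have := isFiniteMeasure_gauss (V := Space n) (b := 1 / R ^ 2) (by positivity)
  have hφm := hφ.measurable
  have hmain := oscillatory_lintegral_le (μ := volume.restrict (shell n ℓ))
    (ν := (gauss ℝ ε).prod (gauss (Space n) (1 / R ^ 2)))
    (θ := fun z ξ => z.1 * φ ξ + 2 * Real.pi * inner ℝ ξ z.2)
    (K := fun ξ η => ENNReal.ofReal (timeKernel φ ε ξ η) * ENNReal.ofReal (spaceKernel R ξ η))
    (g := g)
    (B := ENNReal.ofReal (2 ^ (n - 1) * (2 * Real.pi) * Real.pi ^ (n / 2 : ℝ) * S * Real.pi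
      / Real.pi ^ n * (R / w))) ?_ hgi ?_ ?_ ?_ ?_
  · calc ∫⁻ t, ∫⁻ x in Metric.closedBall 0 (2 * R), ‖wave φ (shell n ℓ) g t x‖ₑ ^ 2
          ∂volume ∂(gauss ℝ ε)
        ≤ ∫⁻ t, ENNReal.ofReal (Real.exp 4) * ∫⁻ x, ‖wave φ (shell n ℓ) g t x‖ₑ ^ 2
            ∂(gauss (Space n) (1 / R ^ 2)) ∂(gauss ℝ ε) :=
          lintegral_mono fun t => setLIntegral_closedBall_le_gauss
            (Measurable.of_uncurry_left hm) hR
      _ = ENNReal.ofReal (Real.exp 4) * ∫⁻ z : ℝ × Space n,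
            ‖wave φ (shell n ℓ) g z.1 z.2‖ₑ ^ 2
              ∂((gauss ℝ ε).prod (gauss (Space n) (1 / R ^ 2))) := by
          rw [lintegral_const_mul _ hm.lintegral_prod_right,
            lintegral_prod _ (by exact hm.aemeasurable)]
      _ ≤ _ := mul_le_mul_right hmain _
      _ = _ := by
          rw [← mul_assoc, ← ENNReal.ofReal_mul (by positivity)]
          congr 2
          ring
  · simp only [Function.uncurry_def]
    fun_prop
  · simp only [Function.uncurry_def, timeKernel, spaceKernel]
    fun_prop
  · intro ξ η
    simp only [timeKernel, spaceKernel]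
    rw [← sq_abs, abs_sub_comm, sq_abs, norm_sub_rev]
  · intro ξ η
    have h (z : ℝ × Space n) : Complex.exp ((z.1 * φ ξ + 2 * Real.pi * inner ℝ ξ z.2
          - (z.1 * φ η + 2 * Real.pi * inner ℝ η z.2) : ℝ) * Complex.I)
        = Complex.exp ((z.1 * (φ ξ - φ η) : ℝ) * Complex.I) *
          Complex.exp ((2 * Real.pi * inner ℝ (ξ - η) z.2 : ℝ) * Complex.I) := by
      rw [← Complex.exp_add, inner_sub_left]
      push_cast
      ring_nf
    simp_rw [h]
    rw [integral_prod_mul (fun t : ℝ => Complex.exp ((t * (φ ξ - φ η) : ℝ) * Complex.I))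
      (fun x : Space n => Complex.exp ((2 * Real.pi * inner ℝ (ξ - η) x : ℝ) * Complex.I)),
      integral_gauss_time φ hε, integral_gauss_space hR, enorm_mul,
      enorm_ofReal_of_nonneg (timeKernel_nonneg φ hε _ _),
      enorm_ofReal_of_nonneg (spaceKernel_nonneg _ _ _)]
  · filter_upwards [ae_restrict_mem (measurableSet_shell ℓ)] with ξ hξ
    have hξ0 : ‖ξ‖ ≠ 0 := (hℓ.trans_le hξ.1).ne'
    set α : Metric.sphere (0 : Space n) 1 := ⟨‖ξ‖⁻¹ • ξ, by simp [norm_smul, hξ0]⟩ with hα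
    have hξα : ξ = ‖ξ‖ • α.1 := by simp [hα, smul_smul, hξ0]
    refine (setLIntegral_timeKernel_le hφ.measurable hφ.pos hφ.speed_pos hε
      (hφ.le ξ hξ) (h := fun ω => ENNReal.ofReal ((Real.pi * R ^ 2) ^ (n / 2 : ℝ)) *
        ENNReal.ofReal (Real.exp (-(Real.pi * R * ℓ * ‖ω.1 - α.1‖) ^ 2))) (by fun_prop)
      (by unfold spaceKernel; fun_prop) fun r hr ω => ?_).trans ?_
    · rw [← ENNReal.ofReal_mul (by positivity)]
      refine ENNReal.ofReal_le_ofReal ?_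
      unfold spaceKernel
      have h1 := norm_unit_sub_le hℓ hr.1 hξ.1 α ω
      rw [← hξα] at h1
      rw [mul_assoc (Real.pi * R)]
      gcongr
    · rw [lintegral_const_mul _ (by fun_prop)]
      refine (mul_le_mul_right (mul_le_mul_right (hSle α (Real.pi * R * ℓ) (by positivity)) _)
        _).trans ?_
      rw [← ENNReal.ofReal_mul (by positivity), ← ENNReal.ofReal_mul (by positivity),
        ← ENNReal.ofReal_mul (by positivity)]
      refine ENNReal.ofReal_le_ofReal (le_of_eq ?_)
      obtain ⟨k, rfl⟩ : ∃ k, n = k + 1 := ⟨n - 1, (Nat.succ_pred (NeZero.ne n)).symm⟩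
      have h2 : (Real.pi * R ^ 2) ^ (((k + 1 : ℕ) : ℝ) / 2)
          = Real.pi ^ (((k + 1 : ℕ) : ℝ) / 2) * R ^ (k + 1) := by
        rw [Real.mul_rpow (by positivity) (by positivity), ← Real.rpow_natCast R 2,
          ← Real.rpow_mul hR.le, ← Real.rpow_natCast]
        congr 2
        push_cast
        ring
      rw [h2, Nat.add_sub_cancel, mul_pow, mul_pow, mul_pow]
      field_simp
      ring

/-- The conservation law for the `L²` norm, on balls. -/
theorem exists_lintegral_space_wave_le (n : ℕ) : ∃ C : ℝ, 0 < C ∧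
    ∀ {φ : Space n → ℝ} (_ : Measurable φ) {ℓ : ℝ}, 0 < ℓ → ∀ {g : Space n → H},
      MemLp g 2 (volume.restrict (shell n ℓ)) → ∀ {R : ℝ}, 0 < R → ∀ t,
      ∫⁻ x in Metric.closedBall 0 (2 * R), ‖wave φ (shell n ℓ) g t x‖ₑ ^ 2
        ≤ ENNReal.ofReal C * ∫⁻ ξ in shell n ℓ, ‖g ξ‖ₑ ^ 2 := by
  refine ⟨Real.exp 4, by positivity, fun {φ} hφ {ℓ} hℓ {g} hg R hR t => ?_⟩
  have hgi := integrableOn_shell hℓ hg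
  have := isFiniteMeasure_gauss (V := Space n) (b := 1 / R ^ 2) (by positivity)
  refine (setLIntegral_closedBall_le_gauss ?_ hR).trans ?_
  · exact Measurable.of_uncurry_left (x := t) (measurable_enorm_wave_sq hφ hgi)
  refine mul_le_mul_right ?_ _
  refine (oscillatory_lintegral_le (K := fun ξ η => ENNReal.ofReal (spaceKernel R ξ η))
    (B := 1) ?_ hgi ?_ ?_ ?_ ?_).trans (one_mul _).le
  · simp only [Function.uncurry_def]
    fun_prop
  · simp only [Function.uncurry_def, spaceKernel]
    fun_prop
  · intro ξ η
    simp only [spaceKernel, norm_sub_rev]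
  · intro ξ η
    have h (x : Space n) :
        t * φ ξ + 2 * Real.pi * inner ℝ ξ x - (t * φ η + 2 * Real.pi * inner ℝ η x)
        = 2 * Real.pi * inner ℝ (ξ - η) x + (t * φ ξ - t * φ η) := by
      rw [inner_sub_left]; ring
    simp_rw [h]
    rw [enorm_integral_exp_mul_eq, integral_gauss_space hR,
      enorm_ofReal_of_nonneg (spaceKernel_nonneg _ _ _)]
  · refine ae_of_all _ fun ξ => (setLIntegral_le_lintegral _ _).trans (le_of_eq ?_)
    have h1 := lintegral_exp_neg_mul_norm_sq (V := Space n) (b := (Real.pi * R) ^ 2) (by positivity)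
    rw [← lintegral_sub_left_eq_self _ ξ] at h1
    simp_rw [spaceKernel,
      ENNReal.ofReal_mul (show 0 ≤ (Real.pi * R ^ 2) ^ (n / 2 : ℝ) by positivity)]
    rw [lintegral_const_mul _ (by fun_prop)]
    have h2 (η : Space n) : -(Real.pi * R * ‖ξ - η‖) ^ 2 = -(Real.pi * R) ^ 2 * ‖ξ - η‖ ^ 2 := by
      ring
    simp_rw [h2]
    rw [h1, finrank_euclideanSpace_fin, ← ENNReal.ofReal_mul (by positivity),
      ← Real.mul_rpow (by positivity) (by positivity)]
    have h3 : Real.pi * R ^ 2 * (Real.pi / (Real.pi * R) ^ 2) = 1 := by field_simp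
    rw [h3, Real.one_rpow, ENNReal.ofReal_one]

/-- Bernstein's inequality, as the case of a point mass in Schur's test. -/
theorem exists_enorm_wave_le (n : ℕ) : ∃ C : ℝ, 0 < C ∧
    ∀ {φ : Space n → ℝ} (_ : Measurable φ) {ℓ : ℝ}, 0 < ℓ → ∀ {g : Space n → H},
      MemLp g 2 (volume.restrict (shell n ℓ)) → ∀ t x,
      ‖wave φ (shell n ℓ) g t x‖ₑ ^ 2
        ≤ ENNReal.ofReal (C * ℓ ^ n) * ∫⁻ ξ in shell n ℓ, ‖g ξ‖ₑ ^ 2 := by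
  set b := (volume : Measure (Space n)).real (Metric.ball 0 1)
  refine ⟨2 ^ n * (b + 1), by positivity, fun {φ} hφ {ℓ} hℓ {g} hg t x => ?_⟩
  have h := oscillatory_lintegral_le (ν := Measure.dirac (t, x)) (μ := volume.restrict (shell n ℓ))
    (θ := fun z ξ => z.1 * φ ξ + 2 * Real.pi * inner ℝ ξ z.2) (K := fun _ _ => 1) (g := g)
    (by simp only [Function.uncurry_def]; fun_prop) (integrableOn_shell hℓ hg)
    (by simp only [Function.uncurry_def]; fun_prop) (fun _ _ => rfl) (fun ξ η => by
      rw [integral_dirac, ← ofReal_norm, Complex.norm_exp_ofReal_mul_I, ENNReal.ofReal_one])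
    (B := volume (shell n ℓ)) (ae_of_all _ fun ξ => by simp)
  have hd := lintegral_dirac' (t, x) (measurable_enorm_wave_sq hφ (integrableOn_shell hℓ hg))
  simp only [Function.uncurry_def] at hd
  rw [← hd]
  refine h.trans (mul_le_mul_left ((volume_shell_le hℓ).trans ?_) _)
  rw [← ofReal_measureReal, ← ENNReal.ofReal_mul (by positivity)]
  refine ENNReal.ofReal_le_ofReal ?_
  calc (2 * ℓ) ^ n * b = 2 ^ n * b * ℓ ^ n := by rw [mul_pow]; ring
    _ ≤ _ := by
      gcongr
      linarith

end

/-! ### The one-dimensional Sobolev inequality and the energy density -/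

section

/-- The Cauchy–Schwarz inequality. -/
theorem lintegral_mul_sq_le {α : Type*} [MeasurableSpace α] (μ : Measure α) {f g : α → ℝ≥0∞}
    (hf : AEMeasurable f μ) (hg : AEMeasurable g μ) :
    (∫⁻ a, f a * g a ∂μ) ^ 2 ≤ (∫⁻ a, f a ^ 2 ∂μ) * ∫⁻ a, g a ^ 2 ∂μ := by
  have h := ENNReal.lintegral_mul_le_Lp_mul_Lq μ Real.HolderConjugate.two_two hf hg
  have h2 (x : ℝ≥0∞) : (x ^ (1 / 2 : ℝ)) ^ 2 = x := by
    rw [← ENNReal.rpow_natCast, ← ENNReal.rpow_mul]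
    norm_num
  refine (pow_le_pow_left₀ zero_le h 2).trans ?_
  rw [mul_pow, h2, h2]
  simp

theorem lintegral_prod_uncurry {α β : Type*} [MeasurableSpace α] [MeasurableSpace β]
    {μ : Measure α} {ν : Measure β} [SFinite ν] {F : α → β → ℝ≥0∞}
    (hF : Measurable (Function.uncurry F)) :
    ∫⁻ z, F z.1 z.2 ∂(μ.prod ν) = ∫⁻ x, ∫⁻ y, F x y ∂ν ∂μ :=
  lintegral_prod _ hF.aemeasurable

theorem setLIntegral_sq_le {α : Type*} [MeasurableSpace α] (μ : Measure α) (s : Set α)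
    {f : α → ℝ≥0∞} (hf : AEMeasurable f (μ.restrict s)) :
    (∫⁻ a in s, f a ∂μ) ^ 2 ≤ μ s * ∫⁻ a in s, f a ^ 2 ∂μ := by
  simpa using lintegral_mul_sq_le (μ.restrict s) (aemeasurable_const (b := (1 : ℝ≥0∞))) hf

theorem ennreal_add_sq_le (a b : ℝ≥0∞) : (a + b) ^ 2 ≤ 2 * (a ^ 2 + b ^ 2) := by
  have h := ENNReal.rpow_add_le_mul_rpow_add_rpow a b (p := 2) (by norm_num)
  norm_num at h
  exact h

/-- The one-dimensional Sobolev inequality at the length scale `ℓ⁻¹`: `h r` is compared with `h s` and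
the result averaged over `s`. -/
theorem enorm_sq_le_of_hasDerivAt {H : Type*} [NormedAddCommGroup H] [NormedSpace ℝ H]
    [CompleteSpace H] {h h' : ℝ → H} (hd : ∀ s, HasDerivAt h (h' s) s) (hc : Continuous h')
    {ℓ : ℝ} (hℓ : 0 < ℓ) {c r : ℝ} (hr : r ∈ Icc c (c + ℓ⁻¹)) :
    ‖h r‖ₑ ^ 2 ≤ ENNReal.ofReal (2 * ℓ) * ∫⁻ s in Icc c (c + ℓ⁻¹),
      (‖h s‖ₑ ^ 2 + ENNReal.ofReal (ℓ⁻¹ ^ 2) * ‖h' s‖ₑ ^ 2) := by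
  set J := Icc c (c + ℓ⁻¹) with hJ
  have hJv : volume J = ENNReal.ofReal ℓ⁻¹ := by rw [hJ, Real.volume_Icc]; congr 1; ring
  have hch : Continuous h := continuous_iff_continuousAt.2 fun s => (hd s).continuousAt
  have h1 (s : ℝ) (hs : s ∈ J) : ‖h r‖ₑ ≤ ‖h s‖ₑ + ∫⁻ u in J, ‖h' u‖ₑ := by
    have h2 : h r = h s + ∫ u in s..r, h' u := by
      rw [intervalIntegral.integral_eq_sub_of_hasDerivAt (fun u _ => hd u)
        (hc.intervalIntegrable _ _)]
      abel
    rw [h2]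
    refine (enorm_add_le _ _).trans (add_le_add_right ?_ _)
    rw [← ofReal_norm, intervalIntegral.norm_intervalIntegral_eq, ofReal_norm]
    refine (enorm_integral_le_lintegral_enorm _).trans (lintegral_mono_set ?_)
    exact uIoc_subset_uIcc.trans (ordConnected_Icc.uIcc_subset hs hr)
  have h2 (s : ℝ) (hs : s ∈ J) : ‖h r‖ₑ ^ 2 ≤
      2 * (‖h s‖ₑ ^ 2 + ENNReal.ofReal ℓ⁻¹ * ∫⁻ u in J, ‖h' u‖ₑ ^ 2) := by
    refine (pow_le_pow_left₀ zero_le (h1 s hs) 2).trans ((ennreal_add_sq_le _ _).trans ?_)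
    gcongr
    rw [← hJv]
    exact setLIntegral_sq_le _ _ hc.enorm.measurable.aemeasurable
  have h3 := setLIntegral_mono' (μ := volume) measurableSet_Icc h2
  have hm : Measurable fun s => ‖h s‖ₑ ^ 2 := hch.enorm.measurable.pow_const 2
  have hm' : Measurable fun s => ‖h' s‖ₑ ^ 2 := hc.enorm.measurable.pow_const 2
  rw [setLIntegral_const, hJv, lintegral_const_mul _ (by exact hm.add measurable_const),
    lintegral_add_right _ measurable_const, setLIntegral_const, hJv] at h3
  have hℓ1 : ENNReal.ofReal ℓ * ENNReal.ofReal ℓ⁻¹ = 1 := by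
    rw [← ENNReal.ofReal_mul hℓ.le, mul_inv_cancel₀ hℓ.ne', ENNReal.ofReal_one]
  rw [lintegral_add_right _ (hm'.const_mul _), lintegral_const_mul _ hm',
    ENNReal.ofReal_mul (by norm_num), ENNReal.ofReal_pow (by positivity), ENNReal.ofReal_ofNat]
  calc ‖h r‖ₑ ^ 2 = ENNReal.ofReal ℓ * (‖h r‖ₑ ^ 2 * ENNReal.ofReal ℓ⁻¹) := by
        rw [mul_comm (‖h r‖ₑ ^ 2), ← mul_assoc, hℓ1, one_mul]
    _ ≤ ENNReal.ofReal ℓ * _ := mul_le_mul_right h3 _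
    _ = _ := by ring

variable {n : ℕ} {H : Type*} [NormedAddCommGroup H] [InnerProductSpace ℂ H] [CompleteSpace H]

omit [CompleteSpace H] in
theorem integrable_wave_integrand {φ : Space n → ℝ} (hφ : Measurable φ) {Ω : Set (Space n)}
    {g : Space n → H} (hg : IntegrableOn g Ω) (t : ℝ) (x : Space n) :
    IntegrableOn (fun ξ =>
      Complex.exp ((t * φ ξ + 2 * Real.pi * inner ℝ ξ x : ℝ) * Complex.I) • g ξ) Ω := by
  refine Integrable.mono hg (AEStronglyMeasurable.smul (Measurable.aestronglyMeasurable ?_) hg.1)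
    (ae_of_all _ fun ξ => ?_)
  · fun_prop
  · rw [norm_smul, Complex.norm_exp_ofReal_mul_I, one_mul]

/-- Multiplication by the frequency in the direction `ω`, that is the derivative `∂_ω` on the
Fourier side. -/
def freqMul (ω : Space n) (g : Space n → H) (ξ : Space n) : H :=
  ((2 * Real.pi * inner ℝ ξ ω : ℝ) * Complex.I : ℂ) • g ξ

omit [CompleteSpace H] in
theorem norm_freqMul_le {ℓ : ℝ} {ω : Space n} (hω : ‖ω‖ = 1) (g : Space n → H)
    {ξ : Space n} (hξ : ξ ∈ shell n ℓ) : ‖freqMul ω g ξ‖ ≤ 4 * Real.pi * ℓ * ‖g ξ‖ := by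
  rw [freqMul, norm_smul, norm_mul, Complex.norm_I, mul_one, Complex.norm_real, Real.norm_eq_abs,
    abs_mul, abs_of_pos (by positivity : 0 < 2 * Real.pi)]
  refine mul_le_mul_of_nonneg_right ?_ (norm_nonneg _)
  have h1 := abs_real_inner_le_norm ξ ω
  rw [hω, mul_one] at h1
  calc 2 * Real.pi * |inner ℝ ξ ω| ≤ 2 * Real.pi * (2 * ℓ) := by
        gcongr
        exact h1.trans hξ.2.le
    _ = _ := by ring

omit [CompleteSpace H] in
theorem memLp_freqMul {ℓ : ℝ} {ω : Space n} (hω : ‖ω‖ = 1) {g : Space n → H}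
    (hg : MemLp g 2 (volume.restrict (shell n ℓ))) :
    MemLp (freqMul ω g) 2 (volume.restrict (shell n ℓ)) := by
  refine hg.of_le_mul (c := 4 * Real.pi * ℓ) ?_ ?_
  · refine AEStronglyMeasurable.smul (Measurable.aestronglyMeasurable ?_) hg.1
    fun_prop
  · filter_upwards [ae_restrict_mem (measurableSet_shell ℓ)] with ξ hξ
    exact norm_freqMul_le hω g hξ

omit [CompleteSpace H] in
theorem lintegral_freqMul_le {ℓ : ℝ} (hℓ : 0 < ℓ) {ω : Space n} (hω : ‖ω‖ = 1)
    (g : Space n → H) : ∫⁻ ξ in shell n ℓ, ‖freqMul ω g ξ‖ₑ ^ 2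
      ≤ ENNReal.ofReal ((4 * Real.pi * ℓ) ^ 2) * ∫⁻ ξ in shell n ℓ, ‖g ξ‖ₑ ^ 2 := by
  rw [← lintegral_const_mul' _ _ ENNReal.ofReal_ne_top]
  refine setLIntegral_mono' (measurableSet_shell ℓ) fun ξ hξ => ?_
  rw [ENNReal.ofReal_pow (by positivity), ← mul_pow, ← ofReal_norm, ← ofReal_norm,
    ← ENNReal.ofReal_mul (by positivity)]
  gcongr
  exact norm_freqMul_le hω g hξ

omit [CompleteSpace H] in
theorem hasDerivAt_wave {φ : Space n → ℝ} (hφ : Measurable φ) {ℓ : ℝ} (hℓ : 0 < ℓ)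
    {g : Space n → H} (hg : MemLp g 2 (volume.restrict (shell n ℓ))) (t : ℝ) {ω : Space n}
    (hω : ‖ω‖ = 1) (s : ℝ) :
    HasDerivAt (fun s : ℝ => wave φ (shell n ℓ) g t (s • ω))
      (wave φ (shell n ℓ) (freqMul ω g) t (s • ω)) s := by
  have hgi := integrableOn_shell hℓ hg
  have hgi' := integrableOn_shell hℓ (memLp_freqMul hω hg)
  refine (hasDerivAt_integral_of_dominated_loc_of_deriv_le (𝕜 := ℝ)
    (F := fun (s : ℝ) ξ => Complex.exp ((t * φ ξ + 2 * Real.pi * inner ℝ ξ (s • ω) : ℝ)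
      * Complex.I) • g ξ)
    (F' := fun (s : ℝ) ξ => Complex.exp ((t * φ ξ + 2 * Real.pi * inner ℝ ξ (s • ω) : ℝ)
      * Complex.I) • freqMul ω g ξ) (bound := fun ξ => ‖freqMul ω g ξ‖)
    (Metric.ball_mem_nhds s one_pos)
    (Filter.Eventually.of_forall fun u => (integrable_wave_integrand hφ hgi t (u • ω)).1)
    (integrable_wave_integrand hφ hgi t (s • ω))
    (integrable_wave_integrand hφ hgi' t (s • ω)).1 (ae_of_all _ fun ξ u _ => ?_) hgi'.norm
    (ae_of_all _ fun ξ u _ => ?_)).2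
  · rw [norm_smul, Complex.norm_exp_ofReal_mul_I, one_mul]
  · unfold freqMul
    rw [smul_smul]
    refine HasDerivAt.smul_const ?_ _
    have h1 : HasDerivAt (fun u : ℝ => t * φ ξ + 2 * Real.pi * inner ℝ ξ (u • ω))
        (2 * Real.pi * inner ℝ ξ ω) u := by
      simp only [inner_smul_right]
      have h0 := ((hasDerivAt_id u).mul_const (inner ℝ ξ ω)).const_mul (2 * Real.pi)
      simpa using h0.const_add (t * φ ξ)
    exact (h1.ofReal_comp.mul_const Complex.I).cexp

/-- The density `|v|² + n ℓ⁻² |∇v|²` of the wave `v` with frequencies in the shell of radius `ℓ`. -/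
def density (φ : Space n → ℝ) (ℓ : ℝ) (g : Space n → H) (t : ℝ) (x : Space n) : ℝ≥0∞ :=
  ‖wave φ (shell n ℓ) g t x‖ₑ ^ 2 + ENNReal.ofReal (ℓ⁻¹ ^ 2) * (n * ∑ k,
    ‖wave φ (shell n ℓ) (freqMul (EuclideanSpace.single k 1) g) t x‖ₑ ^ 2)

omit [CompleteSpace H] in
theorem wave_freqMul {φ : Space n → ℝ} (hφ : Measurable φ) {ℓ : ℝ} (hℓ : 0 < ℓ)
    {g : Space n → H} (hg : MemLp g 2 (volume.restrict (shell n ℓ))) (t : ℝ) (x ω : Space n) :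
    wave φ (shell n ℓ) (freqMul ω g) t x = ∑ k, (ω k : ℂ) •
      wave φ (shell n ℓ) (freqMul (EuclideanSpace.single k 1) g) t x := by
  have hi (k : Fin n) := integrable_wave_integrand hφ (integrableOn_shell hℓ
    (memLp_freqMul (ω := EuclideanSpace.single k 1) (by simp) hg)) t x
  simp only [wave]
  simp_rw [← integral_smul]
  refine Eq.trans ?_ (integral_finsetSum _ fun k _ => (hi k).smul (ω k : ℂ))
  refine integral_congr_ae (ae_of_all _ fun ξ => ?_)
  have h1 (k : Fin n) : inner ℝ ξ (EuclideanSpace.single k (1 : ℝ)) = ξ k := by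
    simp [EuclideanSpace.inner_single_right]
  have h2 : inner ℝ ξ ω = ∑ k, ω k * ξ k := by simp [PiLp.inner_apply]
  simp only [freqMul, smul_smul, ← Finset.sum_smul, h1, h2]
  congr 1
  generalize Complex.exp _ = E
  push_cast
  simp only [Finset.mul_sum, Finset.sum_mul]
  refine Finset.sum_congr rfl fun k _ => ?_
  ring

omit [CompleteSpace H] in
theorem enorm_wave_freqMul_sq_le {φ : Space n → ℝ} (hφ : Measurable φ) {ℓ : ℝ} (hℓ : 0 < ℓ)
    {g : Space n → H} (hg : MemLp g 2 (volume.restrict (shell n ℓ))) (t : ℝ) (x : Space n)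
    {ω : Space n} (hω : ‖ω‖ = 1) :
    ‖wave φ (shell n ℓ) (freqMul ω g) t x‖ₑ ^ 2 ≤ n * ∑ k,
      ‖wave φ (shell n ℓ) (freqMul (EuclideanSpace.single k 1) g) t x‖ₑ ^ 2 := by
  set a : Fin n → ℝ := fun k => ‖wave φ (shell n ℓ) (freqMul (EuclideanSpace.single k 1) g) t x‖
  have h1 : ‖wave φ (shell n ℓ) (freqMul ω g) t x‖ ≤ ∑ k, a k := by
    rw [wave_freqMul hφ hℓ hg]
    refine (norm_sum_le _ _).trans (Finset.sum_le_sum fun k _ => ?_)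
    rw [norm_smul, Complex.norm_real]
    refine mul_le_of_le_one_left (norm_nonneg _) ?_
    rw [← hω]
    exact PiLp.norm_apply_le ω k
  have h2 : ‖wave φ (shell n ℓ) (freqMul ω g) t x‖ ^ 2 ≤ n * ∑ k, a k ^ 2 := by
    refine (pow_le_pow_left₀ (norm_nonneg _) h1 2).trans ?_
    simpa using sq_sum_le_card_mul_sum_sq (s := Finset.univ) (f := a)
  have h3 := ENNReal.ofReal_le_ofReal h2
  rw [ENNReal.ofReal_pow (norm_nonneg _), ofReal_norm, ENNReal.ofReal_mul (by positivity),
    ENNReal.ofReal_sum_of_nonneg (fun k _ => by positivity), ENNReal.ofReal_natCast] at h3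
  refine h3.trans (le_of_eq ?_)
  congr 1
  refine Finset.sum_congr rfl fun k _ => ?_
  rw [ENNReal.ofReal_pow (norm_nonneg _), ofReal_norm]

omit [CompleteSpace H] in
theorem measurable_density {φ : Space n → ℝ} (hφ : Measurable φ) {ℓ : ℝ} (hℓ : 0 < ℓ)
    {g : Space n → H} (hg : MemLp g 2 (volume.restrict (shell n ℓ))) :
    Measurable (Function.uncurry (density φ ℓ g)) := by
  refine (measurable_enorm_wave_sq hφ (integrableOn_shell hℓ hg)).add (Measurable.const_mul
    (Measurable.const_mul (Finset.measurable_fun_sum _ fun k _ => ?_) _) _)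
  exact measurable_enorm_wave_sq hφ (integrableOn_shell hℓ
    (memLp_freqMul (ω := EuclideanSpace.single k 1) (by simp) hg))

omit [CompleteSpace H] in
/-- Derivatives of waves are waves with data `freqMul ω g`, and `freqMul ω` costs a factor `ℓ`, which
the weight `ℓ⁻²` of the density compensates. So each `L²` bound for waves holds for the density. -/
theorem lintegral_density_le {φ : Space n → ℝ} (hφ : Measurable φ) {ℓ : ℝ} (hℓ : 0 < ℓ)
    (ρ : Measure (ℝ × Space n)) {c : ℝ} (hc : 0 < c)
    (h : ∀ g : Space n → H, MemLp g 2 (volume.restrict (shell n ℓ)) →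
      ∫⁻ z, ‖wave φ (shell n ℓ) g z.1 z.2‖ₑ ^ 2 ∂ρ
        ≤ ENNReal.ofReal c * ∫⁻ ξ in shell n ℓ, ‖g ξ‖ₑ ^ 2)
    {g : Space n → H} (hg : MemLp g 2 (volume.restrict (shell n ℓ))) :
    ∫⁻ z, density φ ℓ g z.1 z.2 ∂ρ ≤ ENNReal.ofReal ((1 + 16 * Real.pi ^ 2 * n ^ 2) * c)
      * ∫⁻ ξ in shell n ℓ, ‖g ξ‖ₑ ^ 2 := by
  set A := ∫⁻ ξ in shell n ℓ, ‖g ξ‖ₑ ^ 2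
  have hk (k : Fin n) := memLp_freqMul (ω := EuclideanSpace.single k 1) (by simp) hg
  have hm (k : Fin n) : Measurable fun z : ℝ × Space n =>
      ‖wave φ (shell n ℓ) (freqMul (EuclideanSpace.single k 1) g) z.1 z.2‖ₑ ^ 2 :=
    measurable_enorm_wave_sq hφ (integrableOn_shell hℓ (hk k))
  have hm' := Finset.measurable_fun_sum Finset.univ fun k _ => hm k
  have h1 (k : Fin n) : ∫⁻ z,
      ‖wave φ (shell n ℓ) (freqMul (EuclideanSpace.single k 1) g) z.1 z.2‖ₑ ^ 2 ∂ρ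
      ≤ ENNReal.ofReal (c * (4 * Real.pi * ℓ) ^ 2) * A := by
    refine (h _ (hk k)).trans ?_
    rw [ENNReal.ofReal_mul hc.le, mul_assoc]
    gcongr
    exact lintegral_freqMul_le hℓ (by simp) g
  simp only [density]
  rw [lintegral_add_right _ ((hm'.const_mul _).const_mul _),
    lintegral_const_mul _ (hm'.const_mul _), lintegral_const_mul _ hm',
    lintegral_finsetSum _ fun k _ => hm k]
  calc _ ≤ ENNReal.ofReal c * A + ENNReal.ofReal (ℓ⁻¹ ^ 2) * (n * ∑ k : Fin n,
        ENNReal.ofReal (c * (4 * Real.pi * ℓ) ^ 2) * A) := by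
        gcongr with k
        · exact h g hg
        · exact h1 k
    _ = _ := by
      rw [Finset.sum_const, Finset.card_univ, Fintype.card_fin, nsmul_eq_mul,
        ← ENNReal.ofReal_natCast, ← mul_assoc (ENNReal.ofReal (n : ℝ)),
        ← mul_assoc (ENNReal.ofReal (n : ℝ) * _), ← mul_assoc (ENNReal.ofReal (ℓ⁻¹ ^ 2)),
        ← ENNReal.ofReal_mul (by positivity), ← ENNReal.ofReal_mul (by positivity),
        ← ENNReal.ofReal_mul (by positivity), ← add_mul,
        ← ENNReal.ofReal_add (by positivity) (by positivity)]
      congr 2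
      field_simp
      ring

/-- The four bounds for waves, for the density instead of `|v|²`. -/
theorem exists_density_bounds (n : ℕ) [NeZero n] (H : Type*) [NormedAddCommGroup H]
    [InnerProductSpace ℂ H] [CompleteSpace H] : ∃ C : ℝ, 0 < C ∧
    ∀ {φ : Space n → ℝ} {ℓ w : ℝ}, IsDispersive φ ℓ w → ∀ {g : Space n → H},
      MemLp g 2 (volume.restrict (shell n ℓ)) →
      (∀ x, ∫⁻ t, density φ ℓ g t x
        ≤ ENNReal.ofReal (C * (ℓ ^ (n - 1) / w)) * ∫⁻ ξ in shell n ℓ, ‖g ξ‖ₑ ^ 2) ∧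
      (∀ {R : ℝ}, 0 < R → ∫⁻ t, ∫⁻ x in Metric.closedBall 0 (2 * R), density φ ℓ g t x
        ≤ ENNReal.ofReal (C * (R / w)) * ∫⁻ ξ in shell n ℓ, ‖g ξ‖ₑ ^ 2) ∧
      (∀ {R : ℝ}, 0 < R → ∀ t, ∫⁻ x in Metric.closedBall 0 (2 * R), density φ ℓ g t x
        ≤ ENNReal.ofReal C * ∫⁻ ξ in shell n ℓ, ‖g ξ‖ₑ ^ 2) ∧
      (∀ t x, density φ ℓ g t x
        ≤ ENNReal.ofReal (C * ℓ ^ n) * ∫⁻ ξ in shell n ℓ, ‖g ξ‖ₑ ^ 2) := by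
  obtain ⟨C₁, hC₁, h₁⟩ := exists_lintegral_time_wave_le (H := H) n
  obtain ⟨C₂, hC₂, h₂⟩ := exists_lintegral_time_space_wave_le (H := H) n
  obtain ⟨C₃, hC₃, h₃⟩ := exists_lintegral_space_wave_le (H := H) n
  obtain ⟨C₄, hC₄, h₄⟩ := exists_enorm_wave_le (H := H) n
  set M : ℝ := 1 + 16 * Real.pi ^ 2 * n ^ 2
  have hM : 0 < M := by positivity
  refine ⟨M * (C₁ + C₂ + C₃ + C₄), by positivity, fun {φ ℓ w} hφ {g} hg => ?_⟩
  have hℓ := hφ.pos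
  have hw := hφ.speed_pos
  have hD := measurable_density hφ.measurable hφ.pos hg
  have hmw {g : Space n → H} (hg : MemLp g 2 (volume.restrict (shell n ℓ))) :=
    measurable_enorm_wave_sq hφ.measurable (integrableOn_shell hℓ hg)
  refine ⟨fun x => ?_, fun {R} hR => ?_, fun {R} hR t => ?_, fun t x => ?_⟩
  · have h := lintegral_density_le hφ.measurable hℓ ((volume : Measure ℝ).prod (Measure.dirac x))
      (c := C₁ * (ℓ ^ (n - 1) / w)) (by positivity) (fun g hg => by
        refine (lintegral_prod_uncurry (hmw hg)).trans_le
          (le_trans (le_of_eq (lintegral_congr fun t => ?_)) (h₁ hφ hg x))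
        exact lintegral_dirac' x (Measurable.of_uncurry_left (hmw hg))) hg
    replace h := (lintegral_prod_uncurry hD).symm.trans_le h
    refine (le_of_eq (lintegral_congr fun t => ?_)).trans
      (h.trans (mul_le_mul_left (ENNReal.ofReal_le_ofReal ?_) _))
    · exact (lintegral_dirac' x (Measurable.of_uncurry_left hD)).symm
    · rw [← mul_assoc]; gcongr; linarith
  · have h := lintegral_density_le hφ.measurable hℓ ((volume : Measure ℝ).prod
      (volume.restrict (Metric.closedBall 0 (2 * R)))) (c := C₂ * (R / w)) (by positivity)
      (fun g hg => (lintegral_prod_uncurry (hmw hg)).trans_le (h₂ hφ hg hR)) hg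
    refine (lintegral_prod_uncurry hD).symm.trans_le
      (h.trans (mul_le_mul_left (ENNReal.ofReal_le_ofReal ?_) _))
    rw [← mul_assoc]; gcongr; linarith
  · have h := lintegral_density_le hφ.measurable hℓ ((Measure.dirac t).prod
      (volume.restrict (Metric.closedBall 0 (2 * R)))) (c := C₃) (by positivity)
      (fun g hg => ((lintegral_prod_uncurry (hmw hg)).trans
          (lintegral_dirac' t (hmw hg).lintegral_prod_right)).trans_le
            (h₃ hφ.measurable hℓ hg hR t)) hg
    replace h := ((lintegral_prod_uncurry hD).trans
      (lintegral_dirac' t hD.lintegral_prod_right)).symm.trans_le h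
    refine h.trans (mul_le_mul_left (ENNReal.ofReal_le_ofReal ?_) _)
    gcongr; linarith
  · have h := lintegral_density_le hφ.measurable hℓ (Measure.dirac (t, x))
      (c := C₄ * ℓ ^ n) (by positivity)
      (fun g hg => by
        have := lintegral_dirac' (t, x) (hmw hg)
        simp only [Function.uncurry_def] at this
        rw [this]
        exact h₄ hφ.measurable hℓ hg t x) hg
    have hd := lintegral_dirac' (t, x) hD
    simp only [Function.uncurry_def] at hd
    rw [hd] at h
    refine h.trans (mul_le_mul_left (ENNReal.ofReal_le_ofReal ?_) _)
    rw [← mul_assoc]; gcongr; linarith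

end

/-! ### Spherical means of waves -/

section

variable {n : ℕ} {H : Type*} [NormedAddCommGroup H] [InnerProductSpace ℂ H] [CompleteSpace H]

/-- The square of the `L²` norm of `ω ↦ v (r ω)` over the unit sphere. -/
def sphereMass (v : Space n → H) (r : ℝ) : ℝ≥0∞ :=
  ∫⁻ ω : Metric.sphere (0 : Space n) 1, ‖v (r • ω.1)‖ₑ ^ 2 ∂(volume : Measure (Space n)).toSphere

/-- The integral of the density over the cone over the unit sphere with radii in `[a, b]`,
with respect to `dr dω`. -/
def shellEnergy (φ : Space n → ℝ) (ℓ : ℝ) (g : Space n → H) (a b t : ℝ) : ℝ≥0∞ :=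
  ∫⁻ ω : Metric.sphere (0 : Space n) 1, ∫⁻ s in Icc a b, density φ ℓ g t (s • ω.1)
    ∂(volume : Measure ℝ) ∂(volume : Measure (Space n)).toSphere

section

variable {φ : Space n → ℝ} {ℓ w : ℝ} {g : Space n → H}

omit [CompleteSpace H] in
theorem measurable_density_ray (hφ : Measurable φ) (hℓ : 0 < ℓ)
    (hg : MemLp g 2 (volume.restrict (shell n ℓ))) :
    Measurable fun z : ℝ × Metric.sphere (0 : Space n) 1 × ℝ =>
      density φ ℓ g z.1 (z.2.2 • z.2.1.1) :=
  (measurable_density hφ hℓ hg).comp (g := Function.uncurry (density φ ℓ g))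
    (f := fun z : ℝ × Metric.sphere (0 : Space n) 1 × ℝ => (z.1, z.2.2 • z.2.1.1)) (by fun_prop)

omit [CompleteSpace H] in
theorem measurable_shellEnergy (hφ : Measurable φ) (hℓ : 0 < ℓ)
    (hg : MemLp g 2 (volume.restrict (shell n ℓ))) (a b : ℝ) :
    Measurable (shellEnergy φ ℓ g a b) := by
  have h := measurable_density_ray hφ hℓ hg
  have h1 : Measurable fun z : (ℝ × Metric.sphere (0 : Space n) 1) × ℝ =>
      density φ ℓ g z.1.1 (z.2 • z.1.2.1) :=
    h.comp (f := fun z : (ℝ × Metric.sphere (0 : Space n) 1) × ℝ => (z.1.1, z.1.2, z.2))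
      (by fun_prop)
  exact (h1.lintegral_prod_right' (ν := volume.restrict (Icc a b))).lintegral_prod_right'

/-- The one-dimensional Sobolev inequality along each ray. -/
theorem sphereMass_wave_le (hφ : Measurable φ) (hℓ : 0 < ℓ)
    (hg : MemLp g 2 (volume.restrict (shell n ℓ))) {a b : ℝ} (hab : ℓ⁻¹ ≤ b - a) {r : ℝ}
    (hr : r ∈ Icc a b) (t : ℝ) : sphereMass (wave φ (shell n ℓ) g t) r
      ≤ ENNReal.ofReal (2 * ℓ) * shellEnergy φ ℓ g a b t := by
  have hℓ' : 0 < ℓ⁻¹ := by positivity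
  have hmr : Measurable fun z : Metric.sphere (0 : Space n) 1 × ℝ =>
      density φ ℓ g t (z.2 • z.1.1) :=
    (measurable_density_ray hφ hℓ hg).comp
      (f := fun z : Metric.sphere (0 : Space n) 1 × ℝ => (t, z.1, z.2)) (by fun_prop)
  have hmω : Measurable fun ω : Metric.sphere (0 : Space n) 1 =>
      ∫⁻ s in Icc a b, density φ ℓ g t (s • ω.1) :=
    hmr.lintegral_prod_right' (ν := volume.restrict (Icc a b))
  rw [sphereMass, shellEnergy, ← lintegral_const_mul _ hmω]
  refine lintegral_mono fun ω => ?_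
  have hω : ‖ω.1‖ = 1 := by simp
  -- an interval of length `1 / ℓ` that contains `r`
  set c := min r (b - ℓ⁻¹) with hc
  have hc1 : r ∈ Icc c (c + ℓ⁻¹) := by
    refine ⟨min_le_left _ _, ?_⟩
    rcases min_cases r (b - ℓ⁻¹) with h | h <;> rw [hc, h.1] <;> linarith [hr.2]
  have hc2 : Icc c (c + ℓ⁻¹) ⊆ Icc a b :=
    Icc_subset_Icc (le_min hr.1 (by linarith)) (by linarith [min_le_right r (b - ℓ⁻¹)])
  have hcont : Continuous fun s : ℝ => wave φ (shell n ℓ) (freqMul ω.1 g) t (s • ω.1) :=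
    (continuous_wave hφ (integrableOn_shell hℓ (memLp_freqMul hω hg))).comp
      (g := Function.uncurry (wave φ (shell n ℓ) (freqMul ω.1 g)))
      (f := fun s : ℝ => (t, s • ω.1)) (by fun_prop)
  have hsob := enorm_sq_le_of_hasDerivAt (fun s => hasDerivAt_wave hφ hℓ hg t hω s) hcont hℓ hc1
  refine hsob.trans (mul_le_mul_right ?_ _)
  refine (lintegral_mono_set hc2).trans (lintegral_mono fun s => ?_)
  unfold density
  gcongr
  exact enorm_wave_freqMul_sq_le hφ hℓ hg t _ hω

omit [CompleteSpace H] in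
theorem measurable_sphereMass_wave (hφ : Measurable φ) (hℓ : 0 < ℓ)
    (hg : MemLp g 2 (volume.restrict (shell n ℓ))) (t : ℝ) :
    Measurable (sphereMass (wave φ (shell n ℓ) g t)) := by
  have hm : Measurable fun z : ℝ × Metric.sphere (0 : Space n) 1 =>
      ‖wave φ (shell n ℓ) g t (z.1 • z.2.1)‖ₑ ^ 2 :=
    (measurable_enorm_wave_sq hφ (integrableOn_shell hℓ hg)).comp
      (f := fun z : ℝ × Metric.sphere (0 : Space n) 1 => (t, z.1 • z.2.1)) (by fun_prop)
  exact hm.lintegral_prod_right'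

omit [CompleteSpace H] in
theorem setLIntegral_sphereMass_wave_le (hφ : Measurable φ) (hℓ : 0 < ℓ)
    (hg : MemLp g 2 (volume.restrict (shell n ℓ))) {a b R : ℝ}
    (hsub : Ico R (2 * R) ⊆ Icc a b) (t : ℝ) :
    ∫⁻ r in Ico R (2 * R), sphereMass (wave φ (shell n ℓ) g t) r ≤ shellEnergy φ ℓ g a b t := by
  have hm : Measurable fun z : ℝ × Metric.sphere (0 : Space n) 1 =>
      ‖wave φ (shell n ℓ) g t (z.1 • z.2.1)‖ₑ ^ 2 :=
    (measurable_enorm_wave_sq hφ (integrableOn_shell hℓ hg)).comp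
      (f := fun z : ℝ × Metric.sphere (0 : Space n) 1 => (t, z.1 • z.2.1)) (by fun_prop)
  unfold sphereMass shellEnergy
  rw [lintegral_lintegral_swap hm.aemeasurable]
  refine lintegral_mono fun ω => (lintegral_mono_set hsub).trans (lintegral_mono fun s => ?_)
  exact le_self_add

omit [CompleteSpace H] in
/-- Here `dr dω` is at most `R ^ (-(n - 1)) dx`, as `r ≥ R`. -/
theorem shellEnergy_le_closedBall [NeZero n] (hφ : Measurable φ) (hℓ : 0 < ℓ)
    (hg : MemLp g 2 (volume.restrict (shell n ℓ))) {R : ℝ} (hR : 0 < R) (t : ℝ) :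
    shellEnergy φ ℓ g R (2 * R) t ≤ ENNReal.ofReal (R / R ^ n) *
      ∫⁻ x in Metric.closedBall 0 (2 * R), density φ ℓ g t x := by
  have hm : Measurable (density φ ℓ g t) :=
    Measurable.of_uncurry_left (measurable_density hφ hℓ hg)
  rw [← lintegral_indicator Metric.isClosed_closedBall.measurableSet,
    lintegral_polar (hm.indicator Metric.isClosed_closedBall.measurableSet),
    ← lintegral_const_mul' _ _ ENNReal.ofReal_ne_top]
  refine lintegral_mono fun ω => ?_
  rw [← lintegral_const_mul' _ _ ENNReal.ofReal_ne_top]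
  refine le_trans ?_ (lintegral_mono_set (s := Icc R (2 * R)) fun r hr => hR.trans_le hr.1)
  refine setLIntegral_mono' measurableSet_Icc fun r hr => ?_
  have hr0 : 0 < r := hR.trans_le hr.1
  have hω : ‖r • ω.1‖ = r := by simp [norm_smul, hr0.le]
  rw [indicator_of_mem (by simpa [hω] using hr.2), ← mul_assoc,
    ← ENNReal.ofReal_mul (by positivity)]
  refine le_mul_of_one_le_left' ?_
  rw [ENNReal.one_le_ofReal]
  obtain ⟨k, rfl⟩ : ∃ k, n = k + 1 := ⟨n - 1, (Nat.succ_pred (NeZero.ne n)).symm⟩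
  rw [Nat.add_sub_cancel]
  calc (1 : ℝ) = R / R ^ (k + 1) * R ^ k := by rw [pow_succ]; field_simp
    _ ≤ _ := by
      gcongr
      exact hr.1

end

/-- On the shell of radius `R`, the spherical mean of a wave with frequencies of size `ℓ` is
controlled by a function of time that is bounded, by conservation of the `L²` norm, and integrable,
by local smoothing. The length `max R ℓ⁻¹` is the larger one of the radius and the wave length;
below the wave length, the density is integrated over the whole segment `[0, 2 / ℓ]`. -/
theorem exists_energy (n : ℕ) [NeZero n] (H : Type*) [NormedAddCommGroup H]
    [InnerProductSpace ℂ H] [CompleteSpace H] : ∃ C : ℝ, 0 < C ∧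
    ∀ {φ : Space n → ℝ} {ℓ w : ℝ}, IsDispersive φ ℓ w → ∀ {g : Space n → H},
      MemLp g 2 (volume.restrict (shell n ℓ)) → ∀ {R : ℝ}, 0 < R → ∃ e : ℝ → ℝ≥0∞,
      Measurable e ∧
      (∀ t, ∀ r ∈ Ico R (2 * R),
        sphereMass (wave φ (shell n ℓ) g t) r ≤ ENNReal.ofReal (2 * ℓ) * e t) ∧
      (∀ t, ∫⁻ r in Ico R (2 * R), sphereMass (wave φ (shell n ℓ) g t) r ≤ e t) ∧
      (∫⁻ t, e t ≤ ENNReal.ofReal (C * (max R ℓ⁻¹ ^ 2 / max R ℓ⁻¹ ^ n / w)) *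
        ∫⁻ ξ in shell n ℓ, ‖g ξ‖ₑ ^ 2) ∧
      (∀ t, e t ≤ ENNReal.ofReal (C * (max R ℓ⁻¹ / max R ℓ⁻¹ ^ n)) *
        ∫⁻ ξ in shell n ℓ, ‖g ξ‖ₑ ^ 2) := by
  obtain ⟨C, hC, hbd⟩ := exists_density_bounds n H
  set S := (volume : Measure (Space n)).toSphere.real univ
  have hS : 0 ≤ S := measureReal_nonneg
  refine ⟨C * (1 + 2 * S), by positivity, fun {φ ℓ w} hφ {g} hg R hR => ?_⟩
  obtain ⟨h1, h2, h3, h4⟩ := hbd hφ hg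
  have hℓ := hφ.pos
  have hw := hφ.speed_pos
  have hφm := hφ.measurable
  set A := ∫⁻ ξ in shell n ℓ, ‖g ξ‖ₑ ^ 2
  rcases le_total ℓ⁻¹ R with hRℓ | hRℓ
  · rw [max_eq_left hRℓ]
    have hb := shellEnergy_le_closedBall hφm hℓ hg hR
    refine ⟨shellEnergy φ ℓ g R (2 * R), measurable_shellEnergy hφm hℓ hg _ _, fun t r hr =>
      sphereMass_wave_le hφm hℓ hg (by linarith) (Ico_subset_Icc_self hr) t, fun t =>
      setLIntegral_sphereMass_wave_le hφm hℓ hg Ico_subset_Icc_self t, ?_, fun t => ?_⟩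
    · refine (lintegral_mono hb).trans ?_
      rw [lintegral_const_mul' _ _ ENNReal.ofReal_ne_top]
      refine (mul_le_mul_right (h2 hR) _).trans ?_
      rw [← mul_assoc, ← ENNReal.ofReal_mul (by positivity)]
      refine mul_le_mul_left (ENNReal.ofReal_le_ofReal ?_) _
      calc R / R ^ n * (C * (R / w)) = C * 1 * (R ^ 2 / R ^ n / w) := by ring
        _ ≤ _ := by gcongr; linarith
    · refine (hb t).trans ((mul_le_mul_right (h3 hR t) _).trans ?_)
      rw [← mul_assoc, ← ENNReal.ofReal_mul (by positivity)]
      refine mul_le_mul_left (ENNReal.ofReal_le_ofReal ?_) _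
      calc R / R ^ n * C = C * 1 * (R / R ^ n) := by ring
        _ ≤ _ := by gcongr; linarith
  · rw [max_eq_right hRℓ]
    have hsub : Ico R (2 * R) ⊆ Icc 0 (2 * ℓ⁻¹) := fun r hr =>
      ⟨hR.le.trans hr.1, hr.2.le.trans (by linarith)⟩
    have hmr := measurable_density_ray hφm hℓ hg
    obtain ⟨k, rfl⟩ : ∃ k, n = k + 1 := ⟨n - 1, (Nat.succ_pred (NeZero.ne n)).symm⟩
    refine ⟨shellEnergy φ ℓ g 0 (2 * ℓ⁻¹), measurable_shellEnergy hφm hℓ hg _ _, fun t r hr =>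
      sphereMass_wave_le hφm hℓ hg (by have : 0 < ℓ⁻¹ := by positivity
                                       linarith) (hsub hr) t, fun t =>
      setLIntegral_sphereMass_wave_le hφm hℓ hg hsub t, ?_, fun t => ?_⟩
    · unfold shellEnergy
      have hs1 : Measurable fun z : (ℝ × Metric.sphere (0 : Space (k + 1)) 1) × ℝ =>
          density φ ℓ g z.1.1 (z.2 • z.1.2.1) :=
        hmr.comp (f := fun z : (ℝ × Metric.sphere (0 : Space (k + 1)) 1) × ℝ =>
          (z.1.1, z.1.2, z.2)) (by fun_prop)
      have hs2 (ω : Metric.sphere (0 : Space (k + 1)) 1) : Measurable fun z : ℝ × ℝ =>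
          density φ ℓ g z.1 (z.2 • ω.1) :=
        hmr.comp (f := fun z : ℝ × ℝ => (z.1, ω, z.2)) (by fun_prop)
      rw [lintegral_lintegral_swap (hs1.lintegral_prod_right'
        (ν := volume.restrict (Icc 0 (2 * ℓ⁻¹)))).aemeasurable]
      calc _ ≤ ∫⁻ _ω : Metric.sphere (0 : Space (k + 1)) 1, ∫⁻ _s in Icc 0 (2 * ℓ⁻¹),
            ENNReal.ofReal (C * (ℓ ^ (k + 1 - 1) / w)) * A
            ∂(volume : Measure ℝ) ∂(volume : Measure (Space (k + 1))).toSphere := by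
            refine lintegral_mono fun ω => ?_
            rw [lintegral_lintegral_swap (hs2 ω).aemeasurable]
            exact lintegral_mono fun s => h1 _
        _ ≤ _ := by
            rw [setLIntegral_const, lintegral_const, Real.volume_Icc, sub_zero, ← ofReal_measureReal,
              mul_right_comm (ENNReal.ofReal _) A, mul_right_comm _ A,
              ← ENNReal.ofReal_mul (by positivity), ← ENNReal.ofReal_mul (by positivity)]
            refine mul_le_mul_left (ENNReal.ofReal_le_ofReal ?_) _
            change _ * S ≤ _
            have h5 : C * (ℓ ^ (k + 1 - 1) / w) * (2 * ℓ⁻¹) * S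
                = C * (2 * S) * (ℓ⁻¹ ^ 2 / ℓ⁻¹ ^ (k + 1) / w) := by
              rw [Nat.add_sub_cancel, inv_pow, inv_pow]
              field_simp
              ring
            rw [h5]
            gcongr
            linarith
    · calc shellEnergy φ ℓ g 0 (2 * ℓ⁻¹) t
          ≤ ∫⁻ _ω : Metric.sphere (0 : Space (k + 1)) 1, ∫⁻ _s in Icc 0 (2 * ℓ⁻¹),
            ENNReal.ofReal (C * ℓ ^ (k + 1)) * A
            ∂(volume : Measure ℝ) ∂(volume : Measure (Space (k + 1))).toSphere :=
            lintegral_mono fun ω => lintegral_mono fun s => h4 _ _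
        _ ≤ _ := by
            rw [setLIntegral_const, lintegral_const, Real.volume_Icc, sub_zero, ← ofReal_measureReal,
              mul_right_comm (ENNReal.ofReal _) A, mul_right_comm _ A,
              ← ENNReal.ofReal_mul (by positivity), ← ENNReal.ofReal_mul (by positivity)]
            refine mul_le_mul_left (ENNReal.ofReal_le_ofReal ?_) _
            change _ * S ≤ _
            have h5 : C * ℓ ^ (k + 1) * (2 * ℓ⁻¹) * S
                = C * (2 * S) * (ℓ⁻¹ / ℓ⁻¹ ^ (k + 1)) := by
              rw [inv_pow]
              field_simp
            rw [h5]
            gcongr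
            linarith

end

/-! ### Interpolation in radius and time -/

section

variable {n : ℕ} {H : Type*} [NormedAddCommGroup H] [InnerProductSpace ℂ H] [CompleteSpace H]

/-- The radii in `[R, 2R)`. -/
def radii (R : ℝ) : Set (Ioi (0 : ℝ)) := {r | r.1 ∈ Ico R (2 * R)}

theorem measurableSet_radii (R : ℝ) : MeasurableSet (radii R) :=
  measurable_subtype_coe measurableSet_Ico

theorem setLIntegral_radii_le {R : ℝ} (k : ℕ) (f : ℝ → ℝ≥0∞) :
    ∫⁻ r in radii R, f r.1 ∂(Measure.volumeIoiPow k)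
      ≤ ENNReal.ofReal ((2 * R) ^ k) * ∫⁻ r in Ico R (2 * R), f r := by
  have h1 : ∫⁻ r in radii R, f r.1 ∂(Measure.volumeIoiPow k)
      = ∫⁻ r, (Ico R (2 * R)).indicator f r.1 ∂(Measure.volumeIoiPow k) := by
    rw [← lintegral_indicator (measurableSet_radii R)]
    rfl
  rw [h1, lintegral_volumeIoiPow, ← lintegral_const_mul' _ _ ENNReal.ofReal_ne_top,
    ← lintegral_indicator measurableSet_Ico]
  refine (setLIntegral_mono' measurableSet_Ioi fun r (hr : 0 < r) => ?_).trans
    (setLIntegral_le_lintegral _ _)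
  by_cases h : r ∈ Ico R (2 * R)
  · rw [indicator_of_mem h, indicator_of_mem h]
    gcongr
    exact h.2.le
  · rw [indicator_of_notMem h, indicator_of_notMem h, mul_zero]

/-- Interpolation in the radial variable between a supremum bound and an `L¹` bound for the
square. -/
theorem eLpNorm_radii_le {q : ℝ≥0∞} (hq : 2 < q) (hq' : q < ∞) {R ℓ : ℝ} (hR : 0 < R)
    (hℓ : 0 < ℓ) (k : ℕ) {f : ℝ → ℝ≥0∞} (hf : Measurable f) {e : ℝ≥0∞}
    (h1 : ∀ r ∈ Ico R (2 * R), f r ≤ ENNReal.ofReal (2 * ℓ) * e)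
    (h2 : ∫⁻ r in Ico R (2 * R), f r ≤ e) :
    eLpNorm (fun r : Ioi (0 : ℝ) => f r.1 ^ (1 / 2 : ℝ)) q
      ((Measure.volumeIoiPow k).restrict (radii R))
      ≤ ENNReal.ofReal (((2 * R) ^ k * (2 * ℓ) ^ (q.toReal / 2 - 1) * min 1 (2 * ℓ * R))
        ^ q⁻¹.toReal) * e ^ (1 / 2 : ℝ) := by
  set Q := q.toReal with hQ
  have hQ2 : 2 < Q := by
    have := (ENNReal.toReal_lt_toReal (by simp) hq'.ne).2 hq
    simpa using this
  have hα : 0 ≤ Q / 2 - 1 := by linarith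
  have hsplit (x : ℝ≥0∞) : x ^ (Q / 2) = x ^ (Q / 2 - 1) * x := by
    nth_rewrite 3 [← ENNReal.rpow_one x]
    rw [← ENNReal.rpow_add_of_nonneg _ _ hα zero_le_one]
    congr 1
    ring
  have h3 : ∫⁻ r in Ico R (2 * R), f r ≤ ENNReal.ofReal (min 1 (2 * ℓ * R)) * e := by
    rcases min_cases 1 (2 * ℓ * R) with h | h
    · rw [h.1, ENNReal.ofReal_one, one_mul]
      exact h2
    · rw [h.1]
      refine (setLIntegral_mono' measurableSet_Ico h1).trans (le_of_eq ?_)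
      rw [setLIntegral_const, Real.volume_Ico, mul_right_comm, ← ENNReal.ofReal_mul (by positivity)]
      congr 2
      ring
  have hmain : ∫⁻ r in radii R, f r.1 ^ (Q / 2) ∂(Measure.volumeIoiPow k)
      ≤ ENNReal.ofReal ((2 * R) ^ k * (2 * ℓ) ^ (Q / 2 - 1) * min 1 (2 * ℓ * R)) * e ^ (Q / 2) := by
    calc _ ≤ ENNReal.ofReal ((2 * R) ^ k) * ∫⁻ r in Ico R (2 * R), f r ^ (Q / 2) :=
          setLIntegral_radii_le k fun r => f r ^ (Q / 2)
      _ ≤ ENNReal.ofReal ((2 * R) ^ k) * ∫⁻ r in Ico R (2 * R),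
            (ENNReal.ofReal (2 * ℓ) * e) ^ (Q / 2 - 1) * f r := by
          refine mul_le_mul_right (setLIntegral_mono' measurableSet_Ico fun r hr => ?_) _
          rw [hsplit]
          gcongr
          exact h1 r hr
      _ ≤ ENNReal.ofReal ((2 * R) ^ k) * ((ENNReal.ofReal (2 * ℓ) * e) ^ (Q / 2 - 1) *
            (ENNReal.ofReal (min 1 (2 * ℓ * R)) * e)) := by
          rw [lintegral_const_mul _ hf]
          gcongr
      _ = _ := by
          rw [ENNReal.mul_rpow_of_nonneg _ _ hα, ENNReal.ofReal_rpow_of_nonneg (by positivity) hα,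
            hsplit, ENNReal.ofReal_mul (by positivity), ENNReal.ofReal_mul (by positivity)]
          ring
  rw [eLpNorm_eq_lintegral_rpow_enorm_toReal (by positivity) hq'.ne, ← hQ]
  simp only [enorm_eq_self, ← ENNReal.rpow_mul]
  have hQi : q⁻¹.toReal = 1 / Q := by rw [ENNReal.toReal_inv, one_div]
  have hexp : (1 / 2 : ℝ) * Q = Q / 2 := by ring
  rw [hexp]
  refine (ENNReal.rpow_le_rpow hmain (by positivity)).trans (le_of_eq ?_)
  rw [ENNReal.mul_rpow_of_nonneg _ _ (by positivity),
    ENNReal.ofReal_rpow_of_nonneg (by positivity) (by positivity), ← ENNReal.rpow_mul, hQi]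
  congr 2
  field_simp

/-- Interpolation in time between `L²` and `L^∞`. -/
theorem eLpNorm_rpow_half_le {p : ℝ≥0∞} (hp : 2 ≤ p) {α : Type*} [MeasurableSpace α]
    {μ : Measure α} {e : α → ℝ≥0∞} (he : Measurable e) {s i : ℝ} (hs : 0 ≤ s) (hi : 0 ≤ i)
    {A : ℝ≥0∞} (h1 : ∀ t, e t ≤ ENNReal.ofReal s * A) (h2 : ∫⁻ t, e t ∂μ ≤ ENNReal.ofReal i * A) :
    eLpNorm (fun t => e t ^ (1 / 2 : ℝ)) p μ
      ≤ ENNReal.ofReal (s ^ (1 / 2 - p⁻¹.toReal) * i ^ p⁻¹.toReal) * A ^ (1 / 2 : ℝ) := by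
  rcases eq_or_ne p ∞ with rfl | hp'
  · simp only [eLpNorm_exponent_top, ENNReal.inv_top, ENNReal.toReal_zero, sub_zero,
      Real.rpow_zero, mul_one]
    refine essSup_le_of_ae_le _ (ae_of_all _ fun t => ?_)
    simp only [enorm_eq_self]
    rw [← ENNReal.ofReal_rpow_of_nonneg hs (by norm_num),
      ← ENNReal.mul_rpow_of_nonneg _ _ (by norm_num)]
    gcongr
    exact h1 t
  set P := p.toReal with hP
  have hP2 : 2 ≤ P := by
    have := (ENNReal.toReal_le_toReal (by simp) hp').2 hp
    simpa using this
  have hα : 0 ≤ P / 2 - 1 := by linarith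
  have hsplit (x : ℝ≥0∞) : x ^ (P / 2) = x ^ (P / 2 - 1) * x := by
    nth_rewrite 3 [← ENNReal.rpow_one x]
    rw [← ENNReal.rpow_add_of_nonneg _ _ hα zero_le_one]
    congr 1
    ring
  have hmain : ∫⁻ t, e t ^ (P / 2) ∂μ
      ≤ ENNReal.ofReal (s ^ (P / 2 - 1) * i) * A ^ (P / 2) := by
    calc _ ≤ ∫⁻ t, (ENNReal.ofReal s * A) ^ (P / 2 - 1) * e t ∂μ := by
          refine lintegral_mono fun t => ?_
          rw [hsplit]
          gcongr
          exact h1 t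
      _ ≤ (ENNReal.ofReal s * A) ^ (P / 2 - 1) * (ENNReal.ofReal i * A) := by
          rw [lintegral_const_mul _ he]
          gcongr
      _ = _ := by
          rw [ENNReal.mul_rpow_of_nonneg _ _ hα, ENNReal.ofReal_rpow_of_nonneg hs hα,
            hsplit, ENNReal.ofReal_mul (by positivity)]
          ring
  rw [eLpNorm_eq_lintegral_rpow_enorm_toReal (by positivity) hp', ← hP]
  simp only [enorm_eq_self, ← ENNReal.rpow_mul]
  have hPi : p⁻¹.toReal = 1 / P := by rw [ENNReal.toReal_inv, one_div]
  have hexp : (1 / 2 : ℝ) * P = P / 2 := by ring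
  rw [hexp]
  refine (ENNReal.rpow_le_rpow hmain (by positivity)).trans (le_of_eq ?_)
  rw [ENNReal.mul_rpow_of_nonneg _ _ (by positivity),
    ENNReal.ofReal_rpow_of_nonneg (by positivity) (by positivity), ← ENNReal.rpow_mul, hPi,
    Real.mul_rpow (by positivity) hi, ← Real.rpow_mul hs]
  have h3 : (P / 2 - 1) * (1 / P) = 1 / 2 - 1 / P := by field_simp
  have h4 : P / 2 * (1 / P) = 1 / 2 := by field_simp
  rw [h3, h4]

/-- The powers of the radius `R`, the frequency `ℓ` and the speed `w` in the estimate of one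
dyadic piece: up to the decay in `Rℓ` on both sides they are dictated by scaling. -/
theorem dyadic_constant_le {n : ℕ} (hn : 1 ≤ n) {C a b Q δ : ℝ} (hC : 0 < C)
    (hb : 0 < b) (hQ : Q = 1 / b) (hδ1 : δ ≤ n * b)
    (hδ2 : δ ≤ (n - 1) * (1 / 2 - b) - a) : ∃ D : ℝ, 0 < D ∧ ∀ {R ℓ w : ℝ}, 0 < R → 0 < ℓ →
    0 < w →
    ((2 * R) ^ (n - 1) * (2 * ℓ) ^ (Q / 2 - 1) * min 1 (2 * ℓ * R)) ^ b *
      ((C * (max R ℓ⁻¹ / max R ℓ⁻¹ ^ n)) ^ (1 / 2 - a) *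
        (C * (max R ℓ⁻¹ ^ 2 / max R ℓ⁻¹ ^ n / w)) ^ a)
      ≤ D * min (R * ℓ) (R * ℓ)⁻¹ ^ δ * (ℓ ^ (n / 2 - n * b - a) * w ^ (-a)) := by
  -- with all quantities written as exponentials, the inequality is linear in the exponents
  obtain ⟨c, rfl⟩ : ∃ c, Real.exp c = C := ⟨_, Real.exp_log hC⟩
  set L := Real.log 2
  have hL0 : 0 ≤ L := Real.log_nonneg (by norm_num)
  have hL : (2 : ℝ) = Real.exp L := (Real.exp_log (by norm_num)).symm
  obtain ⟨k, rfl⟩ : ∃ k, n = k + 1 := ⟨n - 1, (Nat.succ_pred (by omega)).symm⟩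
  refine ⟨Real.exp (k * b * L + (1 / 2 - b) * L + b * L + c / 2), by positivity,
    fun {R ℓ w} hR hℓ hw => ?_⟩
  obtain ⟨x, rfl⟩ : ∃ x, Real.exp x = R := ⟨_, Real.exp_log hR⟩
  obtain ⟨y, rfl⟩ : ∃ x, Real.exp x = ℓ := ⟨_, Real.exp_log hℓ⟩
  obtain ⟨z, rfl⟩ : ∃ x, Real.exp x = w := ⟨_, Real.exp_log hw⟩
  have hQb : (Q / 2 - 1) * b = 1 / 2 - b := by rw [hQ]; field_simp
  have hlhs (ρ m : ℝ) (hm : 0 ≤ m) :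
      ((2 * Real.exp x) ^ (k + 1 - 1) * (2 * Real.exp y) ^ (Q / 2 - 1) * m) ^ b *
      ((Real.exp c * (Real.exp ρ / Real.exp ρ ^ (k + 1))) ^ (1 / 2 - a) *
        (Real.exp c * (Real.exp ρ ^ 2 / Real.exp ρ ^ (k + 1) / Real.exp z)) ^ a)
      = Real.exp (k * b * (L + x) + (1 / 2 - b) * (L + y) + (c - k * ρ) * (1 / 2 - a)
        + (c + ρ - k * ρ - z) * a) * m ^ b := by
    rw [Nat.add_sub_cancel, Real.mul_rpow (by positivity) hm, mul_right_comm]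
    congr 1
    nth_rewrite 1 2 [hL]
    simp only [← Real.exp_nat_mul, ← Real.exp_add, ← Real.exp_sub, ← Real.exp_mul]
    congr 1
    push_cast
    linear_combination (L + y) * hQb
  have hR (m : ℝ) : m ^ δ * (Real.exp y ^ (((k + 1 : ℕ) : ℝ) / 2 - (k + 1 : ℕ) * b - a)
      * Real.exp z ^ (-a)) = m ^ δ *
      Real.exp (y * ((k + 1) / 2 - (k + 1) * b - a) - z * a) := by
    rw [← Real.exp_mul, ← Real.exp_mul, ← Real.exp_add]
    push_cast
    ring_nf
  rw [mul_assoc (Real.exp _) (min _ _ ^ δ), hR]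
  push_cast at hδ1 hδ2
  rw [← Real.exp_add, ← Real.exp_neg, ← Real.exp_neg]
  -- the first case is that of a radius below the wave length
  rcases le_total x (-y) with h | h
  · have h1 : Real.exp (x + y) ≤ Real.exp (-(x + y)) := Real.exp_le_exp.2 (by linarith)
    rw [max_eq_right (Real.exp_le_exp.2 h), min_eq_left h1, hlhs _ _ (by positivity)]
    have h2 : min 1 (2 * Real.exp y * Real.exp x) ^ b ≤ Real.exp ((L + y + x) * b) := by
      rw [Real.exp_mul]
      gcongr
      refine (min_le_right _ _).trans (le_of_eq ?_)
      rw [Real.exp_add, Real.exp_add, ← hL]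
    refine (mul_le_mul_of_nonneg_left h2 (by positivity)).trans ?_
    rw [← Real.exp_mul, ← Real.exp_add, ← Real.exp_add, ← Real.exp_add]
    refine Real.exp_le_exp.2 ?_
    nlinarith [mul_nonneg (sub_nonneg.2 hδ1) (by linarith : 0 ≤ -(x + y))]
  · have h1 : Real.exp (-(x + y)) ≤ Real.exp (x + y) := Real.exp_le_exp.2 (by linarith)
    rw [max_eq_left (Real.exp_le_exp.2 h), min_eq_right h1, hlhs _ _ (by positivity)]
    have h2 : min 1 (2 * Real.exp y * Real.exp x) ^ b ≤ 1 := by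
      refine Real.rpow_le_one (by positivity) (min_le_left _ _) hb.le
    refine (mul_le_mul_of_nonneg_left h2 (by positivity)).trans ?_
    rw [mul_one, ← Real.exp_mul, ← Real.exp_add, ← Real.exp_add]
    refine Real.exp_le_exp.2 ?_
    nlinarith [mul_nonneg (sub_nonneg.2 hδ2) (by linarith : 0 ≤ x + y), mul_nonneg hb.le hL0]

end

/-! ### Summation over dyadic radii and frequencies -/

section

theorem eLpNorm_const_mul_le {α : Type*} [MeasurableSpace α] {μ : Measure α} {c : ℝ≥0∞}
    (hc : c ≠ ∞) {p : ℝ≥0∞} (hp : p ≠ 0) (f : α → ℝ≥0∞) :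
    eLpNorm (fun x => c * f x) p μ ≤ c * eLpNorm f p μ := by
  rcases eq_or_ne p ∞ with rfl | hp'
  · simp only [eLpNorm_exponent_top]
    refine essSup_le_of_ae_le _ ?_
    filter_upwards [ae_le_eLpNormEssSup (f := f) (μ := μ)] with x hx
    simp only [enorm_eq_self] at hx ⊢
    exact mul_le_mul_right hx c
  · have hP : 0 < p.toReal := ENNReal.toReal_pos hp hp'
    rw [eLpNorm_eq_lintegral_rpow_enorm_toReal hp hp', eLpNorm_eq_lintegral_rpow_enorm_toReal hp hp']
    simp only [enorm_eq_self, ENNReal.mul_rpow_of_nonneg _ _ hP.le]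
    rw [lintegral_const_mul' _ _ (ENNReal.rpow_ne_top_of_nonneg hP.le hc),
      ENNReal.mul_rpow_of_nonneg _ _ (by positivity), ← ENNReal.rpow_mul, mul_one_div_cancel hP.ne',
      ENNReal.rpow_one]

/-- The spherical means of one dyadic piece of frequency `ℓ` on one dyadic shell of radius `R`:
the bound decays like a power of `min (Rℓ) (Rℓ)⁻¹`. -/
theorem exists_dyadic_bound (n : ℕ) [NeZero n] (H : Type*) [NormedAddCommGroup H]
    [InnerProductSpace ℂ H] [CompleteSpace H] {p q : ℝ≥0∞} (hp : 2 ≤ p) (hq : 2 < q) (hq' : q < ∞)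
    {δ : ℝ} (hδ1 : δ ≤ n * q⁻¹.toReal)
    (hδ2 : δ ≤ (n - 1) * (1 / 2 - q⁻¹.toReal) - p⁻¹.toReal) : ∃ D : ℝ, 0 < D ∧
    ∀ {φ : Space n → ℝ} {ℓ w : ℝ}, IsDispersive φ ℓ w → ∀ {g : Space n → H},
      MemLp g 2 (volume.restrict (shell n ℓ)) → ∀ {R : ℝ}, 0 < R → ∃ b : ℝ → ℝ≥0∞,
      Measurable b ∧
      (∀ t, eLpNorm (fun r : Ioi (0 : ℝ) => sphereMass (wave φ (shell n ℓ) g t) r.1 ^ (1 / 2 : ℝ)) q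
        ((Measure.volumeIoiPow (n - 1)).restrict (radii R)) ≤ b t) ∧
      eLpNorm b p volume ≤ ENNReal.ofReal (D * min (R * ℓ) (R * ℓ)⁻¹ ^ δ *
        (ℓ ^ (n / 2 - n * q⁻¹.toReal - p⁻¹.toReal) * w ^ (-p⁻¹.toReal))) *
          (∫⁻ ξ in shell n ℓ, ‖g ξ‖ₑ ^ 2) ^ (1 / 2 : ℝ) := by
  obtain ⟨C, hC, hen⟩ := exists_energy n H
  have hq0 : 0 < q⁻¹.toReal :=
    ENNReal.toReal_pos (ENNReal.inv_ne_zero.2 hq'.ne) (ENNReal.inv_ne_top.2 (by positivity))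
  obtain ⟨D, hD, hconst⟩ := dyadic_constant_le (n := n) (a := p⁻¹.toReal) (b := q⁻¹.toReal)
    (Q := q.toReal) (NeZero.one_le) hC hq0 (by rw [ENNReal.toReal_inv, one_div, inv_inv]) hδ1 hδ2
  refine ⟨D, hD, fun {φ ℓ w} hφ {g} hg R hR => ?_⟩
  obtain ⟨e, hem, he1, he2, he3, he4⟩ := hen hφ hg hR
  have hℓ := hφ.pos
  have hw := hφ.speed_pos
  refine ⟨fun t => ENNReal.ofReal (((2 * R) ^ (n - 1) * (2 * ℓ) ^ (q.toReal / 2 - 1) *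
    min 1 (2 * ℓ * R)) ^ q⁻¹.toReal) * e t ^ (1 / 2 : ℝ), by fun_prop, fun t =>
    eLpNorm_radii_le hq hq' hR hℓ (n - 1) (measurable_sphereMass_wave hφ.measurable hℓ hg t)
      (he1 t) (he2 t), ?_⟩
  have h1 := eLpNorm_rpow_half_le hp hem (by positivity) (by positivity) he4 he3
  refine (eLpNorm_const_mul_le ENNReal.ofReal_ne_top (by positivity) _).trans ?_
  refine (mul_le_mul_right h1 _).trans ?_
  rw [← mul_assoc, ← ENNReal.ofReal_mul (by positivity)]
  exact mul_le_mul_left (ENNReal.ofReal_le_ofReal (hconst hR hℓ hw)) _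

/-- Minkowski's inequality for series. -/
theorem eLpNorm_tsum_le {α ι : Type*} [Countable ι] [MeasurableSpace α] {μ : Measure α}
    {f : ι → α → ℝ≥0∞} (hf : ∀ i, AEMeasurable (f i) μ) {p : ℝ≥0∞} (hp : 1 ≤ p) :
    eLpNorm (fun x => ∑' i, f i x) p μ ≤ ∑' i, eLpNorm (f i) p μ := by
  rcases eq_or_ne p ∞ with rfl | hp'
  · simp only [eLpNorm_exponent_top]
    refine essSup_le_of_ae_le _ ?_
    filter_upwards [ae_all_iff.2 fun i => ae_le_eLpNormEssSup (f := f i) (μ := μ)] with x hx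
    exact ENNReal.tsum_le_tsum hx
  have hP : 0 < p.toReal := ENNReal.toReal_pos (by positivity) hp'
  have hsum (s : Finset ι) : eLpNorm (fun x => ∑ i ∈ s, f i x) p μ ≤ ∑' i, eLpNorm (f i) p μ := by
    refine le_trans ?_ (ENNReal.sum_le_tsum s)
    have := eLpNorm_sum_le (s := s) (f := f) (fun i _ => (hf i).aestronglyMeasurable) hp
    refine le_trans (le_of_eq ?_) this
    congr 1
    ext x
    simp
  rw [eLpNorm_eq_lintegral_rpow_enorm_toReal (by positivity) hp']
  have hpow (x : α) : ‖∑' i, f i x‖ₑ ^ p.toReal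
      = ⨆ s : Finset ι, (∑ i ∈ s, f i x) ^ p.toReal := by
    rw [enorm_eq_self, ENNReal.tsum_eq_iSup_sum]
    exact (ENNReal.orderIsoRpow p.toReal hP).map_iSup _
  simp_rw [hpow]
  rw [lintegral_iSup_directed (fun s => (Finset.aemeasurable_fun_sum s fun i _ => hf i).pow_const _)]
  · rw [one_div, ENNReal.rpow_inv_le_iff hP]
    refine iSup_le fun s => ?_
    have h := hsum s
    rw [eLpNorm_eq_lintegral_rpow_enorm_toReal (by positivity) hp', one_div,
      ENNReal.rpow_inv_le_iff hP] at h
    simpa using h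
  · intro s t
    classical
    refine ⟨s ∪ t, fun x => ?_, fun x => ?_⟩ <;>
    · refine ENNReal.rpow_le_rpow (Finset.sum_le_sum_of_subset ?_) hP.le
      first | exact Finset.subset_union_left | exact Finset.subset_union_right

/-- The embedding `ℓ¹ ⊆ ℓʳ`. -/
theorem tsum_rpow_le_rpow_tsum {ι : Type*} (c : ι → ℝ≥0∞) {r : ℝ} (hr : 1 ≤ r) :
    ∑' i, c i ^ r ≤ (∑' i, c i) ^ r := by
  have hsplit (x : ℝ≥0∞) : x ^ r = x ^ (r - 1) * x := by
    nth_rewrite 3 [← ENNReal.rpow_one x]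
    rw [← ENNReal.rpow_add_of_nonneg _ _ (by linarith) zero_le_one]
    congr 1
    ring
  calc ∑' i, c i ^ r ≤ ∑' i, (∑' j, c j) ^ (r - 1) * c i := by
        refine ENNReal.tsum_le_tsum fun i => ?_
        rw [hsplit]
        gcongr
        exact ENNReal.le_tsum i
    _ = _ := by rw [ENNReal.tsum_mul_left, hsplit]

theorem iUnion_radii : ⋃ k : ℤ, radii ((2 : ℝ) ^ k) = univ := by
  refine eq_univ_of_forall fun r => ?_
  obtain ⟨k, hk⟩ := exists_mem_Ico_zpow (x := r.1) (y := (2 : ℝ)) r.2 (by norm_num)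
  refine mem_iUnion.2 ⟨k, hk.1, ?_⟩
  have := hk.2
  rwa [zpow_add₀ (by norm_num), zpow_one, mul_comm] at this

/-- The `L^q` norm over all radii is an `ℓ^q` sum over dyadic shells, hence at most an `ℓ²` sum. -/
theorem eLpNorm_le_tsum_radii {ν : Measure (Ioi (0 : ℝ))} {q : ℝ≥0∞} (hq : 2 ≤ q) (hq' : q < ∞)
    (N : Ioi (0 : ℝ) → ℝ≥0∞) :
    eLpNorm N q ν
      ≤ (∑' k : ℤ, eLpNorm N q (ν.restrict (radii ((2 : ℝ) ^ k))) ^ 2) ^ (1 / 2 : ℝ) := by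
  have hQ : 2 ≤ q.toReal := by
    have := (ENNReal.toReal_le_toReal (by simp) hq'.ne).2 hq
    simpa using this
  have h0 : q ≠ 0 := by positivity
  have h1 (k : ℤ) : ∫⁻ r in radii ((2 : ℝ) ^ k), ‖N r‖ₑ ^ q.toReal ∂ν
      = (eLpNorm N q (ν.restrict (radii ((2 : ℝ) ^ k))) ^ 2) ^ (q.toReal / 2) := by
    rw [eLpNorm_eq_lintegral_rpow_enorm_toReal h0 hq'.ne, ← ENNReal.rpow_natCast,
      ← ENNReal.rpow_mul, ← ENNReal.rpow_mul]
    have : 1 / q.toReal * (((2 : ℕ) : ℝ) * (q.toReal / 2)) = 1 := by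
      push_cast
      field_simp
    rw [this, ENNReal.rpow_one]
  nth_rewrite 1 [eLpNorm_eq_lintegral_rpow_enorm_toReal h0 hq'.ne]
  rw [one_div, ENNReal.rpow_inv_le_iff (by linarith), ← ENNReal.rpow_mul, ← setLIntegral_univ,
    ← iUnion_radii]
  refine (lintegral_iUnion_le _ _).trans ?_
  simp_rw [h1]
  have : 1 / 2 * q.toReal = q.toReal / 2 := by ring
  rw [this]
  exact tsum_rpow_le_rpow_tsum _ (by linarith)

/-- Minkowski's inequality in `L^{p/2}`, which moves an `ℓ²` sum out of an `L^p` norm. -/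
theorem eLpNorm_rpow_half_tsum_le {α ι : Type*} [Countable ι] [MeasurableSpace α] {μ : Measure α}
    {B : ι → α → ℝ≥0∞} (hB : ∀ i, AEMeasurable (B i) μ) {p : ℝ≥0∞} (hp : 2 ≤ p) :
    eLpNorm (fun x => (∑' i, B i x ^ 2) ^ (1 / 2 : ℝ)) p μ
      ≤ (∑' i, eLpNorm (B i) p μ ^ 2) ^ (1 / 2 : ℝ) := by
  have h1 := eLpNorm_enorm_rpow (p := p) (μ := μ) (fun x => ∑' i, B i x ^ 2)
    (show (0 : ℝ) < 1 / 2 by norm_num)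
  simp only [enorm_eq_self] at h1
  have hhalf : ENNReal.ofReal (1 / 2) = 2⁻¹ := by
    rw [one_div, ENNReal.ofReal_inv_of_pos (by norm_num), ENNReal.ofReal_ofNat]
  rw [h1, hhalf]
  have hp2 : 1 ≤ p * 2⁻¹ := by
    rw [← ENNReal.mul_inv_cancel (a := 2) (by simp) (by simp)]
    gcongr
  refine ENNReal.rpow_le_rpow ((eLpNorm_tsum_le (fun i => (hB i).pow_const 2) hp2).trans
    (ENNReal.tsum_le_tsum fun i => le_of_eq ?_)) (by norm_num)
  have h2 := eLpNorm_enorm_rpow (p := p * 2⁻¹) (μ := μ) (B i) (show (0 : ℝ) < 2 by norm_num)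
  simp only [enorm_eq_self, ENNReal.rpow_ofNat, ENNReal.ofReal_ofNat] at h2
  rw [h2, mul_assoc, ENNReal.inv_mul_cancel (by simp) (by simp), mul_one]

/-- The Cauchy–Schwarz inequality with a weight `κ`. -/
theorem tsum_mul_sq_le {ι : Type*} [Countable ι] (κ a : ι → ℝ≥0∞) :
    (∑' i, κ i * a i) ^ 2 ≤ (∑' i, κ i) * ∑' i, κ i * a i ^ 2 := by
  let _ : MeasurableSpace ι := ⊤
  have h := lintegral_mul_sq_le (Measure.count : Measure ι) (f := fun i => κ i ^ (1 / 2 : ℝ))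
    (g := fun i => κ i ^ (1 / 2 : ℝ) * a i) (measurable_of_countable _).aemeasurable
    (measurable_of_countable _).aemeasurable
  have h2 (i : ι) : κ i ^ (1 / 2 : ℝ) * κ i ^ (1 / 2 : ℝ) = κ i := by
    rw [← ENNReal.rpow_add_of_nonneg _ _ (by norm_num) (by norm_num)]
    norm_num
  have h3 (i : ι) : (κ i ^ (1 / 2 : ℝ)) ^ 2 = κ i := by rw [sq, h2]
  simp only [lintegral_count, mul_pow, ← mul_assoc, h3, h2] at h
  exact h

/-- Young's inequality `‖κ * a‖₂ ≤ ‖κ‖₁ ‖a‖₂` on `ℤ`. -/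
theorem tsum_tsum_sq_le (κ a : ℤ → ℝ≥0∞) :
    ∑' k, (∑' j, κ (j + k) * a j) ^ 2 ≤ (∑' k, κ k) ^ 2 * ∑' j, a j ^ 2 := by
  have h1 (k : ℤ) : ∑' j, κ (j + k) = ∑' j, κ j := (Equiv.addRight k).tsum_eq κ
  have h2 (j : ℤ) : ∑' k, κ (j + k) = ∑' k, κ k := (Equiv.addLeft j).tsum_eq κ
  calc _ ≤ ∑' k, (∑' j, κ j) * ∑' j, κ (j + k) * a j ^ 2 := by
        refine ENNReal.tsum_le_tsum fun k => ?_
        rw [← h1 k]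
        exact tsum_mul_sq_le _ _
    _ = (∑' j, κ j) * ∑' j, ∑' k, κ (j + k) * a j ^ 2 := by
        rw [ENNReal.tsum_mul_left, ENNReal.tsum_comm]
    _ = _ := by
        simp_rw [ENNReal.tsum_mul_right, h2, ENNReal.tsum_mul_left]
        ring

theorem tsum_min_rpow_lt_top {δ : ℝ} (hδ : 0 < δ) :
    ∑' k : ℤ, ENNReal.ofReal (min ((2 : ℝ) ^ k) ((2 : ℝ) ^ k)⁻¹ ^ δ) < ∞ := by
  have hr : ((1 / 2 : ℝ) ^ δ) < 1 := Real.rpow_lt_one (by norm_num) (by norm_num) hδ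
  have hg := summable_geometric_of_lt_one (by positivity) hr
  have hnat (k : ℕ) : ((1 / 2 : ℝ) ^ k) ^ δ = ((1 / 2 : ℝ) ^ δ) ^ k := by
    rw [← Real.rpow_natCast, ← Real.rpow_natCast, ← Real.rpow_mul (by norm_num),
      ← Real.rpow_mul (by norm_num), mul_comm]
  have hle (k : ℕ) : ((2 : ℝ) ^ k)⁻¹ ≤ 2 ^ k := by
    have : (1 : ℝ) ≤ 2 ^ k := one_le_pow₀ (by norm_num)
    exact (inv_le_one_of_one_le₀ this).trans this
  have hs : Summable fun k : ℤ => min ((2 : ℝ) ^ k) ((2 : ℝ) ^ k)⁻¹ ^ δ := by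
    refine Summable.of_nat_of_neg ?_ ?_
    · refine hg.congr fun k => ?_
      rw [zpow_natCast, min_eq_right (hle k), ← hnat, one_div, inv_pow]
    · refine hg.congr fun k => ?_
      rw [zpow_neg, zpow_natCast, inv_inv, min_eq_left (hle k), ← hnat, one_div, inv_pow]
  exact hs.tsum_ofReal_lt_top

/-- A property that holds almost everywhere holds at almost every point of almost every sphere. -/
theorem ae_polar {n : ℕ} [NeZero n] {P : Space n → Prop} (h : ∀ᵐ x, P x) :
    ∀ᵐ r ∂(Measure.volumeIoiPow (n - 1)), ∀ᵐ ω ∂(volume : Measure (Space n)).toSphere,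
      P (r.1 • ω.1) := by
  -- the exceptional set is enlarged to a measurable one, for Fubini's theorem
  set Z := toMeasurable volume {x | ¬ P x}
  have hZ : volume Z = 0 := by rw [measure_toMeasurable]; exact h
  have hZm : MeasurableSet Z := measurableSet_toMeasurable _ _
  have h1 := lintegral_polar_prod (Z.indicator (1 : Space n → ℝ≥0∞))
  rw [lintegral_indicator_one hZm, hZ] at h1
  have hm : Measurable fun z : Metric.sphere (0 : Space n) 1 × Ioi (0 : ℝ) =>
    z.2.1 • z.1.1 := by fun_prop
  have hm' : Measurable fun z : Metric.sphere (0 : Space n) 1 × Ioi (0 : ℝ) =>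
    Z.indicator (1 : Space n → ℝ≥0∞) (z.2.1 • z.1.1) := (measurable_one.indicator hZm).comp hm
  have h4 := (lintegral_eq_zero_iff hm').1 h1.symm
  have h2 : ∀ᵐ z ∂((volume : Measure (Space n)).toSphere.prod (Measure.volumeIoiPow (n - 1))),
      z.2.1 • z.1.1 ∉ Z := by
    filter_upwards [h4] with z hz hzZ
    simp [hzZ] at hz
  have h3 := Measure.ae_ae_of_ae_prod h2
  rw [Measure.ae_ae_comm (p := fun (ω : Metric.sphere (0 : Space n) 1) (r : Ioi (0 : ℝ)) =>
    r.1 • ω.1 ∉ Z) (hm hZm.compl)] at h3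
  refine h3.mono fun r hr => hr.mono fun ω hω => ?_
  by_contra hP
  exact hω (subset_toMeasurable _ _ hP)

theorem polarNorm_le {n N : ℕ} [NeZero n] {ι : Type*} [Countable ι] {q : ℝ≥0∞}
    {v : Space n → Spinor N} {u : ι → Space n → Spinor N} (hu : ∀ i, Continuous (u i))
    (hvu : ∀ᵐ x, ‖v x‖ₑ ≤ ∑' i, ‖u i x‖ₑ) :
    polarNorm q v ≤ eLpNorm (fun r : Ioi (0 : ℝ) => ∑' i, sphereMass (u i) r.1 ^ (1 / 2 : ℝ)) q
      (Measure.volumeIoiPow (n - 1)) := by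
  refine eLpNorm_mono_enorm_ae ((ae_polar hvu).mono fun r hr => ?_)
  rw [enorm_eq_self, enorm_eq_self]
  have hm (i : ι) : Measurable fun ω : Metric.sphere (0 : Space n) 1 => ‖u i (r.1 • ω.1)‖ₑ :=
    ((hu i).enorm.measurable).comp (by fun_prop)
  calc _ ≤ eLpNorm (fun ω : Metric.sphere (0 : Space n) 1 => ∑' i, ‖u i (r.1 • ω.1)‖ₑ) 2
        (volume : Measure (Space n)).toSphere :=
        eLpNorm_mono_enorm_ae (hr.mono fun ω hω => by rwa [enorm_eq_self])
    _ ≤ _ := eLpNorm_tsum_le (fun i => (hm i).aemeasurable) (by norm_num)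
    _ = _ := by
        refine tsum_congr fun i => ?_
        rw [eLpNorm_eq_lintegral_rpow_enorm_toReal (by norm_num) (by norm_num), sphereMass]
        simp

/-- The mixed norm of a function that is dominated by a sum of pieces, in terms of majorants of the
pieces on dyadic shells. The majorants are measurable in time, which the norms of `F` need not be. -/
theorem mixedNorm_le {n N : ℕ} [NeZero n] {ι : Type*} [Countable ι] {p q : ℝ≥0∞} (hp : 2 ≤ p)
    (hq : 2 ≤ q) (hq' : q < ∞) {F : ℝ → Space n → Spinor N} {u : ι → ℝ → Space n → Spinor N}
    (hu : ∀ i t, Continuous (u i t)) (hFu : ∀ t, ∀ᵐ x, ‖F t x‖ₑ ≤ ∑' i, ‖u i t x‖ₑ)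
    {b : ι → ℤ → ℝ → ℝ≥0∞} (hb : ∀ i k, Measurable (b i k))
    (hub : ∀ i k t, eLpNorm (fun r : Ioi (0 : ℝ) => sphereMass (u i t) r.1 ^ (1 / 2 : ℝ)) q
      ((Measure.volumeIoiPow (n - 1)).restrict (radii ((2 : ℝ) ^ k))) ≤ b i k t) :
    mixedNorm p q F ≤ (∑' k : ℤ, (∑' i, eLpNorm (b i k) p volume) ^ 2) ^ (1 / 2 : ℝ) := by
  have h1q : 1 ≤ q := le_trans (by norm_num) hq
  have h1p : 1 ≤ p := le_trans (by norm_num) hp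
  have hm (i : ι) (t : ℝ) : Measurable fun r : Ioi (0 : ℝ) =>
      sphereMass (u i t) r.1 ^ (1 / 2 : ℝ) := by
    have h : Measurable fun z : ℝ × Metric.sphere (0 : Space n) 1 =>
        ‖u i t (z.1 • z.2.1)‖ₑ ^ 2 :=
      ((hu i t).enorm.measurable.comp (by fun_prop)).pow_const 2
    have h' : Measurable (sphereMass (u i t)) := h.lintegral_prod_right'
    exact (h'.comp measurable_subtype_coe).pow_const _
  have ht (t : ℝ) : polarNorm q (F t) ≤ (∑' k : ℤ, (∑' i, b i k t) ^ 2) ^ (1 / 2 : ℝ) := by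
    refine (polarNorm_le (fun i => hu i t) (hFu t)).trans
      ((eLpNorm_le_tsum_radii hq hq' _).trans ?_)
    refine ENNReal.rpow_le_rpow (ENNReal.tsum_le_tsum fun k => pow_le_pow_left₀ zero_le ?_ 2)
      (by norm_num)
    exact (eLpNorm_tsum_le (fun i => (hm i t).aemeasurable) h1q).trans
      (ENNReal.tsum_le_tsum fun i => hub i k t)
  calc mixedNorm p q F ≤ eLpNorm (fun t => (∑' k : ℤ, (∑' i, b i k t) ^ 2) ^ (1 / 2 : ℝ)) p volume :=
        eLpNorm_mono_enorm fun t => by simpa only [enorm_eq_self] using ht t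
    _ ≤ _ := eLpNorm_rpow_half_tsum_le (B := fun k t => ∑' i, b i k t)
        (fun k => (Measurable.tsum fun i => hb i k).aemeasurable) hp
    _ ≤ _ := ENNReal.rpow_le_rpow (ENNReal.tsum_le_tsum fun k => pow_le_pow_left₀ zero_le
        (eLpNorm_tsum_le (fun i => (hb i k).aemeasurable) h1p) 2) (by norm_num)

end

/-! ### Waves and the Dirac propagator -/

section

variable {n : ℕ}

section

variable {H : Type*} [NormedAddCommGroup H] [InnerProductSpace ℂ H] [CompleteSpace H]

/-- For an integrable `h` in `L²`, the inverse Fourier transform on `L²` is given by the usual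
integral. -/
theorem fourierInv_toLp_ae {h : Space n → H} (h1 : Integrable h) (h2 : MemLp h 2 volume) :
    (𝓕⁻ h2.toLp : Lp H 2 (volume : Measure (Space n))) =ᵐ[volume] 𝓕⁻ h := by
  have hcont : Continuous (𝓕⁻ h) := by
    have := VectorFourier.fourierIntegral_continuous Real.continuous_fourierChar
      (L := -innerₗ (Space n)) (μ := volume) (by simpa using! continuous_inner.neg) h1
    refine this.congr fun x => ?_
    simp [VectorFourier.fourierIntegral, Real.fourierInv_eq, real_inner_comm]
  refine ae_eq_of_integral_contDiff_smul_eq ((Lp.memLp _).locallyIntegrable (by norm_num))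
    hcont.locallyIntegrable fun g hg hgc => ?_
  have hg₁ : HasCompactSupport (Complex.ofRealCLM ∘ g) := hgc.comp_left rfl
  have hg₂ : ContDiff ℝ ((⊤ : ℕ∞) : WithTop ℕ∞) (Complex.ofRealCLM ∘ g) := by fun_prop
  set G : 𝓢(Space n, ℂ) := hg₁.toSchwartzMap hg₂
  have hG (x : Space n) : g x • (𝓕⁻ h) x = G x • (𝓕⁻ h) x := by simp [G]
  have e1 := congrArg (fun T => T G) (Lp.fourierInv_toTemperedDistribution_eq h2.toLp)
  simp only [TemperedDistribution.fourierInv_apply, Lp.toTemperedDistribution_apply] at e1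
  calc _ = ∫ x, G x • (𝓕⁻ h2.toLp : Lp H 2 (volume : Measure (Space n))) x := by simp [G]
    _ = ∫ x, (𝓕⁻ G) x • h x := by
        rw [← e1]
        refine integral_congr_ae ?_
        filter_upwards [h2.coeFn_toLp] with x hx
        rw [hx]
    _ = ∫ x, G x • (𝓕⁻ h) x := by
        have := VectorFourier.integral_fourierIntegral_smul_eq_flip (μ := volume) (ν := volume)
          (L := -innerₗ (Space n)) Real.continuous_fourierChar (by simpa using! continuous_inner.neg)
          G.integrable h1
        simpa [VectorFourier.fourierIntegral, Real.fourierInv_eq, real_inner_comm,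
          SchwartzMap.fourierInv_coe] using! this
    _ = _ := by simp_rw [hG]

theorem pairwise_disjoint_shell :
    Pairwise (Function.onFun Disjoint fun j : ℤ => shell n ((2 : ℝ) ^ j)) := by
  have key (i j : ℤ) (hij : i < j) : Disjoint (shell n ((2 : ℝ) ^ i)) (shell n ((2 : ℝ) ^ j)) := by
    refine disjoint_left.2 fun ξ hi hj => ?_
    have h1 : (2 : ℝ) ^ (i + 1) ≤ 2 ^ j := zpow_le_zpow_right₀ (by norm_num) (by omega)
    rw [zpow_add₀ (by norm_num), zpow_one] at h1
    have h2 := hi.2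
    have h3 := hj.1
    linarith
  intro i j hij
  rcases hij.lt_or_gt with h | h
  · exact key i j h
  · exact (key j i h).symm

theorem exists_mem_shell {ξ : Space n} (hξ : ξ ≠ 0) : ∃ j : ℤ, ξ ∈ shell n ((2 : ℝ) ^ j) := by
  obtain ⟨j, hj⟩ := exists_mem_Ico_zpow (x := ‖ξ‖) (y := (2 : ℝ)) (norm_pos_iff.2 hξ) (by norm_num)
  refine ⟨j, hj.1, ?_⟩
  have := hj.2
  rwa [zpow_add₀ (by norm_num), zpow_one, mul_comm] at this

/-- The inverse Fourier transform of an `L²` function is dominated by the sum of its dyadic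
pieces, because the partial sums converge almost everywhere along a subsequence. -/
theorem enorm_fourierInv_le_tsum [NeZero n] (G : Lp H 2 (volume : Measure (Space n))) :
    ∀ᵐ x, ‖(𝓕⁻ G : Lp H 2 (volume : Measure (Space n))) x‖ₑ ≤ ∑' j : ℤ,
      ‖∫ ξ in shell n ((2 : ℝ) ^ j),
        Complex.exp ((2 * Real.pi * inner ℝ ξ x : ℝ) * Complex.I) • G ξ‖ₑ := by
  set I : ℕ → Finset ℤ := fun J => Finset.Ioo (-(J : ℤ)) J
  set A : ℕ → Set (Space n) := fun J => ⋃ j ∈ I J, shell n ((2 : ℝ) ^ j)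
  have hA (J : ℕ) : MeasurableSet (A J) :=
    Finset.measurableSet_biUnion _ fun j _ => measurableSet_shell _
  have h2 (J : ℕ) : MemLp ((A J).indicator G) 2 volume := (Lp.memLp G).indicator (hA J)
  have hint (J : ℕ) : IntegrableOn G (A J) :=
    integrableOn_finset_iUnion.2 fun j _ =>
      integrableOn_shell (by positivity) ((Lp.memLp G).restrict _)
  have hlim : Filter.Tendsto (fun J => (h2 J).toLp) Filter.atTop (nhds G) := by
    suffices Filter.Tendsto (fun J => (h2 J).toLp) Filter.atTop (nhds (Lp.memLp G).toLp) by
      rwa [Lp.toLp_coeFn] at this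
    refine (Lp.tendsto_Lp_iff_tendsto_eLpNorm'' _ h2 _ (Lp.memLp G)).2 ?_
    -- the shells cover everything but the origin
    have hpt : ∀ᵐ ξ, Filter.Tendsto (fun J => ‖((A J).indicator G - G) ξ‖ₑ ^ (2 : ℝ))
        Filter.atTop (nhds 0) := by
      filter_upwards [compl_mem_ae_iff.2 (measure_singleton (0 : Space n))] with ξ hξ
      obtain ⟨j, hj⟩ := exists_mem_shell (n := n) (ξ := ξ) hξ
      refine tendsto_const_nhds.congr' ?_
      filter_upwards [Filter.eventually_gt_atTop j.natAbs] with J hJ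
      have : ξ ∈ A J := mem_biUnion (x := j) (by simp [I]; omega) hj
      simp [this]
    have hdom := tendsto_lintegral_of_dominated_convergence' (fun ξ => ‖G ξ‖ₑ ^ (2 : ℝ))
      (fun J => (((h2 J).1.sub (Lp.memLp G).1).enorm.pow_const (2 : ℝ)))
      (fun J => ae_of_all _ fun ξ => by
        by_cases h : ξ ∈ A J <;> simp [h])
      (by
        have := lintegral_rpow_enorm_lt_top_of_eLpNorm_lt_top (by norm_num) (by norm_num)
          (Lp.memLp G).2
        simpa using this.ne) hpt
    have h3 := hdom.ennrpow_const (1 / 2)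
    simp only [lintegral_zero, one_div, ENNReal.zero_rpow_of_pos (by norm_num : (0 : ℝ) < 2⁻¹)] at h3
    refine h3.congr fun J => ?_
    rw [eLpNorm_eq_lintegral_rpow_enorm_toReal (by norm_num) (by norm_num)]
    simp
  have hlim' : Filter.Tendsto (fun J => (𝓕⁻ (h2 J).toLp : Lp H 2 (volume : Measure (Space n))))
      Filter.atTop (nhds (𝓕⁻ G)) :=
    ((Lp.fourierTransformₗᵢ (Space n) H).symm.continuous.tendsto G).comp hlim
  obtain ⟨ns, hns, hae⟩ := (tendstoInMeasure_of_tendsto_Lp hlim').exists_seq_tendsto_ae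
  have hrep : ∀ᵐ x, ∀ J, (𝓕⁻ (h2 J).toLp : Lp H 2 (volume : Measure (Space n))) x
      = ∑ j ∈ I J, ∫ ξ in shell n ((2 : ℝ) ^ j),
        Complex.exp ((2 * Real.pi * inner ℝ ξ x : ℝ) * Complex.I) • G ξ := by
    refine ae_all_iff.2 fun J => ?_
    filter_upwards [fourierInv_toLp_ae ((integrable_indicator_iff (hA J)).2 (hint J)) (h2 J)]
      with x hx
    rw [hx, Real.fourierInv_eq']
    have e1 (ξ : Space n) : Complex.exp ((2 * Real.pi * inner ℝ ξ x : ℝ) * Complex.I) •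
        (A J).indicator G ξ = (A J).indicator (fun ξ =>
          Complex.exp ((2 * Real.pi * inner ℝ ξ x : ℝ) * Complex.I) • G ξ) ξ := by
      by_cases h : ξ ∈ A J <;> simp [h]
    simp_rw [e1]
    rw [integral_indicator (hA J)]
    refine integral_biUnion_finset _ (fun j _ => measurableSet_shell _)
      (fun i _ j _ hij => pairwise_disjoint_shell hij) fun j hj => ?_
    have hi : IntegrableOn G (shell n ((2 : ℝ) ^ j)) :=
      integrableOn_shell (by positivity) ((Lp.memLp G).restrict _)
    refine Integrable.mono hi ?_ (ae_of_all _ fun ξ => ?_)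
    · refine AEStronglyMeasurable.smul (Measurable.aestronglyMeasurable ?_) hi.1
      fun_prop
    · rw [norm_smul, Complex.norm_exp_ofReal_mul_I, one_mul]
  filter_upwards [hae, hrep] with x hx hxr
  refine le_of_tendsto hx.enorm (Filter.Eventually.of_forall fun k => ?_)
  rw [hxr]
  exact (enorm_sum_le _ _).trans (ENNReal.sum_le_tsum _)

end

namespace Matrices

variable {N : ℕ} {m : ℝ}

theorem energy_pos (hm : 0 < m) (ξ : Space n) : 0 < energy m ξ :=
  Real.sqrt_pos.2 (by positivity)

theorem le_energy (m : ℝ) (ξ : Space n) : m ≤ energy m ξ :=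
  Real.le_sqrt_of_sq_le (by nlinarith [sq_nonneg (2 * Real.pi * ‖ξ‖)])

/-- The sign of the energy on each of the two branches of the dispersion relation. -/
def branchSign (ε : Bool) : ℝ := if ε then 1 else -1

/-- The projection of the spinor space onto the eigenvectors of the symbol with positive or
negative eigenvalue. -/
def branchProj (𝔇 : Matrices n N) (m : ℝ) (ε : Bool) : Space n → Spinor N →L[ℂ] Spinor N :=
  𝔇.funSymbol m ((Ioi 0).indicator 1 ∘ fun E => branchSign ε * E)

theorem measurable_branchIndicator (ε : Bool) :
    Measurable ((Ioi (0 : ℝ)).indicator (1 : ℝ → ℂ) ∘ fun E => branchSign ε * E) :=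
  (measurable_one.indicator measurableSet_Ioi).comp (by fun_prop)

theorem norm_branchIndicator_le (ε : Bool) (E : ℝ) :
    ‖((Ioi (0 : ℝ)).indicator (1 : ℝ → ℂ) ∘ fun E => branchSign ε * E) E‖ ≤ 1 := by
  by_cases h : branchSign ε * E ∈ Ioi (0 : ℝ) <;> simp [h]

theorem norm_funSymbol_le (𝔇 : Matrices n N) (m : ℝ) {f : ℝ → ℂ} {C : ℝ} (hC : ∀ E, ‖f E‖ ≤ C)
    (ξ : Space n) : ‖𝔇.funSymbol m f ξ‖ ≤ C :=
  norm_cfc_le ((norm_nonneg _).trans (hC 0)) fun _ _ => hC _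

theorem norm_branchProj_apply_le (𝔇 : Matrices n N) (m : ℝ) (ε : Bool) (ξ : Space n)
    (v : Spinor N) : ‖𝔇.branchProj m ε ξ v‖ ≤ ‖v‖ :=
  ((𝔇.branchProj m ε ξ).le_of_opNorm_le
    (𝔇.norm_funSymbol_le m (norm_branchIndicator_le ε) ξ) v).trans_eq (one_mul _)

/-- The spectral decomposition of a function of the symbol. -/
theorem funSymbol_eq_branchProj (𝔇 : Matrices n N) (hm : 0 < m) (f : ℝ → ℂ) (ξ : Space n) :
    𝔇.funSymbol m f ξ = f (branchSign true * energy m ξ) • 𝔇.branchProj m true ξ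
      + f (branchSign false * energy m ξ) • 𝔇.branchProj m false ξ := by
  have h0 := energy_pos hm ξ
  have h1 : (energy m ξ : ℂ) ≠ 0 := by exact_mod_cast h0.ne'
  rw [branchProj, branchProj, funSymbol_eq, funSymbol_eq, funSymbol_eq]
  simp only [Function.comp, branchSign, indicator, mem_Ioi, if_true, one_mul, h0, Pi.one_apply,
    Left.neg_pos_iff, h0.not_gt, if_false, neg_mul, neg_neg, Bool.false_eq_true]
  module

theorem memLp_branchProj (𝔇 : Matrices n N) (m : ℝ) (ε : Bool) (v : L2 n N) :
    MemLp (fun ξ => 𝔇.branchProj m ε ξ (v ξ)) 2 volume :=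
  𝔇.memLp_funSymbol m (measurable_branchIndicator ε) ⟨1, norm_branchIndicator_le ε⟩ v

/-- The derivative of the dispersion relation `r ↦ √((2πr)² + m²)` at the radius `ℓ`. -/
def groupSpeed (m ℓ : ℝ) : ℝ := (2 * Real.pi) ^ 2 * ℓ / √((2 * Real.pi * ℓ) ^ 2 + m ^ 2)

/-- On `|ξ| ≥ ℓ`, the energy grows at least with the group speed at `ℓ`, as the group speed is
an increasing function of the frequency. -/
theorem isDispersive_energy (hm : 0 < m) {ℓ : ℝ} (hℓ : 0 < ℓ) (ε : Bool) :
    IsDispersive (fun ξ : Space n => branchSign ε * energy m ξ) ℓ (groupSpeed m ℓ) := by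
  have hE : 0 < √((2 * Real.pi * ℓ) ^ 2 + m ^ 2) := Real.sqrt_pos.2 (by positivity)
  refine ⟨(measurable_energy m).const_mul _, hℓ, by unfold groupSpeed; positivity,
    fun ξ hξ η hη => ?_⟩
  have hε : |branchSign ε| = 1 := by cases ε <;> simp [branchSign]
  rw [← mul_sub, abs_mul, hε, one_mul]
  have key (ζ : Space n) (hζ : ζ ∈ shell n ℓ) :
      groupSpeed m ℓ * energy m ζ ≤ (2 * Real.pi) ^ 2 * ‖ζ‖ := by
    rw [groupSpeed, div_mul_eq_mul_div, div_le_iff₀ hE, mul_assoc, mul_assoc]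
    refine mul_le_mul_of_nonneg_left ?_ (by positivity)
    refine abs_le_of_sq_le_sq' ?_ (by positivity) |>.2
    rw [mul_pow, mul_pow, energy_sq, Real.sq_sqrt (by positivity)]
    have : ℓ ^ 2 ≤ ‖ζ‖ ^ 2 := pow_le_pow_left₀ hℓ.le hζ.1 2
    nlinarith [mul_le_mul_of_nonneg_right this (sq_nonneg m)]
  have hs : 0 < energy m ξ + energy m η := add_pos (energy_pos hm ξ) (energy_pos hm η)
  have h1 : |energy m ξ - energy m η| * (energy m ξ + energy m η)
      = (2 * Real.pi) ^ 2 * (‖ξ‖ + ‖η‖) * |‖ξ‖ - ‖η‖| := by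
    rw [← abs_of_pos hs, ← abs_mul, ← abs_of_nonneg (by positivity :
      0 ≤ (2 * Real.pi) ^ 2 * (‖ξ‖ + ‖η‖)), ← abs_mul]
    congr 1
    linear_combination energy_sq m ξ - energy_sq m η
  refine le_of_mul_le_mul_right ?_ hs
  rw [h1]
  nlinarith [mul_le_mul_of_nonneg_right (add_le_add (key ξ hξ) (key η hη)) (abs_nonneg (‖ξ‖ - ‖η‖))]

/-- The solution is dominated by its dyadic pieces on the two branches of the dispersion relation. -/
theorem enorm_propagator_le_tsum [NeZero n] (𝔇 : Matrices n N) (hm : 0 < m) (f : L2 n N) (t : ℝ) :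
    ∀ᵐ x, ‖𝔇.propagator m t f x‖ₑ ≤ ∑' i : ℤ × Bool,
      ‖wave (fun ξ => branchSign i.2 * energy m ξ) (shell n ((2 : ℝ) ^ i.1))
        (fun ξ => 𝔇.branchProj m i.2 ξ ((𝓕 f : L2 n N) ξ)) t x‖ₑ := by
  unfold propagator funCalc
  refine (enorm_fourierInv_le_tsum _).mono fun x hx => hx.trans ?_
  rw [ENNReal.tsum_prod']
  refine ENNReal.tsum_le_tsum fun j => ?_
  rw [tsum_bool, add_comm]
  have hint (ε : Bool) : Integrable (fun ξ => Complex.exp ((t * (branchSign ε * energy m ξ) +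
      2 * Real.pi * inner ℝ ξ x : ℝ) * Complex.I) • 𝔇.branchProj m ε ξ ((𝓕 f : L2 n N) ξ))
      (volume.restrict (shell n ((2 : ℝ) ^ j))) := by
    have hi := integrableOn_shell (ℓ := (2 : ℝ) ^ j) (by positivity)
      ((𝔇.memLp_branchProj m ε (𝓕 f)).restrict _)
    have hE := measurable_energy (n := n) m
    have he : Measurable fun ξ : Space n => Complex.exp ((t * (branchSign ε * energy m ξ) +
      2 * Real.pi * inner ℝ ξ x : ℝ) * Complex.I) := by fun_prop
    refine Integrable.mono hi (he.aestronglyMeasurable.smul hi.1) (ae_of_all _ fun ξ => ?_)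
    rw [norm_smul, Complex.norm_exp_ofReal_mul_I, one_mul]
  refine le_trans (le_of_eq ?_) (enorm_add_le _ _)
  unfold wave
  rw [← integral_add (hint true) (hint false)]
  congr 1
  refine integral_congr_ae (ae_restrict_of_ae ?_)
  filter_upwards [MemLp.coeFn_toLp (𝔇.memLp_funSymbol m
    (f := fun E => Complex.exp (Complex.I * t * E)) (by fun_prop) ⟨1, fun E => by
      rw [mul_assoc, ← Complex.ofReal_mul, mul_comm, Complex.norm_exp_ofReal_mul_I]⟩ (𝓕 f))]
    with ξ hξ
  rw [hξ, funSymbol_eq_branchProj 𝔇 hm]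
  simp only [add_apply, _root_.smul_apply, smul_add, smul_smul, ← Complex.exp_add]
  push_cast
  congr 3 <;> ring_nf

end Matrices

end

/-! ### Low and high energies -/

section

variable {n N : ℕ}

/-- The dyadic description of the homogeneous Sobolev norm. -/
theorem exists_tsum_shell_le_sobolevNorm (s : ℝ) : ∃ K : ℝ, 0 < K ∧ ∀ f : L2 n N,
    ∑' j : ℤ, (ENNReal.ofReal (((2 : ℝ) ^ j) ^ s) *
      (∫⁻ ξ in shell n ((2 : ℝ) ^ j), ‖(𝓕 f : L2 n N) ξ‖ₑ ^ 2) ^ (1 / 2 : ℝ)) ^ 2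
      ≤ (ENNReal.ofReal K * sobolevNorm s f) ^ 2 := by
  have hπ := Real.pi_gt_three
  refine ⟨(4 * Real.pi) ^ |s|, by positivity, fun f => ?_⟩
  set K := (4 * Real.pi) ^ |s|
  have hsq (x : ℝ≥0∞) : (x ^ (1 / 2 : ℝ)) ^ 2 = x := by
    rw [← ENNReal.rpow_natCast, ← ENNReal.rpow_mul]
    norm_num
  have hle (ℓ : ℝ) (hℓ : 0 < ℓ) (ξ : Space n) (hξ : ξ ∈ shell n ℓ) :
      ℓ ^ s ≤ K * (2 * Real.pi * ‖ξ‖) ^ s := by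
    have h1 := hξ.1
    have h2 := hξ.2
    have h0 : 0 < ‖ξ‖ := hℓ.trans_le h1
    rcases le_total 0 s with hs | hs
    · calc ℓ ^ s ≤ 1 * (2 * Real.pi * ‖ξ‖) ^ s := by
            rw [one_mul]
            exact Real.rpow_le_rpow hℓ.le (by nlinarith) hs
        _ ≤ _ := by
            gcongr
            exact Real.one_le_rpow (by linarith) (abs_nonneg s)
    · calc ℓ ^ s = K * (4 * Real.pi * ℓ) ^ s := by
            rw [Real.mul_rpow (by positivity) hℓ.le, ← mul_assoc, ← Real.rpow_add (by positivity),
              abs_of_nonpos hs, neg_add_cancel, Real.rpow_zero, one_mul]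
        _ ≤ _ := by
            refine mul_le_mul_of_nonneg_left ?_ (by positivity)
            exact Real.rpow_le_rpow_of_nonpos (by positivity) (by nlinarith) hs
  have hsob : sobolevNorm s f ^ 2
      = ∫⁻ ξ, ‖(2 * Real.pi * ‖ξ‖) ^ s • (𝓕 f : L2 n N) ξ‖ₑ ^ 2 := by
    rw [sobolevNorm, eLpNorm_eq_lintegral_rpow_enorm_toReal (by norm_num) (by norm_num)]
    simp only [ENNReal.toReal_ofNat, hsq, ENNReal.rpow_ofNat]
  rw [mul_pow, hsob, ← lintegral_const_mul' _ _ (by finiteness)]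
  refine le_trans (ENNReal.tsum_le_tsum fun j => ?_) (le_trans (lintegral_iUnion
    (fun j : ℤ => measurableSet_shell (n := n) ((2 : ℝ) ^ j)) pairwise_disjoint_shell _).ge
    (setLIntegral_le_lintegral _ _))
  rw [mul_pow, hsq, ← lintegral_const_mul' _ _ (by finiteness)]
  refine setLIntegral_mono' (measurableSet_shell _) fun ξ hξ => ?_
  rw [← mul_pow, ← mul_pow]
  refine pow_le_pow_left₀ zero_le ?_ 2
  rw [enorm_smul, ← mul_assoc, Real.enorm_of_nonneg (by positivity),
    ← ENNReal.ofReal_mul (by positivity)]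
  exact mul_le_mul_left (ENNReal.ofReal_le_ofReal (hle _ (by positivity) ξ hξ)) _

namespace Matrices

variable {m : ℝ}

/-- The estimate for data with frequencies in a set `S`: all that matters is the size of the group
speed on the shells that meet `S`. -/
theorem exists_mixedNorm_propagator_le [NeZero n] (𝔇 : Matrices n N) (hm : 0 < m) {p q : ℝ≥0∞}
    (hp : 2 ≤ p) (hq : 2 < q) (hq' : q < ∞)
    (hpq : p⁻¹.toReal < (n - 1) * (1 / 2 - q⁻¹.toReal)) {s C₀ : ℝ} (hC₀ : 0 < C₀)
    {S : Set (Space n)} (hS : ∀ ℓ : ℝ, 0 < ℓ → ∀ ξ ∈ shell n ℓ, ξ ∈ S →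
      ℓ ^ (n / 2 - n * q⁻¹.toReal - p⁻¹.toReal) * groupSpeed m ℓ ^ (-p⁻¹.toReal) ≤ C₀ * ℓ ^ s) :
    ∃ C : ℝ, 0 < C ∧ ∀ f : L2 n N, (∀ᵐ ξ, ξ ∉ S → (𝓕 f : L2 n N) ξ = 0) →
      mixedNorm p q (fun t => 𝔇.propagator m t f) ≤ ENNReal.ofReal C * sobolevNorm s f := by
  have hq0 : 0 < q⁻¹.toReal :=
    ENNReal.toReal_pos (ENNReal.inv_ne_zero.2 hq'.ne) (ENNReal.inv_ne_top.2 (by positivity))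
  have hn0 : (0 : ℝ) < n := by exact_mod_cast Nat.pos_of_ne_zero (NeZero.ne n)
  set δ := min (n * q⁻¹.toReal) ((n - 1) * (1 / 2 - q⁻¹.toReal) - p⁻¹.toReal)
  have hδ0 : 0 < δ := lt_min (by positivity) (by linarith)
  obtain ⟨D, hD, hdy⟩ := exists_dyadic_bound n (Spinor N) hp hq hq' (min_le_left _ _ : δ ≤ _)
    (min_le_right _ _)
  obtain ⟨K, hK, hsob⟩ := exists_tsum_shell_le_sobolevNorm (n := n) (N := N) s
  set κ : ℤ → ℝ≥0∞ := fun k => ENNReal.ofReal (min ((2 : ℝ) ^ k) ((2 : ℝ) ^ k)⁻¹ ^ δ)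
  have hT : ∑' k, κ k < ∞ := tsum_min_rpow_lt_top hδ0
  set T := (∑' k, κ k).toReal
  have hT' : ∑' k, κ k = ENNReal.ofReal T := (ENNReal.ofReal_toReal hT.ne).symm
  have hT0 : 0 ≤ T := ENNReal.toReal_nonneg
  refine ⟨2 * (D * C₀) * T * K + 1, by positivity, fun f hf => ?_⟩
  set a : ℤ → ℝ≥0∞ := fun j => ENNReal.ofReal (((2 : ℝ) ^ j) ^ s) *
      (∫⁻ ξ in shell n ((2 : ℝ) ^ j), ‖(𝓕 f : L2 n N) ξ‖ₑ ^ 2) ^ (1 / 2 : ℝ) with ha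
  set g : Bool → Space n → Spinor N := fun ε ξ => 𝔇.branchProj m ε ξ ((𝓕 f : L2 n N) ξ)
  have hg (ε : Bool) (ℓ : ℝ) : MemLp (g ε) 2 (volume.restrict (shell n ℓ)) :=
    (𝔇.memLp_branchProj m ε (𝓕 f)).restrict _
  choose b hbm hb1 hb2 using fun (i : ℤ × Bool) (k : ℤ) =>
    hdy (isDispersive_energy hm (ℓ := (2 : ℝ) ^ i.1) (by positivity) i.2) (hg i.2 _)
      (R := (2 : ℝ) ^ k) (by positivity)
  have hpiece (i : ℤ × Bool) (k : ℤ) :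
      eLpNorm (b i k) p volume ≤ ENNReal.ofReal (D * C₀) * (κ (i.1 + k) * a i.1) := by
    refine (hb2 i k).trans ?_
    have hℓ : (0 : ℝ) < 2 ^ i.1 := by positivity
    have hmono : ∫⁻ ξ in shell n ((2 : ℝ) ^ i.1), ‖g i.2 ξ‖ₑ ^ 2
        ≤ ∫⁻ ξ in shell n ((2 : ℝ) ^ i.1), ‖(𝓕 f : L2 n N) ξ‖ₑ ^ 2 := by
      refine lintegral_mono fun ξ => ?_
      gcongr
      exact enorm_le_iff_norm_le.2 (𝔇.norm_branchProj_apply_le m i.2 ξ _)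
    by_cases hne : ∃ ξ ∈ shell n ((2 : ℝ) ^ i.1), ξ ∈ S
    · obtain ⟨ξ, hξ, hξS⟩ := hne
      have h1 := hS _ hℓ ξ hξ hξS
      have h2 : (2 : ℝ) ^ k * 2 ^ i.1 = 2 ^ (i.1 + k) := by
        rw [zpow_add₀ (by norm_num), mul_comm]
      rw [h2]
      calc _ ≤ ENNReal.ofReal (D * min ((2 : ℝ) ^ (i.1 + k)) ((2 : ℝ) ^ (i.1 + k))⁻¹ ^ δ *
            (C₀ * ((2 : ℝ) ^ i.1) ^ s)) *
            (∫⁻ ξ in shell n ((2 : ℝ) ^ i.1), ‖(𝓕 f : L2 n N) ξ‖ₑ ^ 2) ^ (1 / 2 : ℝ) := by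
            gcongr
        _ = _ := by
            simp only [ha, κ]
            rw [← mul_assoc (ENNReal.ofReal _) (ENNReal.ofReal _) (_ * _),
              ← ENNReal.ofReal_mul (by positivity), ← mul_assoc (ENNReal.ofReal _) (ENNReal.ofReal _),
              ← ENNReal.ofReal_mul (by positivity)]
            congr 2
            ring
    · -- a shell that does not meet `S` carries no part of `f`
      have hz : ∫⁻ ξ in shell n ((2 : ℝ) ^ i.1), ‖(𝓕 f : L2 n N) ξ‖ₑ ^ 2 = 0 := by
        rw [← nonpos_iff_eq_zero, ← lintegral_zero (μ := volume.restrict (shell n ((2 : ℝ) ^ i.1)))]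
        refine lintegral_mono_ae ((ae_restrict_iff' (measurableSet_shell _)).2 ?_)
        filter_upwards [hf] with ξ h1 h2
        rw [h1 fun h => hne ⟨ξ, h2, h⟩]
        simp
      have hz' := le_antisymm (hmono.trans hz.le) zero_le
      rw [hz', ENNReal.zero_rpow_of_pos (by norm_num), mul_zero]
      exact zero_le
  have hsum (k : ℤ) : ∑' i, eLpNorm (b i k) p volume
      ≤ 2 * ENNReal.ofReal (D * C₀) * ∑' j, κ (j + k) * a j := by
    refine (ENNReal.tsum_le_tsum fun i => hpiece i k).trans (le_of_eq ?_)
    rw [ENNReal.tsum_prod', ← ENNReal.tsum_mul_left]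
    refine tsum_congr fun j => ?_
    rw [tsum_bool, ← two_mul, mul_assoc]
  have hmain := mixedNorm_le (N := N) hp hq.le hq' (F := fun t => 𝔇.propagator m t f)
    (fun (i : ℤ × Bool) t => (continuous_wave (isDispersive_energy hm
      (ℓ := (2 : ℝ) ^ i.1) (by positivity) i.2).measurable (integrableOn_shell (by positivity)
        (hg i.2 ((2 : ℝ) ^ i.1)))).comp (Continuous.prodMk_right t))
    (fun t => 𝔇.enorm_propagator_le_tsum hm f t) hbm hb1
  calc _ ≤ _ := hmain
    _ ≤ (∑' k : ℤ, (2 * ENNReal.ofReal (D * C₀) * ∑' j, κ (j + k) * a j) ^ 2) ^ (1 / 2 : ℝ) := by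
        gcongr with k
        exact hsum k
    _ ≤ ((2 * ENNReal.ofReal (D * C₀) * ENNReal.ofReal T *
          (ENNReal.ofReal K * sobolevNorm s f)) ^ 2) ^ (1 / 2 : ℝ) := by
        refine ENNReal.rpow_le_rpow ?_ (by norm_num)
        simp_rw [mul_pow _ (∑' j, _)]
        rw [ENNReal.tsum_mul_left, mul_pow _ (ENNReal.ofReal K * _), mul_pow _ (ENNReal.ofReal T),
          mul_assoc]
        refine mul_le_mul_right ((tsum_tsum_sq_le κ a).trans ?_) _
        rw [hT']
        exact mul_le_mul_right (hsob f) _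
    _ = ENNReal.ofReal (2 * (D * C₀) * T * K) * sobolevNorm s f := by
        rw [← ENNReal.rpow_natCast, ← ENNReal.rpow_mul,
          show ((2 : ℕ) : ℝ) * (1 / 2) = 1 by norm_num, ENNReal.rpow_one, ← mul_assoc, 
          ENNReal.ofReal_mul (p := 2 * (D * C₀) * T) (by positivity),
          ENNReal.ofReal_mul (p := 2 * (D * C₀)) (by positivity),
          ENNReal.ofReal_mul (p := 2) (by norm_num), ENNReal.ofReal_ofNat]
    _ ≤ _ := by
        gcongr
        linarith

/-- The frequencies of low energy. -/
def lowFreq (n : ℕ) (m : ℝ) : Set (Space n) := {ξ | energy m ξ ≤ m + 1}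

/-- The spectrum of `|𝒟|` on the frequency `ξ` is the single point `energy m ξ`, so the cutoff is
scalar. -/
theorem fourier_low_ae (𝔇 : Matrices n N) (hm : 0 < m) (u : L2 n N) :
    (𝓕 (𝔇.low m u) : L2 n N) =ᵐ[volume]
      (lowFreq n m).indicator ((𝓕 u : L2 n N) : Space n → Spinor N) := by
  unfold low funCalc
  rw [FourierTransform.fourier_fourierInv_eq]
  refine (MemLp.coeFn_toLp _).trans (ae_of_all _ fun ξ => ?_)
  have h0 := energy_pos hm ξ
  have h1 := le_energy m ξ
  dsimp only
  rw [funSymbol_eq, abs_neg, abs_of_pos h0, sub_self, zero_div, zero_smul ℂ (𝔇.symbol m ξ),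
    add_zero]
  by_cases h : energy m ξ ≤ m + 1
  · simp [indicator, lowFreq, h, h1]
  · simp [indicator, lowFreq, h]

theorem fourier_low_eq_zero (𝔇 : Matrices n N) (hm : 0 < m) (u : L2 n N) :
    ∀ᵐ ξ, ξ ∉ lowFreq n m → (𝓕 (𝔇.low m u) : L2 n N) ξ = 0 := by
  filter_upwards [𝔇.fourier_low_ae hm u] with ξ h1 h2
  rw [h1, indicator_of_notMem h2]

theorem fourier_high_eq_zero (𝔇 : Matrices n N) (hm : 0 < m) (u : L2 n N) :
    ∀ᵐ ξ, ξ ∉ (lowFreq n m)ᶜ → (𝓕 (𝔇.high m u) : L2 n N) ξ = 0 := by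
  have h : (𝓕 (𝔇.high m u) : L2 n N) = 𝓕 u - 𝓕 (𝔇.low m u) :=
    map_sub (Lp.fourierTransformₗᵢ (Space n) (Spinor N)) u (𝔇.low m u)
  rw [h]
  filter_upwards [𝔇.fourier_low_ae hm u, Lp.coeFn_sub (𝓕 u : L2 n N) (𝓕 (𝔇.low m u))]
    with ξ h1 h2 h3
  rw [h2, Pi.sub_apply, h1, indicator_of_mem (not_not.1 h3), sub_self]

/-- At low energy the group speed is comparable to the frequency. -/
theorem le_groupSpeed_of_mem_lowFreq (hm : 0 < m) {ℓ : ℝ} (hℓ : 0 < ℓ) {ξ : Space n}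
    (hξ : ξ ∈ shell n ℓ) (h : ξ ∈ lowFreq n m) :
    (2 * Real.pi) ^ 2 / (m + 1) * ℓ ≤ groupSpeed m ℓ := by
  have h1 : √((2 * Real.pi * ℓ) ^ 2 + m ^ 2) ≤ m + 1 := by
    refine le_trans (Real.sqrt_le_sqrt ?_) h
    have := hξ.1
    gcongr
  rw [groupSpeed, div_mul_eq_mul_div]
  have hE : 0 < √((2 * Real.pi * ℓ) ^ 2 + m ^ 2) := Real.sqrt_pos.2 (by positivity)
  gcongr

/-- At high energy the group speed is bounded below. -/
theorem le_groupSpeed_of_notMem_lowFreq (hm : 0 < m) {ℓ : ℝ} (hℓ : 0 < ℓ) {ξ : Space n}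
    (hξ : ξ ∈ shell n ℓ) (h : ξ ∉ lowFreq n m) :
    2 * Real.pi / √(1 + 2 * m) ≤ groupSpeed m ℓ := by
  have hE : 0 < √((2 * Real.pi * ℓ) ^ 2 + m ^ 2) := Real.sqrt_pos.2 (by positivity)
  have hM : 0 < √(1 + 2 * m) := Real.sqrt_pos.2 (by positivity)
  have h1 : (m + 1) ^ 2 < (2 * Real.pi * ‖ξ‖) ^ 2 + m ^ 2 := by
    rw [← energy_sq]
    exact pow_lt_pow_left₀ (not_le.1 h) (by positivity) (by norm_num)
  have h2 : (2 * Real.pi * ‖ξ‖) ^ 2 ≤ (2 * (2 * Real.pi * ℓ)) ^ 2 := by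
    have := hξ.2.le
    have := mul_le_mul_of_nonneg_left this (by positivity : 0 ≤ 2 * Real.pi)
    exact pow_le_pow_left₀ (by positivity) (by linarith) 2
  have h3 : √((2 * Real.pi * ℓ) ^ 2 + m ^ 2) ≤ 2 * Real.pi * ℓ * √(1 + 2 * m) := by
    refine Real.sqrt_le_iff.2 ⟨by positivity, ?_⟩
    rw [mul_pow _ (√_), Real.sq_sqrt (by positivity)]
    nlinarith
  rw [groupSpeed, div_le_div_iff₀ hM hE]
  calc _ ≤ 2 * Real.pi * (2 * Real.pi * ℓ * √(1 + 2 * m)) := by gcongr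
    _ = _ := by ring

/-- With `w ≳ ℓ`, the factor `w ^ (-1/p)` costs another `1/p` derivatives. -/
theorem exists_mixedNorm_low_le [NeZero n] (𝔇 : Matrices n N) (hm : 0 < m) {p q : ℝ≥0∞}
    (hp : 2 ≤ p) (hq : 2 < q) (hq' : q < ∞)
    (hpq : p⁻¹.toReal < (n - 1) * (1 / 2 - q⁻¹.toReal)) : ∃ C : ℝ, 0 < C ∧ ∀ u : L2 n N,
      mixedNorm p q (fun t => 𝔇.propagator m t (𝔇.low m u)) ≤ ENNReal.ofReal C *
        sobolevNorm (n / 2 - 2 * p⁻¹.toReal - n * q⁻¹.toReal) (𝔇.low m u) := by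
  have ha : 0 ≤ p⁻¹.toReal := ENNReal.toReal_nonneg
  set c := (2 * Real.pi) ^ 2 / (m + 1)
  have hc : 0 < c := by positivity
  obtain ⟨C, hC, h⟩ := 𝔇.exists_mixedNorm_propagator_le hm hp hq hq' hpq
    (s := n / 2 - 2 * p⁻¹.toReal - n * q⁻¹.toReal) (C₀ := c ^ (-p⁻¹.toReal)) (by positivity)
    (S := lowFreq n m) fun ℓ hℓ ξ hξ hS => by
      have h1 := le_groupSpeed_of_mem_lowFreq hm hℓ hξ hS
      calc _ ≤ ℓ ^ (n / 2 - n * q⁻¹.toReal - p⁻¹.toReal) * (c * ℓ) ^ (-p⁻¹.toReal) := by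
            refine mul_le_mul_of_nonneg_left ?_ (by positivity)
            exact Real.rpow_le_rpow_of_nonpos (by positivity) h1 (by linarith)
        _ = _ := by
            rw [Real.mul_rpow hc.le hℓ.le, mul_left_comm, ← Real.rpow_add hℓ]
            congr 2
            ring
  exact ⟨C, hC, fun u => h _ (𝔇.fourier_low_eq_zero hm u)⟩

/-- With `w ≳ 1`, the factor `w ^ (-1/p)` is harmless. -/
theorem exists_mixedNorm_high_le [NeZero n] (𝔇 : Matrices n N) (hm : 0 < m) {p q : ℝ≥0∞}
    (hp : 2 ≤ p) (hq : 2 < q) (hq' : q < ∞)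
    (hpq : p⁻¹.toReal < (n - 1) * (1 / 2 - q⁻¹.toReal)) : ∃ C : ℝ, 0 < C ∧ ∀ u : L2 n N,
      mixedNorm p q (fun t => 𝔇.propagator m t (𝔇.high m u)) ≤ ENNReal.ofReal C *
        sobolevNorm (n / 2 - p⁻¹.toReal - n * q⁻¹.toReal) (𝔇.high m u) := by
  have ha : 0 ≤ p⁻¹.toReal := ENNReal.toReal_nonneg
  have hM : 0 < √(1 + 2 * m) := Real.sqrt_pos.2 (by positivity)
  set c := 2 * Real.pi / √(1 + 2 * m)
  have hc : 0 < c := by positivity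
  obtain ⟨C, hC, h⟩ := 𝔇.exists_mixedNorm_propagator_le hm hp hq hq' hpq
    (s := n / 2 - p⁻¹.toReal - n * q⁻¹.toReal) (C₀ := c ^ (-p⁻¹.toReal)) (by positivity)
    (S := (lowFreq n m)ᶜ) fun ℓ hℓ ξ hξ hS => by
      have h1 := le_groupSpeed_of_notMem_lowFreq hm hℓ hξ hS
      calc _ ≤ ℓ ^ (n / 2 - n * q⁻¹.toReal - p⁻¹.toReal) * c ^ (-p⁻¹.toReal) := by
            refine mul_le_mul_of_nonneg_left ?_ (by positivity)
            exact Real.rpow_le_rpow_of_nonpos (by positivity) h1 (by linarith)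
        _ = _ := by
            rw [mul_comm]
            congr 2
            ring
  exact ⟨C, hC, fun u => h _ (𝔇.fourier_high_eq_zero hm u)⟩

/-- Plancherel's theorem. -/
theorem norm_funCalc_le (𝔇 : Matrices n N) (m : ℝ) {h : ℝ → ℂ} (hh : Measurable h)
    (h1 : ∀ E, ‖h E‖ ≤ 1) (f : L2 n N) : ‖𝔇.funCalc m h hh ⟨1, h1⟩ f‖ ≤ ‖f‖ := by
  unfold funCalc
  have hiso (g : L2 n N) : ‖(𝓕⁻ g : L2 n N)‖ = ‖g‖ :=
    (Lp.fourierTransformₗᵢ (Space n) (Spinor N)).symm.norm_map g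
  rw [hiso, ← Lp.norm_fourier_eq f]
  refine Lp.norm_le_norm_of_ae_le ?_
  filter_upwards [MemLp.coeFn_toLp (𝔇.memLp_funSymbol m hh ⟨1, h1⟩ (𝓕 f))] with ξ hξ
  rw [hξ]
  exact ((𝔇.funSymbol m h ξ).le_of_opNorm_le (𝔇.norm_funSymbol_le m h1 ξ) _).trans_eq (one_mul _)

end Matrices

/-- For `q = 2` the norm in polar coordinates is the `L²` norm. -/
theorem polarNorm_two [NeZero n] (f : L2 n N) : polarNorm 2 f = ‖f‖ₑ := by
  have hm : Measurable (f : Space n → Spinor N) := (Lp.stronglyMeasurable f).measurable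
  have hsq (x : ℝ≥0∞) : (x ^ (1 / 2 : ℝ)) ^ 2 = x := by
    rw [← ENNReal.rpow_natCast, ← ENNReal.rpow_mul]
    norm_num
  have hm' : Measurable fun z : Metric.sphere (0 : Space n) 1 × Ioi (0 : ℝ) =>
      ‖f (z.2.1 • z.1.1)‖ₑ ^ 2 := (hm.comp (by fun_prop)).enorm.pow_const 2
  rw [Lp.enorm_def, polarNorm, eLpNorm_eq_lintegral_rpow_enorm_toReal (by norm_num) (by norm_num),
    eLpNorm_eq_lintegral_rpow_enorm_toReal (by norm_num) (by norm_num)]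
  simp only [ENNReal.toReal_ofNat, ENNReal.rpow_ofNat, enorm_eq_self]
  rw [lintegral_polar_prod fun x => ‖f x‖ₑ ^ 2, lintegral_prod_symm _ hm'.aemeasurable]
  congr 1
  refine lintegral_congr fun r => ?_
  rw [eLpNorm_eq_lintegral_rpow_enorm_toReal (by norm_num) (by norm_num)]
  simp only [ENNReal.toReal_ofNat, ENNReal.rpow_ofNat, hsq]

theorem sobolevNorm_zero (f : L2 n N) : sobolevNorm 0 f = ‖f‖ₑ := by
  simp only [sobolevNorm, Real.rpow_zero, one_smul]
  rw [← Lp.enorm_def, ← ofReal_norm, Lp.norm_fourier_eq, ofReal_norm]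

/-- Conservation of charge. -/
theorem mixedNorm_top_two_le [NeZero n] (𝔇 : Matrices n N) (m : ℝ) (f : L2 n N) :
    mixedNorm ∞ 2 (fun t => 𝔇.propagator m t f) ≤ ENNReal.ofReal 1 * sobolevNorm 0 f := by
  rw [mixedNorm, eLpNorm_exponent_top, ENNReal.ofReal_one, one_mul, sobolevNorm_zero]
  refine essSup_le_of_ae_le _ (ae_of_all _ fun t => ?_)
  dsimp only
  rw [enorm_eq_self, polarNorm_two]
  refine enorm_le_iff_norm_le.2 (𝔇.norm_funCalc_le m _ (fun E => ?_) f)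
  rw [mul_assoc, ← Complex.ofReal_mul, mul_comm, Complex.norm_exp_ofReal_mul_I]

/-- The low and high energy estimates in any dimension, for exponents with
`1/p < (n - 1) (1/2 - 1/q)` and for the pair `(∞, 2)`. -/
theorem exists_mixedNorm_le [NeZero n] (𝔇 : Matrices n N) {m : ℝ} (hm : 0 < m) {p q : ℝ≥0∞}
    (h : (2 ≤ p ∧ 2 < q ∧ q < ∞ ∧ p⁻¹.toReal < (n - 1) * (1 / 2 - q⁻¹.toReal)) ∨
      (p = ∞ ∧ q = 2)) : ∃ C : ℝ, 0 < C ∧ ∀ u : L2 n N,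
      mixedNorm p q (fun t => 𝔇.propagator m t (𝔇.low m u)) ≤ ENNReal.ofReal C *
        sobolevNorm (n / 2 - 2 * p⁻¹.toReal - n * q⁻¹.toReal) (𝔇.low m u) ∧
      mixedNorm p q (fun t => 𝔇.propagator m t (𝔇.high m u)) ≤ ENNReal.ofReal C *
        sobolevNorm (n / 2 - p⁻¹.toReal - n * q⁻¹.toReal) (𝔇.high m u) := by
  rcases h with ⟨hp, hq, hq', hpq⟩ | ⟨rfl, rfl⟩
  · obtain ⟨C₁, h₁, hlow⟩ := 𝔇.exists_mixedNorm_low_le hm hp hq hq' hpq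
    obtain ⟨C₂, h₂, hhigh⟩ := 𝔇.exists_mixedNorm_high_le hm hp hq hq' hpq
    refine ⟨max C₁ C₂, lt_max_of_lt_left h₁, fun u => ⟨(hlow u).trans ?_, (hhigh u).trans ?_⟩⟩
    · gcongr
      exact le_max_left _ _
    · gcongr
      exact le_max_right _ _
  · have h1 : (n / 2 - 2 * (∞ : ℝ≥0∞)⁻¹.toReal - n * (2 : ℝ≥0∞)⁻¹.toReal : ℝ) = 0 := by
      simp [ENNReal.toReal_inv]
      ring
    have h2 : (n / 2 - (∞ : ℝ≥0∞)⁻¹.toReal - n * (2 : ℝ≥0∞)⁻¹.toReal : ℝ) = 0 := by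
      simp [ENNReal.toReal_inv]
      ring
    rw [h1, h2]
    exact ⟨1, one_pos, fun u => ⟨mixedNorm_top_two_le 𝔇 m _, mixedNorm_top_two_le 𝔇 m _⟩⟩

end

end Dirac

end

theorem theorem1p1 :
    (∀ (m : ℝ) (p q : ℝ≥0∞), 0 < m →
      (2 < p ∧ 2 ≤ q ∧ q < ∞ ∧ p⁻¹ + q⁻¹ < 2⁻¹) ∨ (p = ∞ ∧ q = 2) →
      ∃ C : ℝ, 0 < C ∧ ∀ u₀ : Dirac.L2 2 2,
        Dirac.mixedNorm p q
            (fun t => Dirac.matrices2.propagator m t (Dirac.matrices2.low m u₀)) ≤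
          ENNReal.ofReal C *
            Dirac.sobolevNorm (2 / 2 - 2 * p⁻¹.toReal - 2 * q⁻¹.toReal)
              (Dirac.matrices2.low m u₀) ∧
        Dirac.mixedNorm p q
            (fun t => Dirac.matrices2.propagator m t (Dirac.matrices2.high m u₀)) ≤
          ENNReal.ofReal C *
            Dirac.sobolevNorm (2 / 2 - p⁻¹.toReal - 2 * q⁻¹.toReal)
              (Dirac.matrices2.high m u₀)) ∧
    (∀ (m : ℝ) (p q : ℝ≥0∞), 0 < m →
      (2 ≤ p ∧ 2 ≤ q ∧ q < ∞ ∧ p⁻¹ + 2 * q⁻¹ < 1) ∨ (p = ∞ ∧ q = 2) →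
      ∃ C : ℝ, 0 < C ∧ ∀ u₀ : Dirac.L2 3 4,
        Dirac.mixedNorm p q
            (fun t => Dirac.matrices3.propagator m t (Dirac.matrices3.low m u₀)) ≤
          ENNReal.ofReal C *
            Dirac.sobolevNorm (3 / 2 - 2 * p⁻¹.toReal - 3 * q⁻¹.toReal)
              (Dirac.matrices3.low m u₀) ∧
        Dirac.mixedNorm p q
            (fun t => Dirac.matrices3.propagator m t (Dirac.matrices3.high m u₀)) ≤
          ENNReal.ofReal C *
            Dirac.sobolevNorm (3 / 2 - p⁻¹.toReal - 3 * q⁻¹.toReal)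
              (Dirac.matrices3.high m u₀)) := by
  -- the hypotheses on `1/p` and `1/q` as inequalities between real numbers; they force `q > 2`
  have toReal_lt {a b : ℝ≥0∞} (h : a < b) (hb : b ≠ ∞) : a.toReal < b.toReal :=
    (ENNReal.toReal_lt_toReal h.ne_top hb).2 h
  have two_lt {q : ℝ≥0∞} (h : q⁻¹ < 2⁻¹) : 2 < q := ENNReal.inv_lt_inv.1 h
  refine ⟨fun m p q hm h => ?_, fun m p q hm h => ?_⟩
  · obtain ⟨C, hC, hu⟩ := Dirac.exists_mixedNorm_le Dirac.matrices2 hm (p := p) (q := q) <|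
      h.imp_left fun ⟨hp, _, hq', hpq⟩ => by
        have h1 : p⁻¹ ≠ ∞ := (le_self_add.trans_lt hpq).ne_top
        have h2 : q⁻¹ ≠ ∞ := (le_add_self.trans_lt hpq).ne_top
        refine ⟨hp.le, two_lt (le_add_self.trans_lt hpq), hq', ?_⟩
        have h3 := toReal_lt hpq (by simp)
        rw [ENNReal.toReal_add h1 h2, ENNReal.toReal_inv 2, ENNReal.toReal_ofNat] at h3
        push_cast
        linarith
    exact ⟨C, hC, by exact_mod_cast hu⟩
  · obtain ⟨C, hC, hu⟩ := Dirac.exists_mixedNorm_le Dirac.matrices3 hm (p := p) (q := q) <|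
      h.imp_left fun ⟨hp, _, hq', hpq⟩ => by
        have h1 : p⁻¹ ≠ ∞ := (le_self_add.trans_lt hpq).ne_top
        have h4 : 2 * q⁻¹ < 1 := le_add_self.trans_lt hpq
        refine ⟨hp, two_lt ?_, hq', ?_⟩
        · by_contra h5
          have h6 := mul_le_mul_right (not_lt.1 h5) 2
          rw [ENNReal.mul_inv_cancel (by simp) (by simp)] at h6
          exact h6.not_gt h4
        have h3 := toReal_lt hpq (by simp)
        rw [ENNReal.toReal_add h1 h4.ne_top, ENNReal.toReal_mul, ENNReal.toReal_ofNat,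
          ENNReal.toReal_one] at h3
        push_cast
        linarith
    exact ⟨C, hC, by exact_mod_cast hu⟩
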